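/- Let $N\ge 2$, $1<p\le N$, $p'=p/(p-1)$, and let $\Omega\subset\mathbb R^N$ be a bounded connected open set with Lipschitz boundary. Let $\partial\Omega=\Gamma_n\cup\Gamma_d$ with $\Gamma_n\cap\Gamma_d=\emptyset$ and $\sigma(\Gamma_d)>0$, where $\sigma$ is the $(N-1)$-dimensional measure on $\partial\Omega$. Let $W^{1,p}_{\Gamma_d}(\Omega)$ be the space of functions in $W^{1,p}(\Omega)$ with null trace on $\Gamma_d$, and let $T_k(s)=\max(-k,\min(s,k))$. Let $\mathbf a:\Omega\times\mathbb R^N\to\mathbb R^N$, $\lambda:\Omega\times\mathbb R\to\mathbb R$ and $\Phi:\Omega\times\mathbb R\to\mathbb R^N$ be Carathéodory functions and assume that, for some $\alpha>0$, $\beta\in\mathbb R$, $d\in L^{p'}(\Omega)$ and measurable $b:\Omega\to\mathbb R$, for a.e. $x\in\Omega$: - $\mathbf a(x,\xi)\cdot\xi\ge\alpha|\xi|^p$ for all $\xi\in\mathbb R^N$; - $(\mathbf a(x,\xi)-\mathbf a(x,\xi'))\cdot(\xi-\xi')\ge 0$ for all $\xi,\xi'\in\mathbb R^N$; - $|\mathbf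 a(x,\xi)|\le\beta(|d(x)|+|\xi|^{p-1})$ for all $\xi\in\mathbb R^N$; - $\lambda(x,s)s\ge0$ for all $s\in\mathbb R$; - for every $k>0$ there is $c_k>0$, independent of $x$, with $|\lambda(x,s)|\le c_k$ for all $|s|\le k$; - $|\Phi(x,s)|\le|b(x)|(1+|s|)^{p-1}$ for all $s\in\mathbb R$; where $b\in L^{N/(p-1)}(\Omega)$ if $p<N$, and $\int_\Omega(1+|b|)^{N/(N-1)}(\ln(1+|b|))^{N-1}\,dx<\infty$ if $p=N$. Let $f\in L^1(\Omega)$. Assume moreover that for a.e. $x\in\Omega$ $$(\lambda(x,r)-\lambda(x,r'))(r-r')>0\qquad\text{for all } r\ne r' \text{ in } \mathbb R,$$ and that for every compact $C\subset\mathbb R$ there is $L_C>0$ such that, for a.e. $x\in\Omega$, $$|\Phi(x,r)-\Phi(x,r')|\le L_C\,|b(x)|\,|r-r'|\qquad\text{for all } r,r'\in C.$$ A measurable, a.e. finite function $u$ on $\Omega$ is called a renormalized solution of $$\lambda(x,u)-\operatorname{div}(\mathbf a(x,Du)+\Phi(x,u))=f\ \text{in }\Omega,\qquad(\mathbf a(x,Du)+\Phi(x,u))\cdot\mathbf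 n=0\ \text{on }\Gamma_n,\qquad u=0\ \text{on }\Gamma_d$$ if $T_k(u)\in W^{1,p}_{\Gamma_d}(\Omega)$ for all $k>0$, if $$\lim_{n\to\infty}\frac1n\int_{\{|u|<n\}}\mathbf a(x,Du)\cdot Du\,dx=0,$$ and if for every $h\in W^{1,\infty}(\mathbb R)$ with compact support and every $\varphi\in W^{1,p}_{\Gamma_d}(\Omega)\cap L^\infty(\Omega)$ $$\int_\Omega\lambda(x,u)\varphi h(u)\,dx+\int_\Omega h(u)\,(\mathbf a(x,Du)+\Phi(x,u))\cdot D\varphi\,dx+\int_\Omega\varphi h'(u)\,(\mathbf a(x,Du)+\Phi(x,u))\cdot Du\,dx=\int_\Omega f\varphi h(u)\,dx.$$ Here $Du$ is the a.e. unique measurable function $\Omega\to\mathbb R^N$ with $DT_k(u)=\mathbf 1_{\{|u|<k\}}Du$ a.e. in $\Omega$ for all $k>0$. Then the renormalized solution is unique: if $u$ and $v$ are two renormalized solutions of this problem, then $u=v$ a.e. in $\Omega$. -/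

import Mathlib

open MeasureTheory Filter Topology
open scoped NNReal ENNReal ContDiff RealInnerProductSpace

namespace RenormalizedUniqueness

/-- `ℝ^N` with its Euclidean structure. -/
abbrev Eu (N : ℕ) : Type := EuclideanSpace ℝ (Fin N)

/-- Lipschitz boundary: near each boundary point and in suitable orthonormal coordinates, `Ω` is the
open epigraph of a Lipschitz function (`e` is the vertical direction, `γ` a function on the
hyperplane orthogonal to it). -/
def HasLipschitzBoundary {N : ℕ} (Ω : Set (Eu N)) : Prop :=
  ∀ x₀ ∈ frontier Ω, ∃ e : Eu N, ‖e‖ = 1 ∧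
    ∃ (γ : (Submodule.span ℝ {e})ᗮ → ℝ) (K : ℝ≥0) (r : ℝ), LipschitzWith K γ ∧ 0 < r ∧
      ∀ y ∈ Metric.ball x₀ r,
        (y ∈ Ω ↔ γ ((Submodule.span ℝ {e})ᗮ.orthogonalProjectionOnto y) < ⟪e, y⟫)

/-- The `(N-1)`-dimensional measure, as Hausdorff measure (up to a positive constant factor, this is
the usual surface measure on a Lipschitz boundary). -/
noncomputable def surfaceMeasure (N : ℕ) : Measure (Eu N) := Measure.hausdorffMeasure ((N : ℝ) - 1)

/-- `G` is the weak (distributional) gradient of `u` in `Ω`. -/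
structure HasWeakGradient {N : ℕ} (Ω : Set (Eu N)) (u : Eu N → ℝ) (G : Eu N → Eu N) : Prop where
  locallyIntegrable : LocallyIntegrableOn u Ω volume
  locallyIntegrable_grad : LocallyIntegrableOn G Ω volume
  integral_eq : ∀ φ : Eu N → ℝ, ContDiff ℝ ∞ φ → HasCompactSupport φ → tsupport φ ⊆ Ω →
    ∀ e : Eu N, ∫ x in Ω, u x * fderiv ℝ φ x e = -∫ x in Ω, φ x * ⟪G x, e⟫

/-- `u ∈ W^{1,q}(Ω)`. -/
def MemW1 {N : ℕ} (Ω : Set (Eu N)) (q : ℝ≥0∞) (u : Eu N → ℝ) : Prop :=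
  MemLp u q (volume.restrict Ω) ∧
    ∃ G, HasWeakGradient Ω u G ∧ MemLp G q (volume.restrict Ω)

/-- `w n → u` in `W^{1,q}(Ω)`, for functions `w n` and `u` in that space. -/
def TendstoW1 {N : ℕ} (Ω : Set (Eu N)) (q : ℝ≥0∞) (w : ℕ → Eu N → ℝ) (u : Eu N → ℝ) : Prop :=
  ∃ (Gw : ℕ → Eu N → Eu N) (G : Eu N → Eu N),
    (∀ n, HasWeakGradient Ω (w n) (Gw n)) ∧ HasWeakGradient Ω u G ∧
    Tendsto (fun n => eLpNorm (w n - u) q (volume.restrict Ω)) atTop (𝓝 0) ∧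
    Tendsto (fun n => eLpNorm (Gw n - G) q (volume.restrict Ω)) atTop (𝓝 0)

/-- `g` is the trace on `∂Ω` of `u ∈ W^{1,q}(Ω)`. The trace operator is the continuous extension to
`W^{1,q}(Ω)` of the restriction map `w ↦ w|_{∂Ω} ∈ L^q(∂Ω)` on Lipschitz functions; this is
the graph of that extension. -/
def HasTrace {N : ℕ} (Ω : Set (Eu N)) (q : ℝ≥0∞) (u g : Eu N → ℝ) : Prop :=
  MemLp g q ((surfaceMeasure N).restrict (frontier Ω)) ∧
    ∃ w : ℕ → Eu N → ℝ, (∀ n, ∃ K : ℝ≥0, LipschitzWith K (w n)) ∧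
      TendstoW1 Ω q w u ∧
      Tendsto (fun n => eLpNorm (w n - g) q ((surfaceMeasure N).restrict (frontier Ω)))
        atTop (𝓝 0)

/-- `u ∈ W^{1,q}_{Γd}(Ω)`: `u ∈ W^{1,q}(Ω)` has null trace on `Γd`. -/
def MemW1Gamma {N : ℕ} (Ω Γd : Set (Eu N)) (q : ℝ≥0∞) (u : Eu N → ℝ) : Prop :=
  MemW1 Ω q u ∧ ∃ g, HasTrace Ω q u g ∧ ∀ᵐ x ∂(surfaceMeasure N), x ∈ Γd → g x = 0

/-- The truncation at height `±k`. -/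
noncomputable def trunc (k s : ℝ) : ℝ := max (-k) (min s k)

/-- `F : Ω × X → Y` is a Carathéodory function. -/
def IsCaratheodory {N : ℕ} (Ω : Set (Eu N)) {X Y : Type*} [TopologicalSpace X]
    [TopologicalSpace Y] [MeasurableSpace Y] (F : Eu N → X → Y) : Prop :=
  (∀ s, AEMeasurable (fun x => F x s) (volume.restrict Ω)) ∧
    ∀ᵐ x ∂(volume.restrict Ω), Continuous (F x)

/-- `v` is the gradient `Du` of a function `u` whose truncates have weak gradients:
`D T_k(u) = 1_{|u| < k} v` a.e. in `Ω` for all `k > 0`. -/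
def IsGeneralizedGradient {N : ℕ} (Ω : Set (Eu N)) (u : Eu N → ℝ) (v : Eu N → Eu N) : Prop :=
  AEMeasurable v (volume.restrict Ω) ∧
    ∀ k : ℝ, 0 < k →
      HasWeakGradient Ω (fun x => trunc k (u x)) ({x | |u x| < k}.indicator v)

/-- `u` is a renormalized solution of `lam(x,u) - div (a(x,Du) + Φ(x,u)) = f` in `Ω` with
`(a(x,Du) + Φ(x,u)) · n = 0` on `∂Ω \ Γd` and `u = 0` on `Γd`. The gradient `Du` is determined
a.e. by `u`. The functions `h ∈ W^{1,∞}(ℝ)` are represented by their Lipschitz representatives. -/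
def IsRenormalizedSolution {N : ℕ} (Ω Γd : Set (Eu N)) (p : ℝ) (a : Eu N → Eu N → Eu N)
    (lam : Eu N → ℝ → ℝ) (Φ : Eu N → ℝ → Eu N) (f : Eu N → ℝ) (u : Eu N → ℝ) : Prop :=
  AEMeasurable u (volume.restrict Ω) ∧
  (∀ k : ℝ, 0 < k → MemW1Gamma Ω Γd (ENNReal.ofReal p) (fun x => trunc k (u x))) ∧
  ∃ Du : Eu N → Eu N, IsGeneralizedGradient Ω u Du ∧
    Tendsto (fun n : ℕ => (1 / (n : ℝ)) * ∫ x in Ω ∩ {x | |u x| < n}, ⟪a x (Du x), Du x⟫)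
      atTop (𝓝 0) ∧
    ∀ h : ℝ → ℝ, (∃ K : ℝ≥0, LipschitzWith K h) → HasCompactSupport h →
    ∀ (φ : Eu N → ℝ) (Dφ : Eu N → Eu N), MemW1Gamma Ω Γd (ENNReal.ofReal p) φ →
      MemLp φ ∞ (volume.restrict Ω) → HasWeakGradient Ω φ Dφ →
      (∫ x in Ω, lam x (u x) * φ x * h (u x))
        + (∫ x in Ω, h (u x) * ⟪a x (Du x), Dφ x⟫)
        + (∫ x in Ω, h (u x) * ⟪Φ x (u x), Dφ x⟫)
        + (∫ x in Ω, φ x * deriv h (u x) * ⟪a x (Du x), Du x⟫)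
        + (∫ x in Ω, φ x * deriv h (u x) * ⟪Φ x (u x), Du x⟫)
      = ∫ x in Ω, f x * φ x * h (u x)

end RenormalizedUniqueness

namespace RenormalizedUniqueness

/-! Fix a level n and a C¹ cutoff h equal to 1 on [-n, n], to 0 off [-2n, 2n], with |h'| ≤ C/n. Test
the equation of u, renormalized by h, with h(v) arctan(m(T_{2n}u - T_{2n}v)), and the equation of v
with the same function after exchanging u and v. Since arctan is odd, the terms in f cancel in the
sum (`integral_renormalized_test`). Four contributions remain (`integral_cutoff_le`).

The zero-order term dominates the integral of h(u)h(v)(λ(x,u) - λ(x,v)) arctan(u - v) as soon as m ≥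
1. The term in a(x,Du) - a(x,Dv) is nonnegative by monotonicity. The term in Φ(x,u) - Φ(x,v) is at
most m|s|/(1 + (ms)²) times a fixed integrable function, with s = T_{2n}u - T_{2n}v, by the local
Lipschitz condition; it disappears as m → ∞. The terms containing h' are bounded, by Young's
inequality, by the energies of the truncations at height 2n divided by n, plus the tails n^{p-1} ∫
|b|^{p'} over {|u| ≥ n} and {|v| ≥ n} (`remainder_le`).

The energies divided by n tend to 0 by coercivity and the definition of a renormalized solution
(`tendsto_energy`). The heart of the proof is that the tails vanish too (`tendsto_weighted_tail`).
The Sobolev embedding of W^{1,1} into L^{N/(N-1)}, applied to a step function of u between levels s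
< t, gives |{|u| ≥ t}|^{1-1/N} ≤ C/(t-s) (∫_{s ≤ |u| < t} |Du|^p)^{1/p} |{|u| ≥ s}|^{1-1/p} for
large s (`exists_level_estimate`). If p < N, iterating over dyadic levels with energy o(n) yields
n^{p-1} |{|u| ≥ n}|^{1-p/N} → 0 along powers of 2, which is what Hölder's inequality requires for b
in L^{N/(p-1)}. If p = N, both measures carry the same exponent; iterating over unit levels gives
|{|u| ≥ 2n}| = O(e^{-Mn}) for every M, and the logarithmic integrability of b handles the set where
|b| is exponentially large.

Letting n run through powers of 2, Fatou's lemma gives (λ(x,u) - λ(x,v)) arctan(u - v) = 0 a.e., and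
strict monotonicity of λ forces u = v. -/

/-! ### Sobolev inequality for Lipschitz functions on a Lipschitz domain -/

/-- Near a point of the closure of a Lipschitz domain, the domain is stable under small positive
translations along a full set of linearly independent directions. -/
theorem exists_ball_forall_translate_mem {N : ℕ} {Ω : Set (Eu N)} (hΩo : IsOpen Ω)
    (hΩL : HasLipschitzBoundary Ω) {x₀ : Eu N} (hx₀ : x₀ ∈ closure Ω) :
    ∃ r > 0, ∃ L : (Fin N → ℝ) ≃L[ℝ] Eu N, ∀ y ∈ Ω, y ∈ Metric.ball x₀ r → ∀ i, ∀ t : ℝ, 0 ≤ t →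
      y + t • L (Pi.single i 1) ∈ Metric.ball x₀ r → y + t • L (Pi.single i 1) ∈ Ω := by
  by_cases hx : x₀ ∈ Ω
  · obtain ⟨r, hr, hrΩ⟩ := Metric.isOpen_iff.1 hΩo x₀ hx
    exact ⟨r, hr, (EuclideanSpace.equiv (Fin N) ℝ).symm, fun y _ _ i t _ h => hrΩ h⟩
  have hfr : x₀ ∈ frontier Ω := by
    rw [frontier, hΩo.interior_eq]; exact ⟨hx₀, hx⟩
  obtain ⟨e, he, γ, K, r, hγ, hr, hΩ⟩ := hΩL x₀ hfr
  -- The directions will be e_i + M e. With M ≥ K + 1 the height ⟪e, ·⟫ grows at rate at least M - 1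
  -- ≥ K, while γ grows at rate at most K. The number 1 + M ∑ e_i is the determinant of this family;
  -- it vanishes for at most one M, so K + 1 or K + 2 works.
  obtain ⟨M, hM, hM0⟩ : ∃ M : ℝ, (K : ℝ) + 1 ≤ M ∧ 1 + M * ∑ i, e i ≠ 0 := by
    by_cases h : 1 + ((K : ℝ) + 1) * ∑ i, e i = 0
    · refine ⟨K + 2, by linarith, fun h' => ?_⟩
      have h1 : ∑ i, e i = 0 := by linear_combination h' - h
      rw [h1] at h
      simp at h
    · exact ⟨K + 1, le_rfl, h⟩
  let L₀ : (Fin N → ℝ) →ₗ[ℝ] Eu N :=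
    { toFun := fun x => WithLp.toLp 2 x + (M * ∑ i, x i) • e
      map_add' := by
        intro x y
        simp only [Pi.add_apply, Finset.sum_add_distrib, WithLp.toLp_add]
        module
      map_smul' := by
        intro c x
        simp only [Pi.smul_apply, smul_eq_mul, ← Finset.mul_sum, WithLp.toLp_smul,
          RingHom.id_apply]
        module }
  have hL₀ : ∀ x, L₀ x = WithLp.toLp 2 x + (M * ∑ i, x i) • e := fun _ => rfl
  have hinj : Function.Injective L₀ := by
    rw [← LinearMap.ker_eq_bot, LinearMap.ker_eq_bot']
    intro x hx
    rw [hL₀] at hx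
    have hi : ∀ i, x i + (M * ∑ j, x j) * e i = 0 := fun i => by
      have := congrArg (fun z : Eu N => z i) hx
      simpa using this
    have hs : (∑ i, x i) * (1 + M * ∑ i, e i) = 0 := by
      have := Finset.sum_congr (rfl : (Finset.univ : Finset (Fin N)) = Finset.univ)
        (fun i _ => hi i)
      rw [Finset.sum_add_distrib, ← Finset.mul_sum, Finset.sum_const_zero] at this
      linear_combination this
    have hs0 : ∑ i, x i = 0 := (mul_eq_zero.1 hs).resolve_right hM0
    funext i
    have := hi i
    rw [hs0] at this
    simpa using this
  let L : (Fin N → ℝ) ≃L[ℝ] Eu N :=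
    (L₀.linearEquivOfInjective hinj (by simp)).toContinuousLinearEquiv
  have hL : ∀ x, L x = WithLp.toLp 2 x + (M * ∑ i, x i) • e := fun _ => rfl
  refine ⟨r, hr, L, fun y hy hyr i t ht hty => ?_⟩
  set P := (Submodule.span ℝ {e})ᗮ.orthogonalProjectionOnto with hP
  have hLi : L (Pi.single i 1) = EuclideanSpace.single i 1 + M • e := by
    rw [hL]; simp
  have hPe : P e = 0 :=
    Submodule.orthogonalProjectionOnto_orthogonal_apply_eq_zero (Submodule.mem_span_singleton_self e)
  have hinner : ⟪e, EuclideanSpace.single i (1 : ℝ)⟫ ≥ -1 := by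
    have h1 := abs_real_inner_le_norm e (EuclideanSpace.single i (1 : ℝ))
    rw [he] at h1
    simp only [PiLp.norm_single, norm_one, mul_one] at h1
    linarith [(abs_le.1 h1).1]
  have hPn : ‖P (EuclideanSpace.single i (1 : ℝ))‖ ≤ 1 := by
    refine (Submodule.norm_orthogonalProjectionOnto_apply_le _ _).trans ?_
    simp
  rw [hΩ _ hty]
  have hy' := (hΩ y hyr).1 hy
  have hlip : γ (P (y + t • L (Pi.single i 1))) ≤ γ (P y) + K * t := by
    have h1 := hγ.dist_le_mul (P (y + t • L (Pi.single i 1))) (P y)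
    have h2 : P (y + t • L (Pi.single i 1)) - P y = t • P (EuclideanSpace.single i (1 : ℝ)) := by
      rw [hLi, map_add, map_smul, map_add, map_smul, hPe, smul_zero, add_zero, add_sub_cancel_left]
    rw [Real.dist_eq, dist_eq_norm, h2, norm_smul, Real.norm_of_nonneg ht] at h1
    have h3 := le_of_abs_le h1
    have h4 : (K : ℝ) * (t * ‖P (EuclideanSpace.single i (1 : ℝ))‖) ≤ K * t := by
      gcongr
      exact mul_le_of_le_one_right ht hPn
    linarith
  have hin : ⟪e, y⟫ + t * (M - 1) ≤ ⟪e, y + t • L (Pi.single i 1)⟫ := by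
    rw [hLi, inner_add_right, inner_smul_right, inner_add_right, inner_smul_right,
      real_inner_self_eq_norm_sq, he]
    have : t * (M - 1) ≤ t * (⟪e, EuclideanSpace.single i (1 : ℝ)⟫ + M * 1 ^ 2) := by
      gcongr; linarith
    linarith
  have : (K : ℝ) * t ≤ t * (M - 1) := by
    rw [mul_comm]; gcongr; linarith
  linarith

/-- A Lipschitz function on the line is controlled by the integral of its derivative. -/
theorem enorm_le_lintegral_deriv_of_lipschitz {g : ℝ → ℝ} {K : ℝ≥0} (hg : LipschitzWith K g)
    {T : ℝ} (hT : 0 ≤ T) (hgT : g T = 0) : ‖g 0‖ₑ ≤ ∫⁻ t in Set.Ioc 0 T, ‖deriv g t‖ₑ := by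
  have hac : AbsolutelyContinuousOnInterval g 0 T :=
    (hg.lipschitzOnWith (s := Set.uIcc 0 T)).absolutelyContinuousOnInterval
  have h := hac.integral_deriv_eq_sub
  rw [hgT, zero_sub, intervalIntegral.integral_of_le hT] at h
  rw [← enorm_neg, ← h]
  exact enorm_integral_le_lintegral_enorm _

/-- A Lipschitz function supported in a ball is controlled on `Ω` by its derivative along half-lines
staying in `Ω`. -/
theorem enorm_le_lintegral_lineDeriv {N : ℕ} {Ω : Set (Eu N)} {x₀ : Eu N} {r : ℝ} (hr : 0 < r)
    {W : Eu N → ℝ} {K : ℝ≥0} (hW : LipschitzWith K W)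
    (hsupp : ∀ y, y ∉ Metric.closedBall x₀ (r / 2) → W y = 0) {v : Eu N} (hv : v ≠ 0) {y : Eu N}
    (h : y ∈ Metric.ball x₀ r → ∀ t : ℝ, 0 ≤ t → y + t • v ∈ Metric.ball x₀ r → y + t • v ∈ Ω) :
    ‖W y‖ₑ ≤ ∫⁻ t : ℝ, Ω.indicator (fun z => ‖lineDeriv ℝ W z v‖ₑ) (y + t • v) := by
  have hsub : Metric.closedBall x₀ (r / 2) ⊆ Metric.ball x₀ r :=
    Metric.closedBall_subset_ball (by linarith)
  by_cases hy : y ∈ Metric.ball x₀ r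
  swap
  · rw [hsupp y fun h' => hy (hsub h')]; simp
  have hv' : 0 < ‖v‖ := norm_pos_iff.2 hv
  -- At time T the half-line is at distance at least r from x₀, hence off the support of W.
  set T := (‖y - x₀‖ + r) / ‖v‖ with hT
  have hT0 : 0 ≤ T := by positivity
  have hWT : W (y + T • v) = 0 := by
    refine hsupp _ fun hmem => ?_
    rw [Metric.mem_closedBall, dist_eq_norm] at hmem
    have h1 : ‖T • v‖ = ‖y - x₀‖ + r := by
      rw [norm_smul, Real.norm_of_nonneg hT0, hT, div_mul_cancel₀ _ hv'.ne']
    have h2 : ‖T • v‖ ≤ ‖y + T • v - x₀‖ + ‖y - x₀‖ := by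
      have : T • v = (y + T • v - x₀) - (y - x₀) := by abel
      calc ‖T • v‖ = ‖(y + T • v - x₀) - (y - x₀)‖ := by rw [← this]
        _ ≤ _ := norm_sub_le _ _
    linarith
  have hlin : LipschitzWith ‖v‖₊ (fun t : ℝ => y + t • v) := by
    refine LipschitzWith.of_dist_le_mul fun s t => ?_
    rw [dist_eq_norm, add_sub_add_left_eq_sub, ← sub_smul, norm_smul, Real.dist_eq, mul_comm]
    rfl
  have hg : LipschitzWith (K * ‖v‖₊) (fun t : ℝ => W (y + t • v)) := hW.comp hlin
  have hkey := enorm_le_lintegral_deriv_of_lipschitz hg hT0 hWT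
  simp only [zero_smul, add_zero] at hkey
  refine hkey.trans ?_
  refine le_trans ?_ (setLIntegral_le_lintegral (Set.Ioc 0 T) _)
  refine setLIntegral_mono' measurableSet_Ioc fun t ht => ?_
  have hder : deriv (fun t : ℝ => W (y + t • v)) t = lineDeriv ℝ W (y + t • v) v := by
    rw [lineDeriv]
    have : (fun s : ℝ => W (y + t • v + s • v)) = fun s : ℝ => W (y + (t + s) • v) := by
      funext s; rw [add_smul, add_assoc]
    rw [this, deriv_comp_const_add (fun s : ℝ => W (y + s • v)) t 0, add_zero]
  rw [hder]
  by_cases hz : y + t • v ∈ Ω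
  · rw [Set.indicator_of_mem hz]
  -- Inside the large ball the half-line stays in Ω, so a point of it outside Ω lies off the small
  -- ball; there W vanishes locally and its derivative contributes nothing.
  have hnb : y + t • v ∉ Metric.closedBall x₀ (r / 2) := fun h' => hz (h hy t ht.1.le (hsub h'))
  have hev : W =ᶠ[𝓝 (y + t • v)] fun _ => 0 := by
    filter_upwards [Metric.isClosed_closedBall.isOpen_compl.mem_nhds hnb] with z hz
    exact hsupp z hz
  rw [hev.lineDeriv_eq]
  simp [lineDeriv]

/-- The local Gagliardo inequality in a region stable under translation along the images under `L`
of the coordinate directions. -/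
theorem exists_lintegral_rpow_le_lineDeriv {N : ℕ} (hN : 2 ≤ N) (L : (Fin N → ℝ) ≃L[ℝ] Eu N) :
    ∃ C : ℝ≥0, ∀ (Ω : Set (Eu N)) (x₀ : Eu N) (r : ℝ), MeasurableSet Ω → 0 < r →
      (∀ y ∈ Ω, y ∈ Metric.ball x₀ r → ∀ i, ∀ t : ℝ, 0 ≤ t →
        y + t • L (Pi.single i 1) ∈ Metric.ball x₀ r → y + t • L (Pi.single i 1) ∈ Ω) →
      ∀ (W : Eu N → ℝ) (K : ℝ≥0), LipschitzWith K W →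
      (∀ y, y ∉ Metric.closedBall x₀ (r / 2) → W y = 0) →
      ∫⁻ y in Ω, ‖W y‖ₑ ^ ((N : ℝ) / (N - 1)) ≤
        C * (∫⁻ y in Ω, ∑ i, ‖lineDeriv ℝ W y (L (Pi.single i 1))‖ₑ) ^ ((N : ℝ) / (N - 1)) := by
  classical
  have hN' : (2 : ℝ) ≤ N := by exact_mod_cast hN
  set q : ℝ := (N : ℝ) / (N - 1) with hq
  have hq0 : 0 ≤ q := div_nonneg (by linarith) (by linarith)
  have hconj : Real.HolderConjugate (Fintype.card (Fin N)) q := by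
    rw [Fintype.card_fin]
    exact (Real.holderConjugate_iff_eq_conjExponent (by linarith)).2 rfl
  let c := Measure.addHaarScalarFactor (volume : Measure (Eu N))
    ((volume : Measure (Fin N → ℝ)).map L)
  have hvol : (volume : Measure (Eu N)) = c • ((volume : Measure (Fin N → ℝ)).map L) :=
    Measure.isAddLeftInvariant_eq_smul ..
  have hc : 0 < c := Measure.addHaarScalarFactor_pos_of_isAddHaarMeasure ..
  have hInt : ∀ f : Eu N → ℝ≥0∞, Measurable f → ∫⁻ y, f y = c * ∫⁻ x, f (L x) := by
    intro f hf
    rw [hvol, lintegral_smul_measure, lintegral_map hf L.continuous.measurable]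
    rfl
  -- The change of variables by `L` multiplies integrals by c; the left side scales like c and the
  -- right side like c^q.
  refine ⟨c * (c⁻¹) ^ q, fun Ω x₀ r hΩ hr hprop W K hW hsupp => ?_⟩
  -- Only the derivative is extended by zero, not W. The half-line bound for points of Ω sees
  -- nothing else, so no extension operator is needed.
  set F : Eu N → ℝ≥0∞ := Ω.indicator fun y => ∑ i, ‖lineDeriv ℝ W y (L (Pi.single i 1))‖ₑ with hF
  have hFm : Measurable F := by
    refine Measurable.indicator ?_ hΩ
    refine Finset.measurable_sum _ fun i _ => ?_
    exact (measurable_lineDeriv hW.continuous).enorm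
  have hGm : Measurable (Ω.indicator fun y => ‖W y‖ₑ ^ q) :=
    ((hW.continuous.measurable.enorm).pow_const q).indicator hΩ
  rw [← lintegral_indicator hΩ, ← lintegral_indicator hΩ, hInt _ hGm]
  change _ ≤ _ * (∫⁻ y, F y) ^ q
  rw [hInt _ hFm]
  -- Gagliardo's argument: each coordinate direction bounds |W| by a one-dimensional integral of F,
  -- and the product of the N bounds to the power 1/(N-1) is integrated by the grid inequality.
  have hgrid := lintegral_prod_lintegral_pow_le (fun _ : Fin N => (volume : Measure ℝ)) hconj
    (hFm.comp L.continuous.measurable)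
  have hpt : ∀ x, (Ω.indicator fun y => ‖W y‖ₑ ^ q) (L x) ≤
      ∏ i, (∫⁻ xᵢ, (F ∘ L) (Function.update x i xᵢ)) ^
        ((1 : ℝ) / (Fintype.card (Fin N) - 1 : ℝ)) := by
    intro x
    by_cases hx : L x ∈ Ω
    swap
    · rw [Set.indicator_of_notMem hx]; exact zero_le
    rw [Set.indicator_of_mem hx]
    have h1 : ‖W (L x)‖ₑ ^ q =
        ∏ _i : Fin N, ‖W (L x)‖ₑ ^ ((1 : ℝ) / (Fintype.card (Fin N) - 1 : ℝ)) := by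
      rw [Finset.prod_const, ← ENNReal.rpow_natCast, ← ENNReal.rpow_mul, Finset.card_univ,
        Fintype.card_fin, hq]
      congr 1
      ring
    rw [h1]
    refine Finset.prod_le_prod' fun i _ => ?_
    refine ENNReal.rpow_le_rpow ?_ (by rw [Fintype.card_fin]; exact div_nonneg zero_le_one (by linarith))
    have hv : L (Pi.single i 1) ≠ 0 := by
      intro h0
      simp at h0
    have h2 := enorm_le_lintegral_lineDeriv hr hW hsupp hv (fun hb => hprop (L x) hx hb i)
    refine h2.trans ?_
    have h3 : ∀ s : ℝ, (F ∘ L) (Function.update x i s) = F (L x + (s - x i) • L (Pi.single i 1)) := by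
      intro s
      have : Function.update x i s = x + (s - x i) • (Pi.single i 1 : Fin N → ℝ) := by
        funext j
        by_cases hj : j = i
        · subst hj; simp
        · simp [hj]
      rw [Function.comp_apply, this, map_add, map_smul]
    simp_rw [h3]
    rw [lintegral_sub_right_eq_self (fun s : ℝ => F (L x + s • L (Pi.single i 1))) (x i)]
    refine lintegral_mono fun t => ?_
    refine Set.indicator_le_indicator ?_
    exact Finset.single_le_sum (f := fun j => ‖lineDeriv ℝ W (L x + t • L (Pi.single i 1))
      (L (Pi.single j 1))‖ₑ) (fun _ _ => zero_le) (Finset.mem_univ i)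
  calc (c : ℝ≥0∞) * ∫⁻ x, (Ω.indicator fun y => ‖W y‖ₑ ^ q) (L x)
      ≤ c * (∫⁻ x, F (L x)) ^ q := by
        gcongr
        exact (lintegral_mono hpt).trans hgrid
    _ = ↑(c * (c⁻¹) ^ q) * (c * ∫⁻ x, F (L x)) ^ q := by
        rw [ENNReal.mul_rpow_of_nonneg _ _ hq0, ENNReal.coe_mul, ENNReal.coe_rpow_of_nonneg _ hq0]
        rw [← mul_assoc, mul_assoc (c : ℝ≥0∞), ← ENNReal.mul_rpow_of_nonneg _ _ hq0,
          ← ENNReal.coe_mul, inv_mul_cancel₀ hc.ne']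
        simp

/-- The product of a Lipschitz function with a bounded Lipschitz function vanishing outside a set
where the first one is bounded is Lipschitz. -/
theorem lipschitzWith_mul_of_bound {X : Type*} [PseudoMetricSpace X] {η w : X → ℝ} {A K : ℝ≥0}
    (hη : LipschitzWith A η) (hw : LipschitzWith K w) {s : Set X} {b B : ℝ≥0}
    (hηs : ∀ x, x ∉ s → η x = 0) (hηb : ∀ x, |η x| ≤ b) (hB : ∀ x ∈ s, |w x| ≤ B) :
    LipschitzWith (A * B + b * K) (fun x => η x * w x) := by
  have key : ∀ x y, x ∈ s → |η x * w x - η y * w y| ≤ (A * B + b * K) * dist x y := by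
    intro x y hx
    have h1 : η x * w x - η y * w y = (η x - η y) * w x + η y * (w x - w y) := by ring
    have h2 : |η x - η y| ≤ A * dist x y := by simpa [Real.dist_eq] using hη.dist_le_mul x y
    have h3 : |w x - w y| ≤ K * dist x y := by simpa [Real.dist_eq] using hw.dist_le_mul x y
    calc |η x * w x - η y * w y| ≤ |η x - η y| * |w x| + |η y| * |w x - w y| := by
          rw [h1, ← abs_mul, ← abs_mul]; exact abs_add_le _ _
      _ ≤ (A * dist x y) * B + b * (K * dist x y) := by
          gcongr
          · exact hB x hx
          · exact hηb y
      _ = _ := by ring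
  refine LipschitzWith.of_dist_le_mul fun x y => ?_
  rw [Real.dist_eq]
  push_cast
  by_cases hx : x ∈ s
  · exact key x y hx
  by_cases hy : y ∈ s
  · rw [abs_sub_comm, dist_comm]; exact key y x hy
  · rw [hηs x hx, hηs y hy]
    simp only [zero_mul, sub_zero, abs_zero]
    positivity

theorem enorm_gradient {N : ℕ} (w : Eu N → ℝ) (y : Eu N) :
    ‖gradient w y‖ₑ = ‖fderiv ℝ w y‖ₑ := by
  rw [← ofReal_norm, ← ofReal_norm, gradient, LinearIsometryEquiv.norm_map]

/-- Localization of the Gagliardo inequality: it is applied to the product of w with a Lipschitz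
bump equal to 1 near x₀. The derivative falling on the bump costs the term in w on the right. -/
theorem exists_ball_lintegral_rpow_le {N : ℕ} (hN : 2 ≤ N) {Ω : Set (Eu N)} (hΩo : IsOpen Ω)
    (hΩL : HasLipschitzBoundary Ω) {x₀ : Eu N} (hx₀ : x₀ ∈ closure Ω) :
    ∃ r > 0, ∃ C : ℝ≥0, ∀ (w : Eu N → ℝ) (K : ℝ≥0), LipschitzWith K w →
      ∫⁻ y in Ω ∩ Metric.ball x₀ r, ‖w y‖ₑ ^ ((N : ℝ) / (N - 1)) ≤
        C * (∫⁻ y in Ω, (‖w y‖ₑ + ‖gradient w y‖ₑ)) ^ ((N : ℝ) / (N - 1)) := by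
  have hN' : (2 : ℝ) ≤ N := by exact_mod_cast hN
  set q : ℝ := (N : ℝ) / (N - 1) with hq
  have hq0 : 0 ≤ q := div_nonneg (by linarith) (by linarith)
  obtain ⟨r, hr, L, hL⟩ := exists_ball_forall_translate_mem hΩo hΩL hx₀
  obtain ⟨C, hC⟩ := exists_lintegral_rpow_le_lineDeriv hN L
  set A : ℝ≥0 := ⟨4 / r, by positivity⟩ with hA
  set η : Eu N → ℝ := fun y => max 0 (min 1 (2 - 4 / r * dist y x₀)) with hηdef
  have hη : LipschitzWith A η := by
    have h0 : LipschitzWith A (fun y : Eu N => 2 - 4 / r * dist y x₀) := by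
      refine LipschitzWith.of_dist_le_mul fun x y => ?_
      have h1 : |dist y x₀ - dist x x₀| ≤ dist x y := by
        rw [abs_sub_comm]; exact abs_dist_sub_le x y x₀
      have h2 : 2 - 4 / r * dist x x₀ - (2 - 4 / r * dist y x₀)
          = 4 / r * (dist y x₀ - dist x x₀) := by ring
      rw [Real.dist_eq, h2, abs_mul, abs_of_pos (by positivity : 0 < 4 / r)]
      exact mul_le_mul_of_nonneg_left h1 (by positivity)
    exact (h0.const_min 1).const_max 0
  have hη0 : ∀ y, 0 ≤ η y := fun y => le_max_left _ _
  have hη1 : ∀ y, η y ≤ 1 := fun y => max_le zero_le_one (min_le_left _ _)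
  have hηb : ∀ y, |η y| ≤ (1 : ℝ≥0) := fun y => by
    rw [abs_of_nonneg (hη0 y)]; exact hη1 y
  have hηs : ∀ y, y ∉ Metric.closedBall x₀ (r / 2) → η y = 0 := by
    intro y hy
    rw [Metric.mem_closedBall, not_le] at hy
    have : 2 - 4 / r * dist y x₀ ≤ 0 := by
      have : 2 ≤ 4 / r * dist y x₀ := by
        rw [div_mul_eq_mul_div, le_div_iff₀ hr]; linarith
      linarith
    exact max_eq_left ((min_le_right _ _).trans this)
  have hηone : ∀ y ∈ Metric.ball x₀ (r / 4), η y = 1 := by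
    intro y hy
    rw [Metric.mem_ball] at hy
    have : 1 ≤ 2 - 4 / r * dist y x₀ := by
      have : 4 / r * dist y x₀ ≤ 1 := by
        rw [div_mul_eq_mul_div, div_le_iff₀ hr]; linarith
      linarith
    simp only [hηdef]
    rw [min_eq_left this]; simp
  set B : ℝ≥0 := (1 + A) * ∑ i, ‖L (Pi.single i 1)‖₊ with hB
  refine ⟨r / 4, by positivity, C * B ^ q, fun w K hw => ?_⟩
  obtain ⟨D, hD⟩ : ∃ D : ℝ≥0, ∀ y ∈ Metric.closedBall x₀ (r / 2), |w y| ≤ D := by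
    obtain ⟨D, hD⟩ := (isCompact_closedBall x₀ (r / 2)).exists_bound_of_continuousOn
      hw.continuous.continuousOn
    exact ⟨D.toNNReal, fun y hy => (hD y hy).trans (Real.le_coe_toNNReal D)⟩
  have hW := lipschitzWith_mul_of_bound hη hw hηs hηb hD
  have h1 := hC Ω x₀ r hΩo.measurableSet hr hL _ _ hW
    (fun y hy => by simp only [hηs y hy, zero_mul])
  have h2 : ∫⁻ y in Ω ∩ Metric.ball x₀ (r / 4), ‖w y‖ₑ ^ q ≤ ∫⁻ y in Ω, ‖η y * w y‖ₑ ^ q := by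
    calc ∫⁻ y in Ω ∩ Metric.ball x₀ (r / 4), ‖w y‖ₑ ^ q
        = ∫⁻ y in Ω ∩ Metric.ball x₀ (r / 4), ‖η y * w y‖ₑ ^ q := by
          refine setLIntegral_congr_fun (hΩo.measurableSet.inter measurableSet_ball) fun y hy => ?_
          simp only [hηone y hy.2, one_mul]
      _ ≤ _ := lintegral_mono_set Set.inter_subset_left
  have h3 : ∫⁻ y in Ω, ∑ i, ‖lineDeriv ℝ (fun y => η y * w y) y (L (Pi.single i 1))‖ₑ ≤
      B * ∫⁻ y in Ω, (‖w y‖ₑ + ‖gradient w y‖ₑ) := by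
    rw [← lintegral_const_mul' _ _ ENNReal.coe_ne_top]
    refine lintegral_mono_ae (ae_restrict_of_ae ?_)
    filter_upwards [hw.ae_differentiableAt, hη.ae_differentiableAt] with y hwy hηy
    have hfd : fderiv ℝ (fun y => η y * w y) y = η y • fderiv ℝ w y + w y • fderiv ℝ η y :=
      fderiv_fun_mul hηy hwy
    have hA' : ‖fderiv ℝ η y‖ₑ ≤ A := by
      rw [← ofReal_norm]
      exact ENNReal.ofReal_le_of_le_toReal (norm_fderiv_le_of_lipschitz ℝ hη)
    have hfd' : ‖fderiv ℝ (fun y => η y * w y) y‖ₑ ≤ (1 + A) * (‖w y‖ₑ + ‖gradient w y‖ₑ) := by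
      rw [hfd, enorm_gradient]
      refine (enorm_add_le (η y • fderiv ℝ w y) (w y • fderiv ℝ η y)).trans ?_
      rw [enorm_smul, enorm_smul]
      have hη1' : ‖η y‖ₑ ≤ 1 := by
        rw [← ofReal_norm]; exact ENNReal.ofReal_le_one.2 (hηb y)
      calc ‖η y‖ₑ * ‖fderiv ℝ w y‖ₑ + ‖w y‖ₑ * ‖fderiv ℝ η y‖ₑ
          ≤ 1 * ‖fderiv ℝ w y‖ₑ + ‖w y‖ₑ * A := by gcongr
        _ ≤ (1 * ‖fderiv ℝ w y‖ₑ + ‖w y‖ₑ * A) + (‖w y‖ₑ + A * ‖fderiv ℝ w y‖ₑ) := le_self_add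
        _ = _ := by ring
    calc ∑ i, ‖lineDeriv ℝ (fun y => η y * w y) y (L (Pi.single i 1))‖ₑ
        ≤ ∑ i, ‖fderiv ℝ (fun y => η y * w y) y‖ₑ * ‖L (Pi.single i 1)‖ₑ := by
          refine Finset.sum_le_sum fun i _ => ?_
          rw [(hηy.fun_mul hwy).lineDeriv_eq_fderiv]
          exact ContinuousLinearMap.le_opENorm _ _
      _ = ‖fderiv ℝ (fun y => η y * w y) y‖ₑ * ∑ i, ‖L (Pi.single i 1)‖ₑ := by
          rw [Finset.mul_sum]
      _ ≤ ((1 + A) * (‖w y‖ₑ + ‖gradient w y‖ₑ)) * ∑ i, ‖L (Pi.single i 1)‖ₑ := by gcongr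
      _ = B * (‖w y‖ₑ + ‖gradient w y‖ₑ) := by
          rw [hB]
          push_cast
          simp only [enorm_eq_nnnorm]
          ring
  calc _ ≤ _ := h2
    _ ≤ _ := h1
    _ ≤ C * (B * ∫⁻ y in Ω, (‖w y‖ₑ + ‖gradient w y‖ₑ)) ^ q := by gcongr
    _ = _ := by
      rw [ENNReal.mul_rpow_of_nonneg _ _ hq0, ENNReal.coe_mul C, ENNReal.coe_rpow_of_nonneg _ hq0,
        mul_assoc]

/-- The Sobolev inequality `W^{1,1}(Ω) ⊆ L^{N/(N-1)}(Ω)` on a bounded Lipschitz domain, for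
Lipschitz functions. -/
theorem exists_eLpNorm_le_of_lipschitzWith {N : ℕ} (hN : 2 ≤ N) {Ω : Set (Eu N)} (hΩo : IsOpen Ω)
    (hΩb : Bornology.IsBounded Ω) (hΩL : HasLipschitzBoundary Ω) :
    ∃ C : ℝ≥0, ∀ (w : Eu N → ℝ) (K : ℝ≥0), LipschitzWith K w →
      eLpNorm w (ENNReal.ofReal ((N : ℝ) / (N - 1))) (volume.restrict Ω) ≤
        C * (eLpNorm w 1 (volume.restrict Ω) + eLpNorm (gradient w) 1 (volume.restrict Ω)) := by
  have hN' : (2 : ℝ) ≤ N := by exact_mod_cast hN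
  set q : ℝ := (N : ℝ) / (N - 1) with hq
  have hq0 : 0 < q := div_pos (by linarith) (by linarith)
  obtain ⟨C, hC⟩ : ∃ C : ℝ≥0, ∀ (w : Eu N → ℝ) (K : ℝ≥0), LipschitzWith K w →
      ∫⁻ y in Ω ∩ closure Ω, ‖w y‖ₑ ^ q ≤
        C * (∫⁻ y in Ω, (‖w y‖ₑ + ‖gradient w y‖ₑ)) ^ q := by
    -- Finitely many of the local balls cover the closure, and the constants add up over a union.
    refine hΩb.isCompact_closure.induction_on (p := fun s => ∃ C : ℝ≥0, ∀ (w : Eu N → ℝ)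
      (K : ℝ≥0), LipschitzWith K w → ∫⁻ y in Ω ∩ s, ‖w y‖ₑ ^ q ≤
        C * (∫⁻ y in Ω, (‖w y‖ₑ + ‖gradient w y‖ₑ)) ^ q) ?_ ?_ ?_ ?_
    · exact ⟨0, fun w K hw => by simp⟩
    · rintro s t hst ⟨C, hC⟩
      exact ⟨C, fun w K hw => (lintegral_mono_set (Set.inter_subset_inter_right _ hst)).trans
        (hC w K hw)⟩
    · rintro s t ⟨C, hC⟩ ⟨D, hD⟩
      refine ⟨C + D, fun w K hw => ?_⟩
      rw [Set.inter_union_distrib_left, ENNReal.coe_add, add_mul]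
      exact (lintegral_union_le _ _ _).trans (add_le_add (hC w K hw) (hD w K hw))
    · intro x hx
      obtain ⟨r, hr, C, hC⟩ := exists_ball_lintegral_rpow_le hN hΩo hΩL hx
      exact ⟨Metric.ball x r, mem_nhdsWithin_of_mem_nhds (Metric.ball_mem_nhds x hr), C, hC⟩
  refine ⟨C ^ (1 / q), fun w K hw => ?_⟩
  have h := hC w K hw
  rw [Set.inter_eq_left.2 subset_closure] at h
  rw [eLpNorm_eq_lintegral_rpow_enorm_toReal (by simpa using hq0) ENNReal.ofReal_ne_top,
    ENNReal.toReal_ofReal hq0.le, eLpNorm_one_eq_lintegral_enorm, eLpNorm_one_eq_lintegral_enorm,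
    ← lintegral_add_left hw.continuous.measurable.enorm]
  calc _ ≤ (C * (∫⁻ y in Ω, (‖w y‖ₑ + ‖gradient w y‖ₑ)) ^ q) ^ (1 / q) := by gcongr
    _ = _ := by
      rw [ENNReal.mul_rpow_of_nonneg _ _ (by positivity), ← ENNReal.rpow_mul,
        mul_one_div_cancel hq0.ne', ENNReal.rpow_one, ENNReal.coe_rpow_of_nonneg _ (by positivity)]

/-! ### Weak gradients and approximation by Lipschitz functions -/

theorem inner_gradient {N : ℕ} (w : Eu N → ℝ) (x e : Eu N) : ⟪gradient w x, e⟫ = fderiv ℝ w x e := by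
  rw [gradient, InnerProductSpace.toDual_symm_apply]

theorem measurable_gradient {N : ℕ} (w : Eu N → ℝ) : Measurable (gradient w) :=
  (InnerProductSpace.toDual ℝ (Eu N)).symm.continuous.measurable.comp (measurable_fderiv ℝ w)

theorem norm_gradient_le_of_lipschitzWith {N : ℕ} {w : Eu N → ℝ} {K : ℝ≥0} (hw : LipschitzWith K w)
    (x : Eu N) : ‖gradient w x‖ ≤ K := by
  rw [gradient, LinearIsometryEquiv.norm_map]
  exact norm_fderiv_le_of_lipschitz ℝ hw

/-- The a.e. gradient of a Lipschitz function is its weak gradient. -/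
theorem hasWeakGradient_of_lipschitzWith {N : ℕ} (Ω : Set (Eu N)) {w : Eu N → ℝ} {K : ℝ≥0}
    (hw : LipschitzWith K w) : HasWeakGradient Ω w (gradient w) where
  locallyIntegrable := hw.continuous.locallyIntegrable.locallyIntegrableOn Ω
  locallyIntegrable_grad := by
    refine LocallyIntegrable.locallyIntegrableOn ?_ Ω
    exact (memLp_top_of_bound (measurable_gradient w).aestronglyMeasurable K
      (.of_forall fun x => norm_gradient_le_of_lipschitzWith hw x)).locallyIntegrable le_top
  integral_eq := by
    intro φ hφ hφc hφΩ e
    have h0 : ∀ x, x ∉ Ω → φ x = 0 := fun x hx => image_eq_zero_of_notMem_tsupport fun h => hx (hφΩ h)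
    have h1 : ∀ x, x ∉ Ω → fderiv ℝ φ x = 0 := fun x hx => by
      by_contra h
      exact hx (hφΩ (support_fderiv_subset ℝ h))
    rw [setIntegral_eq_integral_of_forall_compl_eq_zero fun x hx => by simp [h1 x hx],
      setIntegral_eq_integral_of_forall_compl_eq_zero fun x hx => by simp [h0 x hx]]
    obtain ⟨D, hD⟩ := hφ.lipschitzWith_of_hasCompactSupport hφc (by simp)
    have h := hw.integral_lineDeriv_mul_eq (μ := volume) hD hφc e
    have h2 : ∫ x, lineDeriv ℝ w x e * φ x = ∫ x, φ x * ⟪gradient w x, e⟫ := by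
      refine integral_congr_ae ?_
      filter_upwards [hw.ae_differentiableAt] with x hx
      rw [hx.lineDeriv_eq_fderiv, inner_gradient, mul_comm]
    have h3 : ∫ x, lineDeriv ℝ φ x (-e) * w x = -∫ x, w x * fderiv ℝ φ x e := by
      rw [← integral_neg]
      refine integral_congr_ae (.of_forall fun x => ?_)
      simp only [((hφ.differentiable (by simp)) x).lineDeriv_eq_fderiv, map_neg]
      ring
    rw [← h2, h, h3, neg_neg]

/-- Weak gradients are unique. -/
theorem HasWeakGradient.ae_eq {N : ℕ} {Ω : Set (Eu N)} (hΩo : IsOpen Ω) {u : Eu N → ℝ}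
    {G G' : Eu N → Eu N} (h : HasWeakGradient Ω u G) (h' : HasWeakGradient Ω u G') :
    G =ᵐ[volume.restrict Ω] G' := by
  have hloc : ∀ {H : Eu N → Eu N}, LocallyIntegrableOn H Ω → ∀ φ : Eu N → ℝ, ContDiff ℝ ∞ φ →
      HasCompactSupport φ → tsupport φ ⊆ Ω → Integrable (fun x => φ x • H x) := by
    intro H hH φ hφ hφc hφΩ
    have hK : IntegrableOn H (tsupport φ) := hH.integrableOn_compact_subset hφΩ hφc
    have h1 : IntegrableOn (fun x => φ x • H x) (tsupport φ) :=
      hK.continuousOn_smul hφ.continuous.continuousOn hφc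
    refine (integrableOn_iff_integrable_of_support_subset ?_).1 h1
    refine (Function.support_smul_subset_left _ _).trans (subset_tsupport φ)
  have key : ∀ᵐ x ∂volume, x ∈ Ω → G x - G' x = 0 := by
    refine hΩo.ae_eq_zero_of_integral_contDiff_smul_eq_zero
      (h.locallyIntegrable_grad.sub h'.locallyIntegrable_grad) fun φ hφ hφc hφΩ => ?_
    have h0 : ∀ x, x ∉ Ω → φ x = 0 := fun x hx => image_eq_zero_of_notMem_tsupport fun h => hx (hφΩ h)
    have i1 := hloc h.locallyIntegrable_grad φ hφ hφc hφΩ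
    have i2 := hloc h'.locallyIntegrable_grad φ hφ hφc hφΩ
    refine ext_inner_right ℝ fun e => ?_
    have hcalc : ∀ {H : Eu N → Eu N}, Integrable (fun x => φ x • H x) →
        ⟪∫ x, φ x • H x, e⟫ = ∫ x in Ω, φ x * ⟪H x, e⟫ := by
      intro H hH
      rw [setIntegral_eq_integral_of_forall_compl_eq_zero fun x hx => by simp [h0 x hx],
        real_inner_comm, ← integral_inner hH]
      refine integral_congr_ae (.of_forall fun x => ?_)
      simp only [inner_smul_right, real_inner_comm]
    simp only [smul_sub]
    rw [integral_sub i1 i2, inner_sub_left, hcalc i1, hcalc i2, inner_zero_left]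
    have e1 := h.integral_eq φ hφ hφc hφΩ e
    have e2 := h'.integral_eq φ hφ hφc hφΩ e
    linarith
  rw [EventuallyEq, ae_restrict_iff' hΩo.measurableSet]
  filter_upwards [key] with x hx hxΩ
  exact sub_eq_zero.1 (hx hxΩ)

/-- `w` is a sequence of Lipschitz functions converging in `W^{1,q}(Ω)` and almost everywhere to
`u`, whose gradient is `G`. -/
structure LipApprox {N : ℕ} (Ω : Set (Eu N)) (q : ℝ≥0∞) (w : ℕ → Eu N → ℝ) (u : Eu N → ℝ)
    (G : Eu N → Eu N) : Prop where
  lip : ∀ n, ∃ K : ℝ≥0, LipschitzWith K (w n)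
  memLp : MemLp u q (volume.restrict Ω)
  memLp_grad : MemLp G q (volume.restrict Ω)
  tendsto : Tendsto (fun n => eLpNorm (w n - u) q (volume.restrict Ω)) atTop (𝓝 0)
  tendsto_grad : Tendsto (fun n => eLpNorm (gradient (w n) - G) q (volume.restrict Ω)) atTop (𝓝 0)
  ae_tendsto : ∀ᵐ x ∂(volume.restrict Ω), Tendsto (fun n => w n x) atTop (𝓝 (u x))

theorem tendsto_eLpNorm_one_of_tendsto_eLpNorm {X F : Type*} [MeasurableSpace X]
    [NormedAddCommGroup F] {μ : Measure X} [IsFiniteMeasure μ] {q : ℝ≥0∞} (hq : 1 ≤ q)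
    (f : ℕ → X → F) (g : X → F) (hf : ∀ n, AEStronglyMeasurable (f n) μ)
    (hg : AEStronglyMeasurable g μ)
    (hlim : Tendsto (fun n => eLpNorm (f n - g) q μ) atTop (𝓝 0)) :
    Tendsto (fun n => eLpNorm (f n - g) 1 μ) atTop (𝓝 0) := by
  set c := μ Set.univ ^ (1 / (1 : ℝ≥0∞).toReal - 1 / q.toReal) with hc
  have hcne : c ≠ ⊤ := by
    refine ENNReal.rpow_ne_top_of_nonneg ?_ (measure_ne_top _ _)
    rw [ENNReal.toReal_one, div_one, sub_nonneg]
    rcases eq_or_ne q ⊤ with rfl | hq'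
    · simp
    · have : (1 : ℝ) ≤ q.toReal := by
        rw [← ENNReal.toReal_one]; exact (ENNReal.toReal_le_toReal (by simp) hq').2 hq
      rw [div_le_one (by linarith)]; exact this
  have h2 : Tendsto (fun n => eLpNorm (f n - g) q μ * c) atTop (𝓝 0) := by
    have := ENNReal.Tendsto.mul_const hlim (Or.inr hcne)
    simpa using this
  exact tendsto_of_tendsto_of_tendsto_of_le_of_le tendsto_const_nhds h2 (fun _ => zero_le)
    fun n => eLpNorm_le_eLpNorm_mul_rpow_measure_univ hq ((hf n).sub hg)

/-- The Sobolev inequality for limits of Lipschitz functions. -/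
theorem exists_eLpNorm_le_of_lipApprox {N : ℕ} (hN : 2 ≤ N) {Ω : Set (Eu N)} (hΩo : IsOpen Ω)
    (hΩb : Bornology.IsBounded Ω) (hΩL : HasLipschitzBoundary Ω) :
    ∃ C : ℝ≥0, ∀ (q : ℝ≥0∞) (w : ℕ → Eu N → ℝ) (u : Eu N → ℝ) (G : Eu N → Eu N), 1 ≤ q →
      LipApprox Ω q w u G →
      eLpNorm u (ENNReal.ofReal ((N : ℝ) / (N - 1))) (volume.restrict Ω) ≤
        C * (eLpNorm u 1 (volume.restrict Ω) + eLpNorm G 1 (volume.restrict Ω)) := by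
  obtain ⟨C, hC⟩ := exists_eLpNorm_le_of_lipschitzWith hN hΩo hΩb hΩL
  refine ⟨C, fun q w u G hq h => ?_⟩
  have : IsFiniteMeasure (volume.restrict Ω) := ⟨by simpa using hΩb.measure_lt_top⟩
  have hwm : ∀ n, AEStronglyMeasurable (w n) (volume.restrict Ω) := fun n => by
    obtain ⟨K, hK⟩ := h.lip n
    exact hK.continuous.aestronglyMeasurable
  have hgm : ∀ n, AEStronglyMeasurable (gradient (w n)) (volume.restrict Ω) := fun n =>
    (measurable_gradient _).aestronglyMeasurable
  have t1 := tendsto_eLpNorm_one_of_tendsto_eLpNorm hq w u hwm h.memLp.1 h.tendsto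
  have t2 := tendsto_eLpNorm_one_of_tendsto_eLpNorm hq (fun n => gradient (w n)) G hgm h.memLp_grad.1 h.tendsto_grad
  -- No convergence in L^{N/(N-1)} is known beforehand; a.e. convergence and Fatou suffice on the
  -- left, while the right side converges in L¹.
  have hfatou := Lp.eLpNorm_lim_le_liminf_eLpNorm (p := ENNReal.ofReal ((N : ℝ) / (N - 1))) hwm u
    h.ae_tendsto
  have hbd : ∀ n, eLpNorm (w n) (ENNReal.ofReal ((N : ℝ) / (N - 1))) (volume.restrict Ω) ≤
      C * ((eLpNorm (w n - u) 1 (volume.restrict Ω) + eLpNorm u 1 (volume.restrict Ω)) +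
        (eLpNorm (gradient (w n) - G) 1 (volume.restrict Ω) +
          eLpNorm G 1 (volume.restrict Ω))) := by
    intro n
    obtain ⟨K, hK⟩ := h.lip n
    refine (hC _ _ hK).trans ?_
    gcongr
    · calc eLpNorm (w n) 1 (volume.restrict Ω)
          = eLpNorm ((w n - u) + u) 1 (volume.restrict Ω) := by rw [sub_add_cancel]
        _ ≤ _ := eLpNorm_add_le ((hwm n).sub h.memLp.1) h.memLp.1 le_rfl
    · calc eLpNorm (gradient (w n)) 1 (volume.restrict Ω)
          = eLpNorm ((gradient (w n) - G) + G) 1 (volume.restrict Ω) := by rw [sub_add_cancel]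
        _ ≤ _ := eLpNorm_add_le ((hgm n).sub h.memLp_grad.1) h.memLp_grad.1 le_rfl
  refine hfatou.trans ?_
  have hlim : Tendsto (fun n =>
      (C : ℝ≥0∞) * ((eLpNorm (w n - u) 1 (volume.restrict Ω) + eLpNorm u 1 (volume.restrict Ω)) +
        (eLpNorm (gradient (w n) - G) 1 (volume.restrict Ω) +
          eLpNorm G 1 (volume.restrict Ω)))) atTop
      (𝓝 (C * ((0 + eLpNorm u 1 (volume.restrict Ω)) + (0 + eLpNorm G 1 (volume.restrict Ω))))) := by
    refine ENNReal.Tendsto.const_mul ?_ (Or.inr ENNReal.coe_ne_top)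
    exact (t1.add_const _).add (t2.add_const _)
  rw [zero_add, zero_add] at hlim
  rw [← hlim.liminf_eq]
  exact liminf_le_liminf (.of_forall hbd)

/-- Integration by parts survives the limit: the functions and gradients converge in L¹, and the
test function and its derivatives are bounded. -/
theorem LipApprox.hasWeakGradient {N : ℕ} {Ω : Set (Eu N)}
    (hΩb : Bornology.IsBounded Ω) {q : ℝ≥0∞} (hq : 1 ≤ q) {w : ℕ → Eu N → ℝ} {u : Eu N → ℝ}
    {G : Eu N → Eu N} (h : LipApprox Ω q w u G) : HasWeakGradient Ω u G := by
  have : IsFiniteMeasure (volume.restrict Ω) := ⟨by simpa using hΩb.measure_lt_top⟩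
  have hui : IntegrableOn u Ω := h.memLp.integrable hq
  have hGi : IntegrableOn G Ω := h.memLp_grad.integrable hq
  refine ⟨hui.locallyIntegrableOn, hGi.locallyIntegrableOn, fun φ hφ hφc hφΩ e => ?_⟩
  have hwm : ∀ n, AEStronglyMeasurable (w n) (volume.restrict Ω) := fun n => by
    obtain ⟨K, hK⟩ := h.lip n
    exact hK.continuous.aestronglyMeasurable
  have hgm : ∀ n, AEStronglyMeasurable (gradient (w n)) (volume.restrict Ω) := fun n =>
    (measurable_gradient _).aestronglyMeasurable
  have t1 := tendsto_eLpNorm_one_of_tendsto_eLpNorm hq w u hwm h.memLp.1 h.tendsto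
  have t2 := tendsto_eLpNorm_one_of_tendsto_eLpNorm hq (fun n => gradient (w n)) G hgm
    h.memLp_grad.1 h.tendsto_grad
  have hwi : ∀ n, IntegrableOn (w n) Ω := fun n => by
    obtain ⟨K, hK⟩ := h.lip n
    exact (hK.continuous.continuousOn.integrableOn_compact hΩb.isCompact_closure).mono_set
      subset_closure
  have hgi : ∀ n, IntegrableOn (gradient (w n)) Ω := fun n => by
    obtain ⟨K, hK⟩ := h.lip n
    exact Integrable.of_bound (hgm n) K (.of_forall fun x => norm_gradient_le_of_lipschitzWith hK x)
  have hφd : Continuous fun x => fderiv ℝ φ x e :=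
    (hφ.continuous_fderiv (by simp)).clm_apply continuous_const
  obtain ⟨D, hD⟩ := hφ.lipschitzWith_of_hasCompactSupport hφc (by simp)
  have hφ1 : ∀ x, ‖fderiv ℝ φ x e‖ ≤ D * ‖e‖ := fun x =>
    (ContinuousLinearMap.le_opNorm _ _).trans (by gcongr; exact norm_fderiv_le_of_lipschitz ℝ hD)
  obtain ⟨B, hB⟩ : ∃ B, ∀ x, ‖φ x‖ ≤ B := hφc.exists_bound_of_continuous hφ.continuous
  have hB0 : 0 ≤ B := (norm_nonneg _).trans (hB 0)
  have l1 : Tendsto (fun n => ∫ x in Ω, w n x * fderiv ℝ φ x e) atTop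
      (𝓝 (∫ x in Ω, u x * fderiv ℝ φ x e)) := by
    refine tendsto_integral_of_L1' _ (hui.mul_bdd hφd.aestronglyMeasurable (.of_forall hφ1)).1
      (.of_forall fun n => (hwi n).mul_bdd hφd.aestronglyMeasurable (.of_forall hφ1)) ?_
    have h0 : Tendsto (fun n => ENNReal.ofReal (D * ‖e‖) *
        eLpNorm (w n - u) 1 (volume.restrict Ω)) atTop (𝓝 0) := by
      simpa using ENNReal.Tendsto.const_mul t1 (Or.inr (ENNReal.ofReal_ne_top (r := D * ‖e‖)))
    refine tendsto_of_tendsto_of_tendsto_of_le_of_le tendsto_const_nhds h0 (fun _ => zero_le)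
      fun n => ?_
    refine eLpNorm_le_mul_eLpNorm_of_ae_le_mul (.of_forall fun x => ?_) 1
    simp only [Pi.sub_apply]
    rw [← sub_mul, norm_mul, mul_comm]
    gcongr
    exact hφ1 x
  have l2 : Tendsto (fun n => ∫ x in Ω, φ x * ⟪gradient (w n) x, e⟫) atTop
      (𝓝 (∫ x in Ω, φ x * ⟪G x, e⟫)) := by
    have hi : ∀ {H : Eu N → Eu N}, IntegrableOn H Ω →
        Integrable (fun x => φ x * ⟪H x, e⟫) (volume.restrict Ω) := fun hH =>
      (hH.inner_const e).bdd_mul hφ.continuous.aestronglyMeasurable (.of_forall hB)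
    refine tendsto_integral_of_L1' _ (hi hGi).1 (.of_forall fun n => hi (hgi n)) ?_
    have h0 : Tendsto (fun n => ENNReal.ofReal (B * ‖e‖) *
        eLpNorm (gradient (w n) - G) 1 (volume.restrict Ω)) atTop (𝓝 0) := by
      simpa using ENNReal.Tendsto.const_mul t2 (Or.inr (ENNReal.ofReal_ne_top (r := B * ‖e‖)))
    refine tendsto_of_tendsto_of_tendsto_of_le_of_le tendsto_const_nhds h0 (fun _ => zero_le)
      fun n => ?_
    refine eLpNorm_le_mul_eLpNorm_of_ae_le_mul (.of_forall fun x => ?_) 1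
    simp only [Pi.sub_apply]
    rw [← mul_sub, ← inner_sub_left, norm_mul]
    calc ‖φ x‖ * ‖⟪gradient (w n) x - G x, e⟫‖ ≤ B * (‖gradient (w n) x - G x‖ * ‖e‖) := by
          gcongr
          · exact hB x
          · exact norm_inner_le_norm _ _
      _ = _ := by ring
  refine tendsto_nhds_unique l1 ?_
  have : (fun n => ∫ x in Ω, w n x * fderiv ℝ φ x e) =
      fun n => -∫ x in Ω, φ x * ⟪gradient (w n) x, e⟫ := by
    funext n
    obtain ⟨K, hK⟩ := h.lip n
    exact (hasWeakGradient_of_lipschitzWith Ω hK).integral_eq φ hφ hφc hφΩ e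
  rw [this]
  exact l2.neg

/-- Multiplying a fixed `L^q` function by uniformly bounded functions tending to `0` a.e. -/
theorem tendsto_eLpNorm_smul_of_bound {X F : Type*} [MeasurableSpace X]
    [NormedAddCommGroup F] [NormedSpace ℝ F] {μ : Measure X} {q : ℝ≥0∞} (hq : 1 ≤ q) (hq' : q ≠ ⊤)
    {c : ℕ → X → ℝ} {G : X → F} (hc : ∀ n, AEStronglyMeasurable (c n) μ) (hG : MemLp G q μ) {M : ℝ}
    (hM : ∀ n, ∀ᵐ x ∂μ, ‖c n x‖ ≤ M)
    (hlim : ∀ᵐ x ∂μ, Tendsto (fun n => c n x) atTop (𝓝 0)) :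
    Tendsto (fun n => eLpNorm (fun x => c n x • G x) q μ) atTop (𝓝 0) := by
  have hq0 : q ≠ 0 := (zero_lt_one.trans_le hq).ne'
  have hqr : 0 < q.toReal := ENNReal.toReal_pos hq0 hq'
  simp only [eLpNorm_eq_lintegral_rpow_enorm_toReal hq0 hq']
  have key : Tendsto (fun n => ∫⁻ x, ‖c n x • G x‖ₑ ^ q.toReal ∂μ) atTop (𝓝 (∫⁻ _, 0 ∂μ)) := by
    refine tendsto_lintegral_of_dominated_convergence'
      (fun x => (ENNReal.ofReal M * ‖G x‖ₑ) ^ q.toReal) ?_ ?_ ?_ ?_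
    · exact fun n => (((hc n).smul hG.1).enorm).pow_const _
    · intro n
      filter_upwards [hM n] with x hx
      rw [enorm_smul, ← ofReal_norm]
      gcongr
    · simp only [ENNReal.mul_rpow_of_nonneg _ _ hqr.le]
      rw [lintegral_const_mul' _ _ (ENNReal.rpow_ne_top_of_nonneg hqr.le ENNReal.ofReal_ne_top)]
      refine ENNReal.mul_ne_top (ENNReal.rpow_ne_top_of_nonneg hqr.le ENNReal.ofReal_ne_top) ?_
      exact (lintegral_rpow_enorm_lt_top_of_eLpNorm_lt_top hq0 hq' hG.2).ne
    · filter_upwards [hlim] with x hx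
      have h1 : Tendsto (fun n => c n x • G x) atTop (𝓝 0) := by simpa using hx.smul_const (G x)
      have h2 := h1.enorm
      rw [enorm_zero] at h2
      have h3 := (ENNReal.continuous_rpow_const (y := q.toReal)).continuousAt.tendsto.comp h2
      rw [ENNReal.zero_rpow_of_pos hqr] at h3
      exact h3
  rw [lintegral_zero] at key
  have h3 := (ENNReal.continuous_rpow_const (y := 1 / q.toReal)).continuousAt.tendsto.comp key
  rw [ENNReal.zero_rpow_of_pos (by positivity)] at h3
  exact h3

/-! ### Chain rule and stability of the null trace condition -/

/-- `F : ℝ × ℝ → ℝ` is Lipschitz and of class `C¹`, with partial derivatives `F₁` and `F₂`. -/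
structure IsC1Lipschitz (F F₁ F₂ : ℝ × ℝ → ℝ) (K : ℝ≥0) : Prop where
  lip : LipschitzWith K F
  cont₁ : Continuous F₁
  cont₂ : Continuous F₂
  hasFDerivAt : ∀ y, HasFDerivAt F
    (F₁ y • ContinuousLinearMap.fst ℝ ℝ ℝ + F₂ y • ContinuousLinearMap.snd ℝ ℝ ℝ) y

namespace IsC1Lipschitz

variable {F F₁ F₂ : ℝ × ℝ → ℝ} {K : ℝ≥0}

theorem abs_le₁ (h : IsC1Lipschitz F F₁ F₂ K) (y : ℝ × ℝ) : |F₁ y| ≤ K := by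
  have h1 : ‖(F₁ y • ContinuousLinearMap.fst ℝ ℝ ℝ + F₂ y • ContinuousLinearMap.snd ℝ ℝ ℝ)‖ ≤ K := by
    rw [← (h.hasFDerivAt y).fderiv]; exact norm_fderiv_le_of_lipschitz ℝ h.lip
  have h2 := ContinuousLinearMap.le_of_opNorm_le _ h1 ((1, 0) : ℝ × ℝ)
  simpa using h2

theorem abs_le₂ (h : IsC1Lipschitz F F₁ F₂ K) (y : ℝ × ℝ) : |F₂ y| ≤ K := by
  have h1 : ‖(F₁ y • ContinuousLinearMap.fst ℝ ℝ ℝ + F₂ y • ContinuousLinearMap.snd ℝ ℝ ℝ)‖ ≤ K := by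
    rw [← (h.hasFDerivAt y).fderiv]; exact norm_fderiv_le_of_lipschitz ℝ h.lip
  have h2 := ContinuousLinearMap.le_of_opNorm_le _ h1 ((0, 1) : ℝ × ℝ)
  simpa using h2

theorem norm_sub_le (h : IsC1Lipschitz F F₁ F₂ K) (a b c d : ℝ) :
    ‖F (a, b) - F (c, d)‖ ≤ K * ‖|a - c| + |b - d|‖ := by
  have h1 := h.lip.dist_le_mul (a, b) (c, d)
  rw [Prod.dist_eq, Real.dist_eq, Real.dist_eq, Real.dist_eq] at h1
  rw [Real.norm_eq_abs, Real.norm_of_nonneg (by positivity)]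
  refine h1.trans ?_
  gcongr
  exact max_le (by simp) (by simp)

theorem tendsto_eLpNorm (h : IsC1Lipschitz F F₁ F₂ K) {X : Type*} [MeasurableSpace X]
    {μ : Measure X} {q : ℝ≥0∞} (hq : 1 ≤ q) {w z : ℕ → X → ℝ} {u v : X → ℝ}
    (hw : ∀ n, AEStronglyMeasurable (w n) μ) (hz : ∀ n, AEStronglyMeasurable (z n) μ)
    (hu : AEStronglyMeasurable u μ) (hv : AEStronglyMeasurable v μ)
    (hwu : Tendsto (fun n => eLpNorm (w n - u) q μ) atTop (𝓝 0))
    (hzv : Tendsto (fun n => eLpNorm (z n - v) q μ) atTop (𝓝 0)) :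
    Tendsto (fun n => eLpNorm ((fun x => F (w n x, z n x)) - fun x => F (u x, v x)) q μ) atTop
      (𝓝 0) := by
  have h0 : Tendsto (fun n => ENNReal.ofReal K * (eLpNorm (w n - u) q μ + eLpNorm (z n - v) q μ))
      atTop (𝓝 0) := by
    simpa using ENNReal.Tendsto.const_mul (hwu.add hzv) (Or.inr (ENNReal.ofReal_ne_top (r := K)))
  refine tendsto_of_tendsto_of_tendsto_of_le_of_le tendsto_const_nhds h0 (fun _ => zero_le)
    fun n => ?_
  calc _ ≤ ENNReal.ofReal K * eLpNorm ((fun x => ‖(w n - u) x‖) + fun x => ‖(z n - v) x‖) q μ :=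
        eLpNorm_le_mul_eLpNorm_of_ae_le_mul (.of_forall fun x => h.norm_sub_le _ _ _ _) q
    _ ≤ _ := by
        gcongr
        refine (eLpNorm_add_le ((hw n).sub hu).norm ((hz n).sub hv).norm hq).trans ?_
        rw [eLpNorm_norm, eLpNorm_norm]

theorem memLp (h : IsC1Lipschitz F F₁ F₂ K) (hF : F 0 = 0) {X : Type*} [MeasurableSpace X]
    {μ : Measure X} {q : ℝ≥0∞} {u v : X → ℝ} (hu : MemLp u q μ) (hv : MemLp v q μ) :
    MemLp (fun x => F (u x, v x)) q μ := by
  refine (hu.norm.add hv.norm).of_le_mul (c := K)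
    (h.lip.continuous.comp_aestronglyMeasurable (hu.1.prodMk hv.1)) (.of_forall fun x => ?_)
  have := h.norm_sub_le (u x) (v x) 0 0
  rw [← Prod.zero_eq_mk, hF, sub_zero, sub_zero, sub_zero] at this
  exact this

end IsC1Lipschitz

/-- The chain rule for limits of Lipschitz functions. -/
theorem LipApprox.comp {N : ℕ} {Ω : Set (Eu N)} {q : ℝ≥0∞} (hq : 1 ≤ q) (hq' : q ≠ ⊤)
    {w z : ℕ → Eu N → ℝ} {u v : Eu N → ℝ} {G H : Eu N → Eu N} (hu : LipApprox Ω q w u G)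
    (hv : LipApprox Ω q z v H) {F F₁ F₂ : ℝ × ℝ → ℝ} {K : ℝ≥0} (hF : IsC1Lipschitz F F₁ F₂ K)
    (hF0 : F 0 = 0) :
    LipApprox Ω q (fun n x => F (w n x, z n x)) (fun x => F (u x, v x))
      (fun x => F₁ (u x, v x) • G x + F₂ (u x, v x) • H x) := by
  have hwm : ∀ n, AEStronglyMeasurable (w n) (volume.restrict Ω) := fun n => by
    obtain ⟨K, hK⟩ := hu.lip n
    exact hK.continuous.aestronglyMeasurable
  have hzm : ∀ n, AEStronglyMeasurable (z n) (volume.restrict Ω) := fun n => by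
    obtain ⟨K, hK⟩ := hv.lip n
    exact hK.continuous.aestronglyMeasurable
  have hF1m := fun n => hF.cont₁.comp_aestronglyMeasurable ((hwm n).prodMk (hzm n))
  have hF2m := fun n => hF.cont₂.comp_aestronglyMeasurable ((hwm n).prodMk (hzm n))
  have hF1u := hF.cont₁.comp_aestronglyMeasurable (hu.memLp.1.prodMk hv.memLp.1)
  have hF2u := hF.cont₂.comp_aestronglyMeasurable (hu.memLp.1.prodMk hv.memLp.1)
  have hgw : ∀ n, AEStronglyMeasurable (gradient (w n)) (volume.restrict Ω) := fun n =>
    (measurable_gradient _).aestronglyMeasurable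
  have hgz : ∀ n, AEStronglyMeasurable (gradient (z n)) (volume.restrict Ω) := fun n =>
    (measurable_gradient _).aestronglyMeasurable
  refine ⟨?_, hF.memLp hF0 hu.memLp hv.memLp, ?_,
    hF.tendsto_eLpNorm hq hwm hzm hu.memLp.1 hv.memLp.1 hu.tendsto hv.tendsto, ?_, ?_⟩
  · intro n
    obtain ⟨A, hA⟩ := hu.lip n
    obtain ⟨B, hB⟩ := hv.lip n
    exact ⟨_, hF.lip.comp (hA.prodMk hB)⟩
  · have h1 : MemLp (fun x => F₁ (u x, v x) • G x) q (volume.restrict Ω) :=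
      hu.memLp_grad.of_le_mul (c := K) (hF1u.smul hu.memLp_grad.1) (.of_forall fun x => by
        rw [norm_smul]; gcongr; exact hF.abs_le₁ _)
    have h2 : MemLp (fun x => F₂ (u x, v x) • H x) q (volume.restrict Ω) :=
      hv.memLp_grad.of_le_mul (c := K) (hF2u.smul hv.memLp_grad.1) (.of_forall fun x => by
        rw [norm_smul]; gcongr; exact hF.abs_le₂ _)
    exact h1.add h2
  · have e1 : Tendsto (fun n => ENNReal.ofReal K *
        eLpNorm (gradient (w n) - G) q (volume.restrict Ω)) atTop (𝓝 0) := by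
      simpa using ENNReal.Tendsto.const_mul hu.tendsto_grad
        (Or.inr (ENNReal.ofReal_ne_top (r := K)))
    have e2 : Tendsto (fun n => ENNReal.ofReal K *
        eLpNorm (gradient (z n) - H) q (volume.restrict Ω)) atTop (𝓝 0) := by
      simpa using ENNReal.Tendsto.const_mul hv.tendsto_grad
        (Or.inr (ENNReal.ofReal_ne_top (r := K)))
    -- The coefficients converge only a.e. and boundedly, so they are paired with the fixed gradient
    -- and dominated convergence is used. Continuity of the partial derivatives and finiteness of q
    -- enter here.
    have e3 : Tendsto (fun n => eLpNorm (fun x => (F₁ (w n x, z n x) - F₁ (u x, v x)) • G x) q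
        (volume.restrict Ω)) atTop (𝓝 0) := by
      refine tendsto_eLpNorm_smul_of_bound (M := K + K) hq hq' (fun n => (hF1m n).sub hF1u)
        hu.memLp_grad (fun n => .of_forall fun x => ?_) ?_
      · exact (norm_sub_le _ _).trans (add_le_add (hF.abs_le₁ _) (hF.abs_le₁ _))
      · filter_upwards [hu.ae_tendsto, hv.ae_tendsto] with x hx hy
        rw [← sub_self (F₁ (u x, v x))]
        exact ((hF.cont₁.tendsto _).comp (hx.prodMk_nhds hy)).sub_const _
    have e4 : Tendsto (fun n => eLpNorm (fun x => (F₂ (w n x, z n x) - F₂ (u x, v x)) • H x) q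
        (volume.restrict Ω)) atTop (𝓝 0) := by
      refine tendsto_eLpNorm_smul_of_bound (M := K + K) hq hq' (fun n => (hF2m n).sub hF2u)
        hv.memLp_grad (fun n => .of_forall fun x => ?_) ?_
      · exact (norm_sub_le _ _).trans (add_le_add (hF.abs_le₂ _) (hF.abs_le₂ _))
      · filter_upwards [hu.ae_tendsto, hv.ae_tendsto] with x hx hy
        rw [← sub_self (F₂ (u x, v x))]
        exact ((hF.cont₂.tendsto _).comp (hx.prodMk_nhds hy)).sub_const _
    have etot := (e1.add e2).add (e3.add e4)
    simp only [add_zero] at etot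
    refine tendsto_of_tendsto_of_tendsto_of_le_of_le tendsto_const_nhds etot (fun _ => zero_le)
      fun n => ?_
    have hgrad : gradient (fun x => F (w n x, z n x)) =ᵐ[volume.restrict Ω]
        fun x => F₁ (w n x, z n x) • gradient (w n) x + F₂ (w n x, z n x) • gradient (z n) x := by
      obtain ⟨A, hA⟩ := hu.lip n
      obtain ⟨B, hB⟩ := hv.lip n
      refine ae_restrict_of_ae ?_
      filter_upwards [hA.ae_differentiableAt, hB.ae_differentiableAt] with x hx hy
      refine ext_inner_right ℝ fun e => ?_
      rw [inner_gradient, inner_add_left, inner_smul_left, inner_smul_left, inner_gradient,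
        inner_gradient]
      have hd := (hF.hasFDerivAt (w n x, z n x)).comp x (hx.hasFDerivAt.prodMk hy.hasFDerivAt)
      have hd' : fderiv ℝ (fun x => F (w n x, z n x)) x = _ := hd.fderiv
      rw [hd']
      simp
    have hsplit : gradient (fun x => F (w n x, z n x)) -
        (fun x => F₁ (u x, v x) • G x + F₂ (u x, v x) • H x) =ᵐ[volume.restrict Ω]
        ((fun x => F₁ (w n x, z n x) • (gradient (w n) - G) x) +
          (fun x => F₂ (w n x, z n x) • (gradient (z n) - H) x)) +
        ((fun x => (F₁ (w n x, z n x) - F₁ (u x, v x)) • G x) +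
          (fun x => (F₂ (w n x, z n x) - F₂ (u x, v x)) • H x)) := by
      filter_upwards [hgrad] with x hx
      simp only [Pi.sub_apply, Pi.add_apply, hx]
      module
    rw [eLpNorm_congr_ae hsplit]
    have m1 := (hF1m n).smul ((hgw n).sub hu.memLp_grad.1)
    have m2 := (hF2m n).smul ((hgz n).sub hv.memLp_grad.1)
    have m3 := ((hF1m n).sub hF1u).smul hu.memLp_grad.1
    have m4 := ((hF2m n).sub hF2u).smul hv.memLp_grad.1
    refine (eLpNorm_add_le (m1.add m2) (m3.add m4) hq).trans ?_
    gcongr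
    · refine (eLpNorm_add_le m1 m2 hq).trans ?_
      gcongr
      · refine eLpNorm_le_mul_eLpNorm_of_ae_le_mul (.of_forall fun x => ?_) q
        rw [Pi.smul_apply', norm_smul]; gcongr; exact hF.abs_le₁ _
      · refine eLpNorm_le_mul_eLpNorm_of_ae_le_mul (.of_forall fun x => ?_) q
        rw [Pi.smul_apply', norm_smul]; gcongr; exact hF.abs_le₂ _
    · exact eLpNorm_add_le m3 m4 hq
  · filter_upwards [hu.ae_tendsto, hv.ae_tendsto] with x hx hy
    exact (hF.lip.continuous.tendsto _).comp (hx.prodMk_nhds hy)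

/-- Functions with null trace on `Γd` are limits of Lipschitz functions whose restrictions to the
boundary converge to a function vanishing on `Γd`. -/
theorem MemW1Gamma.exists_lipApprox {N : ℕ} {Ω Γd : Set (Eu N)} (hΩo : IsOpen Ω) {q : ℝ≥0∞}
    (hq : 1 ≤ q) {u : Eu N → ℝ} {G : Eu N → Eu N} (hu : MemW1Gamma Ω Γd q u)
    (hG : HasWeakGradient Ω u G) :
    ∃ (w : ℕ → Eu N → ℝ) (g : Eu N → ℝ), LipApprox Ω q w u G ∧
      MemLp g q ((surfaceMeasure N).restrict (frontier Ω)) ∧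
      Tendsto (fun n => eLpNorm (w n - g) q ((surfaceMeasure N).restrict (frontier Ω)))
        atTop (𝓝 0) ∧ ∀ᵐ x ∂(surfaceMeasure N), x ∈ Γd → g x = 0 := by
  obtain ⟨⟨hup, G₀, hG₀, hG₀p⟩, g, ⟨hg, w, hw, ⟨Gw, G₁, hGw, hG₁, t1, t2⟩, t3⟩, hg0⟩ := hu
  have hGp : MemLp G q (volume.restrict Ω) := hG₀p.ae_eq (hG₀.ae_eq hΩo hG)
  have hwm : ∀ n, AEStronglyMeasurable (w n) (volume.restrict Ω) := fun n => by
    obtain ⟨K, hK⟩ := hw n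
    exact hK.continuous.aestronglyMeasurable
  -- Norm convergence gives a.e. convergence along a subsequence, and every other limit persists
  -- along it.
  obtain ⟨ns, hns, hae⟩ := (tendstoInMeasure_of_tendsto_eLpNorm (zero_lt_one.trans_le hq).ne'
    hwm hup.1 t1).exists_seq_tendsto_ae
  have hgr : Tendsto (fun n => eLpNorm (gradient (w n) - G) q (volume.restrict Ω)) atTop (𝓝 0) := by
    refine t2.congr fun n => eLpNorm_congr_ae ?_
    obtain ⟨K, hK⟩ := hw n
    exact ((hGw n).ae_eq hΩo (hasWeakGradient_of_lipschitzWith Ω hK)).sub (hG₁.ae_eq hΩo hG)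
  exact ⟨fun n => w (ns n), g, ⟨fun n => hw _, hup, hGp, t1.comp hns.tendsto_atTop,
    hgr.comp hns.tendsto_atTop, hae⟩, hg, t3.comp hns.tendsto_atTop, hg0⟩

/-- The composition of functions with null trace on `Γd` with a `C¹` Lipschitz function. -/
theorem MemW1Gamma.comp {N : ℕ} {Ω Γd : Set (Eu N)} (hΩo : IsOpen Ω)
    (hΩb : Bornology.IsBounded Ω) {q : ℝ≥0∞} (hq : 1 ≤ q) (hq' : q ≠ ⊤) {u v : Eu N → ℝ}
    {G H : Eu N → Eu N} (hu : MemW1Gamma Ω Γd q u) (hG : HasWeakGradient Ω u G)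
    (hv : MemW1Gamma Ω Γd q v) (hH : HasWeakGradient Ω v H) {F F₁ F₂ : ℝ × ℝ → ℝ} {K : ℝ≥0}
    (hF : IsC1Lipschitz F F₁ F₂ K) (hF0 : F 0 = 0) :
    MemW1Gamma Ω Γd q (fun x => F (u x, v x)) ∧
      HasWeakGradient Ω (fun x => F (u x, v x))
        (fun x => F₁ (u x, v x) • G x + F₂ (u x, v x) • H x) := by
  obtain ⟨w, g, hw, hgp, hwg, hg0⟩ := hu.exists_lipApprox hΩo hq hG
  obtain ⟨z, k, hz, hkp, hzk, hk0⟩ := hv.exists_lipApprox hΩo hq hH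
  have hc := hw.comp hq hq' hz hF hF0
  have hgrad := hc.hasWeakGradient hΩb hq
  -- The trace of the composition is F of the traces, obtained from the same Lipschitz approximants;
  -- it vanishes on `Γd` because F 0 = 0.
  refine ⟨⟨⟨hc.memLp, _, hgrad, hc.memLp_grad⟩, fun x => F (g x, k x),
    ⟨hF.memLp hF0 hgp hkp, _, hc.lip, ⟨_, _, fun n => ?_, hgrad, hc.tendsto, hc.tendsto_grad⟩,
      ?_⟩, ?_⟩, hgrad⟩
  · obtain ⟨A, hA⟩ := hc.lip n
    exact hasWeakGradient_of_lipschitzWith Ω hA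
  · refine hF.tendsto_eLpNorm hq (fun n => ?_) (fun n => ?_) hgp.1 hkp.1 hwg hzk
    · obtain ⟨A, hA⟩ := hw.lip n
      exact hA.continuous.aestronglyMeasurable
    · obtain ⟨A, hA⟩ := hz.lip n
      exact hA.continuous.aestronglyMeasurable
  · filter_upwards [hg0, hk0] with x hx hy hxd
    rw [hx hxd, hy hxd]
    exact hF0

/-! ### Level set estimate from the Sobolev inequality -/

/-- A smooth even step function between the levels `s` and `t`, with slope `O(1/(t-s))`. -/
theorem exists_smooth_step : ∃ C : ℝ, 0 < C ∧ ∀ s t : ℝ, 0 < s → s < t → ∃ G : ℝ → ℝ,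
    ContDiff ℝ 1 G ∧ (∀ x, |x| ≤ s → G x = 0) ∧ (∀ x, t ≤ |x| → G x = 1) ∧
    (∀ x, 0 ≤ G x) ∧ (∀ x, G x ≤ 1) ∧ (∀ x, |deriv G x| ≤ C / (t - s)) ∧
    ∀ x, |x| ≤ s ∨ t ≤ |x| → deriv G x = 0 := by
  have hθ : ContDiff ℝ 1 Real.smoothTransition := Real.smoothTransition.contDiff (n := 1)
  have hθ' : Continuous (deriv Real.smoothTransition) := hθ.continuous_deriv le_rfl
  obtain ⟨D, hD⟩ := (isCompact_Icc (a := (0 : ℝ)) (b := 1)).exists_bound_of_continuousOn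
    hθ'.continuousOn
  have hD0 : 0 ≤ D := (norm_nonneg _).trans (hD 0 (by simp))
  refine ⟨2 * D + 1, by positivity, fun s t hs hst => ?_⟩
  have ht : 0 < t := hs.trans hst
  have hpos : 0 < t ^ 2 - s ^ 2 := by nlinarith
  -- Using x² instead of |x| keeps the step smooth at 0; between the levels the inner slope 2|x|/(t²
  -- - s²) is at most 2/(t - s).
  set G : ℝ → ℝ := fun x => Real.smoothTransition ((x ^ 2 - s ^ 2) / (t ^ 2 - s ^ 2)) with hG
  have hGc : ContDiff ℝ 1 G := hθ.comp (by fun_prop)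
  have h0 : ∀ x, |x| ≤ s → G x = 0 := fun x hx => by
    refine Real.smoothTransition.zero_of_nonpos (div_nonpos_of_nonpos_of_nonneg ?_ hpos.le)
    have := sq_le_sq' (by linarith [abs_nonneg x]) hx
    rw [sq_abs] at this
    linarith
  have h1 : ∀ x, t ≤ |x| → G x = 1 := fun x hx => by
    refine Real.smoothTransition.one_of_one_le ?_
    rw [le_div_iff₀ hpos]
    have := sq_le_sq' (by linarith) hx
    rw [sq_abs] at this
    linarith
  have hn : ∀ x, 0 ≤ G x := fun x => Real.smoothTransition.nonneg _
  have hl : ∀ x, G x ≤ 1 := fun x => Real.smoothTransition.le_one _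
  have hd0 : ∀ x, |x| ≤ s ∨ t ≤ |x| → deriv G x = 0 := by
    rintro x (hx | hx)
    · exact IsLocalMin.deriv_eq_zero (.of_forall fun y => by rw [h0 x hx]; exact hn y)
    · exact IsLocalMax.deriv_eq_zero (.of_forall fun y => by rw [h1 x hx]; exact hl y)
  refine ⟨G, hGc, h0, h1, hn, hl, fun x => ?_, hd0⟩
  by_cases hx : |x| ≤ s ∨ t ≤ |x|
  · rw [hd0 x hx, abs_zero]
    exact div_nonneg (by positivity) (by linarith)
  push Not at hx
  have hder : deriv G x = deriv Real.smoothTransition ((x ^ 2 - s ^ 2) / (t ^ 2 - s ^ 2)) *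
      (2 * x / (t ^ 2 - s ^ 2)) := by
    have e1 : HasDerivAt (fun x : ℝ => (x ^ 2 - s ^ 2) / (t ^ 2 - s ^ 2))
        (2 * x / (t ^ 2 - s ^ 2)) x := by
      simpa using ((hasDerivAt_pow 2 x).sub_const (s ^ 2)).div_const (t ^ 2 - s ^ 2)
    exact ((hθ.differentiable one_ne_zero _).hasDerivAt.comp x e1).deriv
  have hx2 : s ^ 2 ≤ x ^ 2 := by rw [← sq_abs x]; gcongr; exact hx.1.le
  have hx3 : x ^ 2 ≤ t ^ 2 := by rw [← sq_abs x]; gcongr; exact hx.2.le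
  rw [hder, abs_mul, abs_div, abs_mul, abs_of_pos hpos, abs_two]
  have hmem : (x ^ 2 - s ^ 2) / (t ^ 2 - s ^ 2) ∈ Set.Icc (0 : ℝ) 1 :=
    ⟨div_nonneg (by linarith) hpos.le, (div_le_one hpos).2 (by linarith)⟩
  have hle : 2 * |x| / (t ^ 2 - s ^ 2) ≤ 2 / (t - s) := by
    rw [div_le_div_iff₀ hpos (by linarith)]
    nlinarith [hx.2, abs_nonneg x]
  calc _ ≤ D * (2 / (t - s)) := by
        gcongr
        exact hD _ hmem
    _ = 2 * D / (t - s) := by ring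
    _ ≤ _ := by gcongr; linarith

/-- The differential is a sum of two multiples of the coordinate projections, each of norm at most
M; the mean value inequality then gives the Lipschitz constant M + M. -/
theorem isC1Lipschitz_of_bound {F F₁ F₂ : ℝ × ℝ → ℝ} (h1 : Continuous F₁) (h2 : Continuous F₂)
    (hd : ∀ y, HasFDerivAt F
      (F₁ y • ContinuousLinearMap.fst ℝ ℝ ℝ + F₂ y • ContinuousLinearMap.snd ℝ ℝ ℝ) y) {M : ℝ≥0}
    (hM1 : ∀ y, |F₁ y| ≤ M) (hM2 : ∀ y, |F₂ y| ≤ M) : IsC1Lipschitz F F₁ F₂ (M + M) := by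
  refine ⟨?_, h1, h2, hd⟩
  refine lipschitzWith_of_nnnorm_fderiv_le (fun y => (hd y).differentiableAt) (𝕜 := ℝ) fun y => ?_
  rw [(hd y).fderiv, ← NNReal.coe_le_coe, coe_nnnorm]
  refine (norm_add_le _ _).trans ?_
  rw [norm_smul, norm_smul]
  push_cast
  refine add_le_add ?_ ?_
  · exact (mul_le_mul (hM1 y) (ContinuousLinearMap.norm_fst_le ℝ ℝ ℝ) (norm_nonneg _)
      M.2).trans (mul_one _).le
  · exact (mul_le_mul (hM2 y) (ContinuousLinearMap.norm_snd_le ℝ ℝ ℝ) (norm_nonneg _)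
      M.2).trans (mul_one _).le

/-- The Hölder inequality on the support. -/
theorem eLpNorm_one_le_mul_measure_rpow {X F : Type*} [MeasurableSpace X] [NormedAddCommGroup F]
    {μ : Measure X} {f : X → F} (hf : AEStronglyMeasurable f μ) {S : Set X}
    (hS : ∀ x, x ∉ S → f x = 0) {p : ℝ} (hp : 1 ≤ p) :
    eLpNorm f 1 μ ≤ eLpNorm f (ENNReal.ofReal p) μ * μ S ^ (1 - 1 / p) := by
  have h1 : f = (toMeasurable μ S).indicator f := by
    refine (Set.indicator_eq_self.2 fun x hx => ?_).symm
    by_contra h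
    exact hx (hS x fun h' => h (subset_toMeasurable μ S h'))
  have hm := measurableSet_toMeasurable μ S
  calc eLpNorm f 1 μ = eLpNorm f 1 (μ.restrict (toMeasurable μ S)) := by
        conv_lhs => rw [h1]
        rw [eLpNorm_indicator_eq_eLpNorm_restrict hm]
    _ ≤ eLpNorm f (ENNReal.ofReal p) (μ.restrict (toMeasurable μ S)) *
        (μ.restrict (toMeasurable μ S)) Set.univ ^
          (1 / (1 : ℝ≥0∞).toReal - 1 / (ENNReal.ofReal p).toReal) :=
        eLpNorm_le_eLpNorm_mul_rpow_measure_univ (ENNReal.one_le_ofReal.2 hp) hf.restrict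
    _ ≤ _ := by
        rw [Measure.restrict_apply_univ, measure_toMeasurable,
          ENNReal.toReal_ofReal (by linarith), ENNReal.toReal_one, div_one]
        gcongr
        exact Measure.restrict_le_self

/-- The superlevel sets of an a.e. finite function have small measure. -/
theorem tendsto_measure_abs_ge {X : Type*} [MeasurableSpace X] {μ : Measure X} [IsFiniteMeasure μ]
    {u : X → ℝ} (hu : AEMeasurable u μ) :
    Tendsto (fun k : ℝ => μ {x | k ≤ |u x|}) atTop (𝓝 0) := by
  have h := tendsto_measure_iInter_atTop (μ := μ) (s := fun k : ℝ => {x | k ≤ |u x|})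
    (fun k => nullMeasurableSet_le aemeasurable_const (measurable_norm.comp_aemeasurable hu))
    (fun k l hkl x (hx : l ≤ |u x|) => hkl.trans hx) ⟨0, measure_ne_top _ _⟩
  have h0 : ⋂ k : ℝ, {x | k ≤ |u x|} = ∅ := by
    refine Set.eq_empty_of_forall_notMem fun x hx => ?_
    have := Set.mem_iInter.1 hx (|u x| + 1)
    simp only [Set.mem_ofPred_eq] at this
    linarith
  rw [h0, measure_empty] at h
  exact h

theorem trunc_of_abs_le {k s : ℝ} (h : |s| ≤ k) : trunc k s = s := by
  have := abs_le.1 h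
  rw [trunc, min_eq_left this.2, max_eq_right this.1]

theorem abs_trunc_eq {k s : ℝ} (hk : 0 ≤ k) (h : k ≤ |s|) : |trunc k s| = k := by
  rcases le_abs'.1 h with h1 | h1
  · rw [trunc, min_eq_left (by linarith), max_eq_left h1, abs_neg, abs_of_nonneg hk]
  · rw [trunc, min_eq_right h1, max_eq_right (by linarith), abs_of_nonneg hk]

/-- Decay of the measures of superlevel sets in terms of the energy between two levels. -/
theorem exists_level_estimate {N : ℕ} (hN : 2 ≤ N) {Ω Γd : Set (Eu N)} (hΩo : IsOpen Ω)
    (hΩb : Bornology.IsBounded Ω) (hΩL : HasLipschitzBoundary Ω) {p : ℝ} (hp : 1 < p)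
    {u : Eu N → ℝ} {Du : Eu N → Eu N} (hu : AEMeasurable u (volume.restrict Ω))
    (hW : ∀ k : ℝ, 0 < k → MemW1Gamma Ω Γd (ENNReal.ofReal p) (fun x => trunc k (u x)))
    (hD : IsGeneralizedGradient Ω u Du) :
    ∃ C k₀ : ℝ, 0 < C ∧ 0 < k₀ ∧ ∀ s t : ℝ, k₀ ≤ s → s < t →
      (volume.restrict Ω).real {x | t ≤ |u x|} ^ (1 - 1 / (N : ℝ)) ≤
        C / (t - s) * (∫ x in Ω, ‖{x | s ≤ |u x| ∧ |u x| < t}.indicator Du x‖ ^ p) ^ (1 / p) *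
          (volume.restrict Ω).real {x | s ≤ |u x|} ^ (1 - 1 / p) := by
  have : IsFiniteMeasure (volume.restrict Ω) := ⟨by simpa using hΩb.measure_lt_top⟩
  set ν := (volume.restrict Ω) with hν
  have hN' : (2 : ℝ) ≤ N := by exact_mod_cast hN
  have hq : 1 ≤ ENNReal.ofReal p := ENNReal.one_le_ofReal.2 hp.le
  have hq1 : 1 < (N : ℝ) / (N - 1) := by rw [lt_div_iff₀ (by linarith)]; linarith
  obtain ⟨C, hC⟩ := exists_eLpNorm_le_of_lipApprox hN hΩo hΩb hΩL
  obtain ⟨A, hA, hstep⟩ := exists_smooth_step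
  have hNe : 0 < 1 / (N : ℝ) := by positivity
  -- Beyond k₀ the superlevel sets are so small that the lower-order term of the Sobolev inequality
  -- can be absorbed; this replaces a Poincaré inequality.
  obtain ⟨k₀, hk₀, hk₀'⟩ : ∃ k₀ : ℝ, 0 < k₀ ∧
      ∀ s, k₀ ≤ s → (C : ℝ≥0∞) * ν {x | s ≤ |u x|} ^ (1 / (N : ℝ)) ≤ 1 / 2 := by
    have h1 := tendsto_measure_abs_ge hu
    have h2 := (ENNReal.continuous_rpow_const (y := 1 / (N : ℝ))).continuousAt.tendsto.comp h1
    rw [ENNReal.zero_rpow_of_pos hNe] at h2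
    have h3 := ENNReal.Tendsto.const_mul h2 (Or.inr (ENNReal.coe_ne_top (r := C)))
    rw [mul_zero] at h3
    have h4 := h3.eventually (ge_mem_nhds (by norm_num : (0 : ℝ≥0∞) < 1 / 2))
    obtain ⟨k, hk⟩ := eventually_atTop.1 h4
    exact ⟨max k 1, by positivity, fun s hs => hk s ((le_max_left _ _).trans hs)⟩
  -- The factor 2 comes from absorption, A from the slope of the step; the added 1 only ensures
  -- positivity, as C may be 0.
  refine ⟨2 * C * A + 1, k₀, by positivity, hk₀, fun s t hs hst => ?_⟩
  have hs0 : 0 < s := hk₀.trans_le hs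
  have ht0 : 0 < t := hs0.trans hst
  obtain ⟨G, hGc, hG0, hG1, hGn, hGl, hGd, hGd0⟩ := hstep s t hs0 hst
  obtain ⟨w, g, hw, -⟩ := (hW t ht0).exists_lipApprox hΩo hq (hD.2 t ht0)
  have hAt : 0 ≤ A / (t - s) := div_nonneg hA.le (by linarith)
  have hF : IsC1Lipschitz (fun y => G y.1) (fun y => deriv G y.1) (fun _ => 0)
      (⟨A / (t - s), hAt⟩ + ⟨A / (t - s), hAt⟩) := by
    refine isC1Lipschitz_of_bound ((hGc.continuous_deriv le_rfl).comp continuous_fst)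
      continuous_const (fun y => ?_) (fun y => hGd y.1) (fun y => by rw [abs_zero]; exact hAt)
    have h1 := (hGc.differentiable one_ne_zero y.1).hasDerivAt.hasFDerivAt.comp y
      (hasFDerivAt_fst (𝕜 := ℝ) (p := y))
    refine h1.congr_fderiv ?_
    ext <;> simp
  have hcomp := hw.comp hq ENNReal.ofReal_ne_top hw hF (hG0 0 (by simpa using hs0.le))
  set T : Set (Eu N) := {x | s ≤ |u x| ∧ |u x| < t} with hT
  -- G is constant from height t on, so only the truncation of u, which is a Sobolev function, is
  -- really composed with G.
  have hGu : (fun x => G (trunc t (u x))) = fun x => G (u x) := by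
    funext x
    rcases le_total |u x| t with h | h
    · rw [trunc_of_abs_le h]
    · rw [hG1 _ h, hG1 _ (abs_trunc_eq ht0.le h).ge]
  have hsob := hC _ _ _ _ hq hcomp
  simp only [hGu] at hsob
  set D : Eu N → Eu N := fun x => deriv G (trunc t (u x)) • {x | |u x| < t}.indicator Du x +
    (0 : ℝ) • {x | |u x| < t}.indicator Du x with hDdef
  have hDm : AEStronglyMeasurable D ν := hcomp.memLp_grad.1
  have hD' : ∀ x, D x = deriv G (u x) • T.indicator Du x := by
    intro x
    simp only [hDdef, zero_smul, add_zero]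
    by_cases h : |u x| < t
    · rw [trunc_of_abs_le h.le]
      by_cases h' : s ≤ |u x|
      · rw [Set.indicator_of_mem (show x ∈ {x | |u x| < t} from h),
          Set.indicator_of_mem (show x ∈ T from ⟨h', h⟩)]
      · rw [hGd0 _ (Or.inl (not_le.1 h').le), zero_smul, zero_smul]
    · rw [Set.indicator_of_notMem (show x ∉ {x | |u x| < t} from h),
        Set.indicator_of_notMem (show x ∉ T from fun h' => h h'.2), smul_zero, smul_zero]
  have hGum : AEStronglyMeasurable (fun x => G (u x)) ν :=
    (hGc.continuous.measurable.comp_aemeasurable hu).aestronglyMeasurable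
  set q := (N : ℝ) / (N - 1) with hqdef
  have hqN : 1 - 1 / q = 1 / (N : ℝ) := by
    rw [hqdef]; field_simp; ring
  have hqN' : 1 - 1 / (N : ℝ) = 1 / q := by linarith
  have hfin : eLpNorm (fun x => G (u x)) (ENNReal.ofReal q) ν ≠ ⊤ :=
    (MemLp.of_bound hGum 1 (.of_forall fun x => by
      rw [Real.norm_of_nonneg (hGn _)]; exact hGl _)).2.ne
  have hw1 := eLpNorm_one_le_mul_measure_rpow hGum (S := {x | s ≤ |u x|})
    (fun x hx => hG0 _ (not_le.1 hx).le) hq1.le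
  rw [hqN] at hw1
  -- Hölder on {|u| ≥ s} bounds the L¹ norm by the L^{N/(N-1)} norm times a small factor. Half of
  -- the left side is then cancelled, which is legitimate because it is finite.
  have hmain : eLpNorm (fun x => G (u x)) (ENNReal.ofReal q) ν ≤ 2 * C * eLpNorm D 1 ν := by
    set B := eLpNorm (fun x => G (u x)) (ENNReal.ofReal q) ν with hB
    have h1 : B ≤ B / 2 + C * eLpNorm D 1 ν := by
      calc B ≤ C * (eLpNorm (fun x => G (u x)) 1 ν + eLpNorm D 1 ν) := hsob
        _ ≤ C * (B * ν {x | s ≤ |u x|} ^ (1 / (N : ℝ)) + eLpNorm D 1 ν) := by gcongr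
        _ = B * (C * ν {x | s ≤ |u x|} ^ (1 / (N : ℝ))) + C * eLpNorm D 1 ν := by ring
        _ ≤ B * (1 / 2) + C * eLpNorm D 1 ν := by gcongr; exact hk₀' s hs
        _ = _ := by rw [mul_one_div]
    have h2 : B / 2 + B / 2 ≤ B / 2 + C * eLpNorm D 1 ν := by rwa [ENNReal.add_halves]
    have h3 := (ENNReal.add_le_add_iff_left (ENNReal.div_ne_top hfin (by simp))).1 h2
    calc B = B / 2 + B / 2 := (ENNReal.add_halves B).symm
      _ ≤ C * eLpNorm D 1 ν + C * eLpNorm D 1 ν := add_le_add h3 h3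
      _ = _ := by ring
  have hD1 := eLpNorm_one_le_mul_measure_rpow hDm (S := {x | s ≤ |u x|}) (fun x hx => by
    rw [hD', Set.indicator_of_notMem (fun h => hx h.1), smul_zero]) hp.le
  have hTm : NullMeasurableSet T ν :=
    (nullMeasurableSet_le aemeasurable_const (measurable_norm.comp_aemeasurable hu)).inter
      (nullMeasurableSet_lt (measurable_norm.comp_aemeasurable hu) aemeasurable_const)
  have hTD : MemLp (T.indicator Du) (ENNReal.ofReal p) ν := by
    refine hw.memLp_grad.mono ?_ (.of_forall fun x => ?_)
    · exact (aestronglyMeasurable_indicator_iff₀ hTm).2 hD.1.aestronglyMeasurable.restrict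
    · by_cases h : x ∈ T
      · rw [Set.indicator_of_mem h, Set.indicator_of_mem (show x ∈ {x | |u x| < t} from h.2)]
      · rw [Set.indicator_of_notMem h, norm_zero]; exact norm_nonneg _
  have hDp : eLpNorm D (ENNReal.ofReal p) ν ≤ ENNReal.ofReal (A / (t - s)) *
      eLpNorm (T.indicator Du) (ENNReal.ofReal p) ν := by
    refine eLpNorm_le_mul_eLpNorm_of_ae_le_mul (.of_forall fun x => ?_) _
    rw [hD', norm_smul]
    gcongr
    exact hGd _
  have hcheb : ν {x | t ≤ |u x|} ^ (1 / q) ≤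
      eLpNorm (fun x => G (u x)) (ENNReal.ofReal q) ν := by
    have h1 := mul_meas_ge_le_pow_eLpNorm' ν (p := ENNReal.ofReal q) (by simp; linarith)
      ENNReal.ofReal_ne_top hGum 1
    rw [ENNReal.one_rpow, one_mul, ENNReal.toReal_ofReal (by linarith)] at h1
    have h2 : ν {x | t ≤ |u x|} ≤ ν {x | 1 ≤ ‖G (u x)‖ₑ} := by
      refine measure_mono fun x hx => ?_
      simp only [Set.mem_ofPred_eq] at hx ⊢
      rw [hG1 _ hx]; simp
    calc _ ≤ (eLpNorm (fun x => G (u x)) (ENNReal.ofReal q) ν ^ q) ^ (1 / q) := by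
          refine ENNReal.rpow_le_rpow (h2.trans h1) ?_
          positivity
      _ = _ := by rw [← ENNReal.rpow_mul, mul_one_div_cancel (by linarith), ENNReal.rpow_one]
  have htot : ν {x | t ≤ |u x|} ^ (1 / q) ≤ 2 * C * (ENNReal.ofReal (A / (t - s)) *
      eLpNorm (T.indicator Du) (ENNReal.ofReal p) ν * ν {x | s ≤ |u x|} ^ (1 - 1 / p)) := by
    refine (hcheb.trans hmain).trans ?_
    gcongr
    refine hD1.trans ?_
    gcongr
  rw [hTD.eLpNorm_eq_integral_rpow_norm (by simp; linarith) ENNReal.ofReal_ne_top,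
    ENNReal.toReal_ofReal (by linarith)] at htot
  have hp1 : 0 ≤ 1 - 1 / p := by
    rw [sub_nonneg, div_le_one (by linarith)]; exact hp.le
  have hIn : 0 ≤ ∫ x, ‖T.indicator Du x‖ ^ p ∂ν := integral_nonneg fun x => by positivity
  have hne : 2 * (C : ℝ≥0∞) * (ENNReal.ofReal (A / (t - s)) *
      ENNReal.ofReal ((∫ x, ‖T.indicator Du x‖ ^ p ∂ν) ^ p⁻¹) * ν {x | s ≤ |u x|} ^ (1 - 1 / p))
      ≠ ⊤ :=
    ENNReal.mul_ne_top (ENNReal.mul_ne_top (by simp) ENNReal.coe_ne_top)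
      (ENNReal.mul_ne_top (ENNReal.mul_ne_top ENNReal.ofReal_ne_top ENNReal.ofReal_ne_top)
        (ENNReal.rpow_ne_top_of_nonneg hp1 (measure_ne_top _ _)))
  have hreal := ENNReal.toReal_mono hne htot
  rw [← ENNReal.toReal_rpow, ENNReal.toReal_mul, ENNReal.toReal_mul, ENNReal.toReal_mul,
    ENNReal.toReal_mul, ← ENNReal.toReal_rpow, ENNReal.toReal_ofReal hAt,
    ENNReal.toReal_ofReal (by positivity), ENNReal.coe_toReal, ENNReal.toReal_ofNat] at hreal
  rw [hqN']
  refine hreal.trans ?_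
  rw [← one_div]
  change 2 * (C : ℝ) * (A / (t - s) * (∫ x, ‖T.indicator Du x‖ ^ p ∂ν) ^ (1 / p) *
    ν.real {x | s ≤ |u x|} ^ (1 - 1 / p)) ≤ _
  calc _ = (2 * C * A) / (t - s) * (∫ x, ‖T.indicator Du x‖ ^ p ∂ν) ^ (1 / p) *
        ν.real {x | s ≤ |u x|} ^ (1 - 1 / p) := by ring
    _ ≤ _ := by
        have : 0 < t - s := by linarith
        gcongr
        linarith

/-! ### Recursions for the measures of superlevel sets -/

/-- A nonnegative sequence with `y (i + 1) ≤ δ i * (1 + y i)`, `δ → 0`, tends to `0`. -/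
theorem tendsto_zero_of_le_mul_one_add {y δ : ℕ → ℝ} (hy : ∀ i, 0 ≤ y i)
    (hδ : Tendsto δ atTop (𝓝 0)) (h : ∀ᶠ i in atTop, y (i + 1) ≤ δ i * (1 + y i)) :
    Tendsto y atTop (𝓝 0) := by
  obtain ⟨I, hI⟩ := eventually_atTop.1
    (h.and (hδ.eventually (ge_mem_nhds (by norm_num : (0 : ℝ) < 1 / 2))))
  -- Once δ ≤ 1/2, the bound max (y I) 1 reproduces itself. With y bounded, the recursion gives
  -- convergence to 0.
  have hbd : ∀ k, y (I + k) ≤ max (y I) 1 := by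
    intro k
    induction k with
    | zero => exact le_max_left _ _
    | succ k ih =>
      obtain ⟨h1, h2⟩ := hI (I + k) (by omega)
      have h3 : y (I + (k + 1)) ≤ 1 / 2 * (1 + y (I + k)) := by
        rw [← add_assoc]
        exact h1.trans (mul_le_mul_of_nonneg_right h2 (by linarith [hy (I + k)]))
      have h4 : (1 : ℝ) ≤ max (y I) 1 := le_max_right _ _
      linarith
  rw [← tendsto_add_atTop_iff_nat 1]
  have hlim : Tendsto (fun i => |δ i| * (1 + max (y I) 1)) atTop (𝓝 0) := by
    simpa using hδ.abs.mul_const (1 + max (y I) 1)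
  refine squeeze_zero' (.of_forall fun i => hy _) ?_ hlim
  filter_upwards [eventually_ge_atTop I] with i hi
  obtain ⟨k, rfl⟩ := Nat.exists_eq_add_of_le hi
  refine (hI (I + k) hi).1.trans ?_
  have := hbd k
  have h0 := hy (I + k)
  gcongr
  exact le_abs_self _

/-- The recursive estimate for measures of dyadic superlevel sets, rescaled. -/
theorem dyadic_rescaled_le {N p C ε X m m' : ℝ} (hp : 1 < p) (hpN : p < N) (hC : 0 < C)
    (hε : 0 ≤ ε) (hX : 0 < X) (hm : 0 ≤ m) (hm' : 0 ≤ m')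
    (h : m' ^ (1 - 1 / N) ≤ C / X * (ε * X) ^ (1 / p) * m ^ (1 - 1 / p)) :
    (2 * X) ^ (p - 1) * m' ^ (1 - p / N) ≤
      (2 ^ (p - 1) * (C * ε ^ (1 / p)) ^ ((N - p) / (N - 1))) *
        (1 + X ^ (p - 1) * m ^ (1 - p / N)) := by
  have hN : 0 < N := by linarith
  have hN1 : 0 < N - 1 := by linarith
  -- Raising the level estimate to the power r turns the exponent 1 - 1/N into 1 - p/N. The right
  -- side then contains the rescaled quantity X^{p-1} m^{1-p/N} to the power θ = 1 - r/p, which lies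
  -- strictly between 0 and 1, so it is at most one plus that quantity.
  set r := (N - p) / (N - 1) with hr
  have hr0 : 0 < r := div_pos (by linarith) hN1
  set θ := 1 - r / p with hθ
  have hp0 : 0 < p := by linarith
  have hθ1 : θ ≤ 1 := by
    have : 0 ≤ r / p := by positivity
    linarith
  have hθ0 : 0 < θ := by
    have : r < 1 := by rw [hr, div_lt_one hN1]; linarith
    have : r / p < 1 := by rw [div_lt_one hp0]; linarith
    linarith
  have e1 : (1 - 1 / N) * r = 1 - p / N := by rw [hr]; field_simp
  have e2 : (1 - 1 / p) * r = (1 - p / N) * θ := by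
    rw [hθ, hr]; field_simp; ring
  have e3 : (p - 1) - (1 - 1 / p) * r = (p - 1) * θ := by
    rw [hθ]; field_simp
  have h1 : m' ^ (1 - p / N) ≤
      (C * ε ^ (1 / p)) ^ r * (X ^ (-((1 - 1 / p) * r)) * m ^ ((1 - 1 / p) * r)) := by
    have hrhs : C / X * (ε * X) ^ (1 / p) * m ^ (1 - 1 / p) =
        (C * ε ^ (1 / p)) * (X ^ (-(1 - 1 / p)) * m ^ (1 - 1 / p)) := by
      rw [Real.mul_rpow hε hX.le, neg_sub, Real.rpow_sub hX, Real.rpow_one]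
      ring
    rw [hrhs] at h
    rw [← e1, Real.rpow_mul hm']
    refine (Real.rpow_le_rpow (by positivity) h hr0.le).trans (le_of_eq ?_)
    rw [Real.mul_rpow (x := C * ε ^ (1 / p)) (by positivity) (by positivity),
      Real.mul_rpow (x := X ^ _) (by positivity) (by positivity), ← Real.rpow_mul hX.le,
      ← Real.rpow_mul hm, neg_mul]
  have h2 : X ^ (p - 1) * (X ^ (-((1 - 1 / p) * r)) * m ^ ((1 - 1 / p) * r)) =
      (X ^ (p - 1) * m ^ (1 - p / N)) ^ θ := by
    rw [← mul_assoc, ← Real.rpow_add hX, ← sub_eq_add_neg, e3, e2,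
      Real.mul_rpow (by positivity) (by positivity), ← Real.rpow_mul hX.le, ← Real.rpow_mul hm]
  have h3 : (X ^ (p - 1) * m ^ (1 - p / N)) ^ θ ≤ 1 + X ^ (p - 1) * m ^ (1 - p / N) := by
    set Y := X ^ (p - 1) * m ^ (1 - p / N)
    have hY : 0 ≤ Y := by positivity
    calc Y ^ θ ≤ (1 + Y) ^ θ := Real.rpow_le_rpow hY (by linarith) hθ0.le
      _ ≤ (1 + Y) ^ (1 : ℝ) := Real.rpow_le_rpow_of_exponent_le (by linarith) hθ1
      _ = _ := Real.rpow_one _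
  calc (2 * X) ^ (p - 1) * m' ^ (1 - p / N)
      ≤ (2 * X) ^ (p - 1) * ((C * ε ^ (1 / p)) ^ r *
          (X ^ (-((1 - 1 / p) * r)) * m ^ ((1 - 1 / p) * r))) := by gcongr
    _ = (2 ^ (p - 1) * (C * ε ^ (1 / p)) ^ r) *
          (X ^ (p - 1) * (X ^ (-((1 - 1 / p) * r)) * m ^ ((1 - 1 / p) * r))) := by
        rw [Real.mul_rpow (by norm_num) hX.le]; ring
    _ ≤ _ := by
        rw [h2]
        gcongr

/-- Exponential decay from a multiplicative recursion with summable energies. -/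
theorem recursion_exp_bound {m e : ℕ → ℝ} {C σ τ : ℝ} (hC : 0 < C) (hσ : 0 < σ) (hτ : 0 < τ)
    (hm : ∀ j, 0 ≤ m j) (he : ∀ j, 0 ≤ e j) {n : ℕ}
    (h : ∀ j, n ≤ j → m (j + 1) ≤ C * e j ^ σ * m j) (k : ℕ) :
    m (n + k) ≤ m n * (C * τ ^ σ) ^ k * Real.exp (σ * (∑ j ∈ Finset.range k, e (n + j) / τ - k)) := by
  induction k with
  | zero => simp
  | succ k ih =>
    have h1 := h (n + k) (by omega)
    -- From x ≤ e^{x-1} at x = e/τ: a product of energies is thereby controlled by their sum, as in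
    -- the arithmetic-geometric mean inequality.
    have h2 : e (n + k) ^ σ ≤ τ ^ σ * Real.exp (σ * (e (n + k) / τ - 1)) := by
      have h3 : e (n + k) ≤ τ * Real.exp (e (n + k) / τ - 1) := by
        have h4 := Real.add_one_le_exp (e (n + k) / τ - 1)
        rw [sub_add_cancel] at h4
        calc e (n + k) = τ * (e (n + k) / τ) := by field_simp
          _ ≤ _ := by gcongr
      refine (Real.rpow_le_rpow (he _) h3 hσ.le).trans (le_of_eq ?_)
      rw [Real.mul_rpow hτ.le (Real.exp_pos _).le, ← Real.exp_mul, mul_comm σ]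
    have he0 : 0 ≤ e (n + k) ^ σ := Real.rpow_nonneg (he _) _
    have hτσ : 0 ≤ τ ^ σ := Real.rpow_nonneg hτ.le _
    calc m (n + (k + 1)) ≤ C * e (n + k) ^ σ * m (n + k) := by rw [← add_assoc]; exact h1
      _ ≤ C * (τ ^ σ * Real.exp (σ * (e (n + k) / τ - 1))) *
          (m n * (C * τ ^ σ) ^ k *
            Real.exp (σ * (∑ j ∈ Finset.range k, e (n + j) / τ - k))) := by
          have := hm (n + k)
          gcongr
      _ = m n * (C * τ ^ σ) ^ (k + 1) * (Real.exp (σ * (e (n + k) / τ - 1)) *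
            Real.exp (σ * (∑ j ∈ Finset.range k, e (n + j) / τ - k))) := by ring
      _ = _ := by
          rw [← Real.exp_add, Finset.sum_range_succ]
          congr 2
          push_cast
          ring

/-! ### Weighted tails of the convection coefficient -/

/-- The integral of a power of `b` over a small set, by Hölder's inequality. -/
theorem exists_integral_indicator_rpow_le {X : Type*} [MeasurableSpace X] {μ : Measure X}
    [IsFiniteMeasure μ] {N p : ℝ} (hp : 1 < p) (hpN : p < N) {b : X → ℝ}
    (hb : MemLp b (ENNReal.ofReal (N / (p - 1))) μ) :
    ∃ B : ℝ, 0 ≤ B ∧ ∀ S : Set X, NullMeasurableSet S μ →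
      ∫ x, S.indicator (fun x => |b x| ^ (p / (p - 1))) x ∂μ ≤ B * μ.real S ^ (1 - p / N) := by
  have hp' : 0 < p / (p - 1) := div_pos (by linarith) (by linarith)
  -- The power |b|^{p'} lies in L^{N/p}, whose conjugate exponent produces the power 1 - p/N of the
  -- measure.
  have h1 : MemLp (fun x => |b x| ^ (p / (p - 1))) (ENNReal.ofReal (N / p)) μ := by
    have h := hb.norm_rpow_div (ENNReal.ofReal (p / (p - 1)))
    rw [ENNReal.toReal_ofReal hp'.le, ← ENNReal.ofReal_div_of_pos hp'] at h
    have e : N / (p - 1) / (p / (p - 1)) = N / p := by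
      have : p - 1 ≠ 0 := by linarith
      field_simp
    rw [e] at h
    exact h
  have hNp : 1 ≤ N / p := by rw [le_div_iff₀ (by linarith)]; linarith
  refine ⟨(eLpNorm (fun x => |b x| ^ (p / (p - 1))) (ENNReal.ofReal (N / p)) μ).toReal,
    ENNReal.toReal_nonneg, fun S hS => ?_⟩
  have hm : AEStronglyMeasurable (S.indicator fun x => |b x| ^ (p / (p - 1))) μ :=
    (aestronglyMeasurable_indicator_iff₀ hS).2 h1.1.restrict
  have h2 := eLpNorm_one_le_mul_measure_rpow hm (S := S)
    (fun x hx => Set.indicator_of_notMem hx _) hNp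
  have h3 : eLpNorm (S.indicator fun x => |b x| ^ (p / (p - 1))) 1 μ ≤
      eLpNorm (fun x => |b x| ^ (p / (p - 1))) (ENNReal.ofReal (N / p)) μ *
        μ S ^ (1 - 1 / (N / p)) := by
    refine h2.trans ?_
    gcongr
    exact eLpNorm_indicator_le _
  have hexp : 0 ≤ 1 - 1 / (N / p) := by
    rw [sub_nonneg, div_le_one (by linarith)]; exact hNp
  have h4 := ENNReal.toReal_mono (ENNReal.mul_ne_top h1.2.ne
    (ENNReal.rpow_ne_top_of_nonneg hexp (measure_ne_top _ _))) h3
  rw [ENNReal.toReal_mul, ← ENNReal.toReal_rpow, one_div_div] at h4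
  refine le_trans (le_of_eq ?_) h4
  rw [eLpNorm_one_eq_lintegral_enorm, ← integral_norm_eq_lintegral_enorm hm]
  refine integral_congr_ae (.of_forall fun x => ?_)
  simp only
  rw [Real.norm_of_nonneg]
  exact Set.indicator_nonneg (fun x _ => by positivity) x

theorem integral_indicator_energy_mono {X F : Type*} [MeasurableSpace X] [NormedAddCommGroup F]
    {μ : Measure X} {p : ℝ} (hp : 0 < p) {D : X → F} {S T : Set X} (hST : S ⊆ T)
    (hT : MemLp (T.indicator D) (ENNReal.ofReal p) μ) :
    ∫ x, ‖S.indicator D x‖ ^ p ∂μ ≤ ∫ x, ‖T.indicator D x‖ ^ p ∂μ := by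
  have hi : Integrable (fun x => ‖T.indicator D x‖ ^ p) μ := by
    have := hT.integrable_norm_rpow (by simpa using hp) ENNReal.ofReal_ne_top
    rwa [ENNReal.toReal_ofReal hp.le] at this
  refine integral_mono_of_nonneg (.of_forall fun x => by positivity) hi (.of_forall fun x => ?_)
  simp only
  gcongr
  exact norm_indicator_le_of_subset hST D x

/-- Weighted decay of the superlevel sets in the subcritical case. -/
theorem tendsto_weighted_tail_of_lt {X F : Type*} [MeasurableSpace X] [NormedAddCommGroup F]
    {μ : Measure X} [IsFiniteMeasure μ] {N p : ℝ} (hp : 1 < p) (hpN : p < N) {u : X → ℝ} {D : X → F}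
    (hu : AEMeasurable u μ)
    (hDp : ∀ k : ℝ, 0 < k → MemLp ({x | |u x| < k}.indicator D) (ENNReal.ofReal p) μ)
    (hE : Tendsto (fun n : ℕ => (1 / (n : ℝ)) * ∫ x, ‖{x | |u x| < (n : ℝ)}.indicator D x‖ ^ p ∂μ)
      atTop (𝓝 0)) {C k₀ : ℝ} (hC : 0 < C)
    (hlev : ∀ s t : ℝ, k₀ ≤ s → s < t → μ.real {x | t ≤ |u x|} ^ (1 - 1 / N) ≤
      C / (t - s) * (∫ x, ‖{x | s ≤ |u x| ∧ |u x| < t}.indicator D x‖ ^ p ∂μ) ^ (1 / p) *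
        μ.real {x | s ≤ |u x|} ^ (1 - 1 / p))
    {b : X → ℝ} (hb : MemLp b (ENNReal.ofReal (N / (p - 1))) μ) :
    Tendsto (fun i : ℕ => ((2 : ℝ) ^ i) ^ (p - 1) *
      ∫ x, {x | (2 : ℝ) ^ i ≤ |u x|}.indicator (fun x => |b x| ^ (p / (p - 1))) x ∂μ)
      atTop (𝓝 0) := by
  set y : ℕ → ℝ := fun i => ((2 : ℝ) ^ i) ^ (p - 1) *
    μ.real {x | (2 : ℝ) ^ i ≤ |u x|} ^ (1 - p / N) with hy
  -- The energy is normalized at the upper end 2^{i+1} of the dyadic shell; relative to its lower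
  -- end 2^i this becomes 2 ε i.
  set ε : ℕ → ℝ := fun i => (1 / ((2 ^ (i + 1) : ℕ) : ℝ)) *
    ∫ x, ‖{x | |u x| < ((2 ^ (i + 1) : ℕ) : ℝ)}.indicator D x‖ ^ p ∂μ with hε
  have hεlim : Tendsto ε atTop (𝓝 0) :=
    hE.comp ((tendsto_pow_atTop_atTop_of_one_lt (by norm_num : 1 < 2)).comp (tendsto_add_atTop_nat 1))
  have hε0 : ∀ i, 0 ≤ ε i := fun i =>
    mul_nonneg (by positivity) (integral_nonneg fun x => by positivity)
  set δ : ℕ → ℝ := fun i => 2 ^ (p - 1) * (C * (2 * ε i) ^ (1 / p)) ^ ((N - p) / (N - 1)) with hδ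
  have hp0 : 0 < p := by linarith
  have hr0 : 0 < (N - p) / (N - 1) := div_pos (by linarith) (by linarith)
  have hδlim : Tendsto δ atTop (𝓝 0) := by
    have h1 : Tendsto (fun i => 2 * ε i) atTop (𝓝 0) := by simpa using hεlim.const_mul 2
    have h2 := h1.rpow_const (p := 1 / p) (Or.inr (by positivity))
    rw [Real.zero_rpow (by positivity)] at h2
    have h3 : Tendsto (fun i => C * (2 * ε i) ^ (1 / p)) atTop (𝓝 0) := by
      simpa using h2.const_mul C
    have h4 := h3.rpow_const (p := (N - p) / (N - 1)) (Or.inr hr0.le)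
    rw [Real.zero_rpow hr0.ne'] at h4
    have h5 := h4.const_mul ((2 : ℝ) ^ (p - 1))
    rwa [mul_zero] at h5
  have hylim : Tendsto y atTop (𝓝 0) := by
    refine tendsto_zero_of_le_mul_one_add (fun i => by positivity) hδlim ?_
    have h2 : Tendsto (fun i : ℕ => (2 : ℝ) ^ i) atTop atTop :=
      tendsto_pow_atTop_atTop_of_one_lt (by norm_num)
    filter_upwards [h2.eventually_ge_atTop k₀] with i hi
    have hX : (0 : ℝ) < 2 ^ i := by positivity
    have hlt : (2 : ℝ) ^ i < 2 ^ (i + 1) := by rw [pow_succ]; linarith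
    have h3 := hlev _ _ hi hlt
    have h4 : ∫ x, ‖{x | (2 : ℝ) ^ i ≤ |u x| ∧ |u x| < 2 ^ (i + 1)}.indicator D x‖ ^ p ∂μ ≤
        2 * ε i * 2 ^ i := by
      have h5 : 2 * ε i * 2 ^ i =
          ∫ x, ‖{x | |u x| < (2 : ℝ) ^ (i + 1)}.indicator D x‖ ^ p ∂μ := by
        simp only [hε]
        push_cast
        rw [pow_succ]
        field_simp
      rw [h5]
      exact integral_indicator_energy_mono hp0 (fun x hx => hx.2) (hDp _ (by positivity))
    have h6 : (2 : ℝ) ^ (i + 1) - 2 ^ i = 2 ^ i := by rw [pow_succ]; ring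
    rw [h6] at h3
    have h7 := dyadic_rescaled_le (ε := 2 * ε i) hp hpN hC (by linarith [hε0 i]) hX
      measureReal_nonneg measureReal_nonneg (h3.trans (by
        have := integral_nonneg (μ := μ) (f := fun x =>
          ‖{x | (2 : ℝ) ^ i ≤ |u x| ∧ |u x| < 2 ^ (i + 1)}.indicator D x‖ ^ p)
          (fun x => by positivity)
        gcongr))
    rw [← pow_succ'] at h7
    exact h7
  obtain ⟨B, hB, hBS⟩ := exists_integral_indicator_rpow_le hp hpN hb
  have hlim : Tendsto (fun i => B * y i) atTop (𝓝 0) := by simpa using hylim.const_mul B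
  refine squeeze_zero (fun i => ?_) (fun i => ?_) hlim
  · exact mul_nonneg (by positivity)
      (integral_nonneg fun x => Set.indicator_nonneg (fun x _ => by positivity) x)
  · have h1 := hBS {x | (2 : ℝ) ^ i ≤ |u x|}
      (nullMeasurableSet_le aemeasurable_const (measurable_norm.comp_aemeasurable hu))
    calc _ ≤ ((2 : ℝ) ^ i) ^ (p - 1) * (B * μ.real {x | (2 : ℝ) ^ i ≤ |u x|} ^ (1 - p / N)) := by
          gcongr
      _ = B * y i := by simp only [hy]; ring

/-- Exponential decay of the superlevel sets in the critical case. -/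
theorem exists_measure_superlevel_le_exp {X F : Type*} [MeasurableSpace X] [NormedAddCommGroup F]
    {μ : Measure X} [IsFiniteMeasure μ] {p : ℝ} (hp : 1 < p) {u : X → ℝ} {D : X → F}
    (hDp : ∀ k : ℝ, 0 < k → MemLp ({x | |u x| < k}.indicator D) (ENNReal.ofReal p) μ)
    (hE : Tendsto (fun n : ℕ => (1 / (n : ℝ)) * ∫ x, ‖{x | |u x| < (n : ℝ)}.indicator D x‖ ^ p ∂μ)
      atTop (𝓝 0)) {C k₀ : ℝ} (hC : 0 < C)
    (hlev : ∀ s t : ℝ, k₀ ≤ s → s < t → μ.real {x | t ≤ |u x|} ^ (1 - 1 / p) ≤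
      C / (t - s) * (∫ x, ‖{x | s ≤ |u x| ∧ |u x| < t}.indicator D x‖ ^ p ∂μ) ^ (1 / p) *
        μ.real {x | s ≤ |u x|} ^ (1 - 1 / p)) (hu : AEMeasurable u μ) (M : ℝ) :
    ∀ᶠ n : ℕ in atTop, μ.real {x | ((2 * n : ℕ) : ℝ) ≤ |u x|} ≤
      μ.real Set.univ * Real.exp (-M * n) := by
  have hp0 : 0 < p := by linarith
  set m : ℕ → ℝ := fun j => μ.real {x | (j : ℝ) ≤ |u x|} with hm
  set e : ℕ → ℝ := fun j =>
    ∫ x, ‖{x | (j : ℝ) ≤ |u x| ∧ |u x| < ((j + 1 : ℕ) : ℝ)}.indicator D x‖ ^ p ∂μ with he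
  have he0 : ∀ j, 0 ≤ e j := fun j => integral_nonneg fun x => by positivity
  set σ := 1 / (p - 1) with hσ
  have hσ0 : 0 < σ := by rw [hσ]; exact div_pos one_pos (by linarith)
  set q := p / (p - 1) with hq
  have hq0 : 0 < q := div_pos hp0 (by linarith)
  have hpm : p - 1 ≠ 0 := by linarith
  -- The level estimate with gap 1, raised to the power p' = p/(p-1): for p = N the two measure
  -- exponents are both 1 - 1/p and become 1.
  have hrec : ∀ j : ℕ, k₀ ≤ j → m (j + 1) ≤ C ^ q * e j ^ σ * m j := by
    intro j hj
    have h1 := hlev j ((j + 1 : ℕ) : ℝ) hj (by push_cast; linarith)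
    have h2 : ((j + 1 : ℕ) : ℝ) - j = 1 := by push_cast; ring
    rw [h2, div_one] at h1
    have hexp : (1 - 1 / p) * q = 1 := by rw [hq]; field_simp
    have hexp' : 1 / p * q = σ := by rw [hq, hσ]; field_simp
    have h3 := Real.rpow_le_rpow (Real.rpow_nonneg measureReal_nonneg _) h1 hq0.le
    rw [← Real.rpow_mul measureReal_nonneg, hexp, Real.rpow_one,
      Real.mul_rpow (mul_nonneg hC.le (Real.rpow_nonneg (he0 j) _))
        (Real.rpow_nonneg measureReal_nonneg _),
      Real.mul_rpow hC.le (Real.rpow_nonneg (he0 j) _), ← Real.rpow_mul measureReal_nonneg, hexp,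
      Real.rpow_one, ← Real.rpow_mul (he0 j), hexp'] at h3
    exact h3
  have hCq : 0 < C ^ q := Real.rpow_pos_of_pos hC _
  -- Chosen so that each step of the recursion gains exactly the factor e^{-M} when its energy
  -- equals τ.
  set τ : ℝ := (Real.exp (-M) / C ^ q) ^ (1 / σ) with hτ
  have hτ0 : 0 < τ := by positivity
  have hτσ : C ^ q * τ ^ σ = Real.exp (-M) := by
    rw [hτ, ← Real.rpow_mul (by positivity), one_div_mul_cancel hσ0.ne', Real.rpow_one]
    field_simp
  -- Energy o(n) makes the mean energy of the n unit shells between n and 2n at most τ, so the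
  -- exponential correction in the recursion is at most 1.
  have hE2 : ∀ᶠ n : ℕ in atTop,
      ∫ x, ‖{x | |u x| < ((2 * n : ℕ) : ℝ)}.indicator D x‖ ^ p ∂μ ≤ n * τ := by
    have h1 := (hE.comp (tendsto_id.const_mul_atTop' (by norm_num : 0 < 2))).eventually
      (ge_mem_nhds (half_pos hτ0))
    filter_upwards [h1, eventually_gt_atTop 0] with n hn hn0
    have hn0' : (0 : ℝ) < n := by exact_mod_cast hn0
    simp only [Function.comp_apply, id] at hn
    rw [one_div_mul_eq_div, div_le_iff₀ (by push_cast; linarith)] at hn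
    refine hn.trans (le_of_eq ?_)
    push_cast
    ring
  filter_upwards [hE2, tendsto_natCast_atTop_atTop.eventually_ge_atTop k₀] with n hn hnk
  have hbd := recursion_exp_bound (m := m) (e := e) hCq hσ0 hτ0 (fun j => measureReal_nonneg) he0
    (n := n) (fun j hj => hrec j (hnk.trans (by exact_mod_cast hj))) n
  have hsum : ∑ j ∈ Finset.range n, e (n + j) ≤
      ∫ x, ‖{x | |u x| < ((2 * n : ℕ) : ℝ)}.indicator D x‖ ^ p ∂μ := by
    have hInt : ∀ j, Integrable (fun x =>
        ‖{x | ((n + j : ℕ) : ℝ) ≤ |u x| ∧ |u x| < ((n + j + 1 : ℕ) : ℝ)}.indicator D x‖ ^ p) μ := by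
      intro j
      have hS : NullMeasurableSet {x | ((n + j : ℕ) : ℝ) ≤ |u x|} μ :=
        nullMeasurableSet_le aemeasurable_const (measurable_norm.comp_aemeasurable hu)
      have hmem : MemLp ({x | ((n + j : ℕ) : ℝ) ≤ |u x| ∧ |u x| < ((n + j + 1 : ℕ) : ℝ)}.indicator D)
          (ENNReal.ofReal p) μ := by
        have hb := hDp ((n + j + 1 : ℕ) : ℝ) (by positivity)
        have heq : {x | ((n + j : ℕ) : ℝ) ≤ |u x| ∧ |u x| < ((n + j + 1 : ℕ) : ℝ)}.indicator D =
            {x | ((n + j : ℕ) : ℝ) ≤ |u x|}.indicator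
              ({x | |u x| < ((n + j + 1 : ℕ) : ℝ)}.indicator D) := by
          rw [Set.indicator_indicator]; rfl
        rw [heq]
        refine hb.mono ((aestronglyMeasurable_indicator_iff₀ hS).2 hb.1.restrict)
          (.of_forall fun x => norm_indicator_le_norm_self _ _)
      have := hmem.integrable_norm_rpow (by simpa using hp0) ENNReal.ofReal_ne_top
      rwa [ENNReal.toReal_ofReal hp0.le] at this
    rw [← integral_finsetSum _ fun j _ => hInt j]
    have hi : Integrable (fun x => ‖{x | |u x| < ((2 * n : ℕ) : ℝ)}.indicator D x‖ ^ p) μ := by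
      rcases Nat.eq_zero_or_pos n with rfl | hn0
      · have : {x | |u x| < ((2 * 0 : ℕ) : ℝ)} = ∅ := by
          ext x; simp
        rw [this]
        simp [Real.zero_rpow hp0.ne']
      · have := (hDp ((2 * n : ℕ) : ℝ) (by positivity)).integrable_norm_rpow (by simpa using hp0)
          ENNReal.ofReal_ne_top
        rwa [ENNReal.toReal_ofReal hp0.le] at this
    refine integral_mono (integrable_finsetSum _ fun j _ => hInt j) hi fun x => ?_
    simp only
    by_cases hx : ∃ j ∈ Finset.range n, ((n + j : ℕ) : ℝ) ≤ |u x| ∧ |u x| < ((n + j + 1 : ℕ) : ℝ)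
    · obtain ⟨j, hj, hjx⟩ := hx
      rw [Finset.sum_eq_single_of_mem j hj]
      · gcongr
        refine norm_indicator_le_of_subset (fun x hx => ?_) D x
        have hj' : n + j + 1 ≤ 2 * n := by have := Finset.mem_range.1 hj; omega
        exact lt_of_lt_of_le hx.2 (by exact_mod_cast hj')
      · intro i _ hij
        rw [Set.indicator_of_notMem, norm_zero, Real.zero_rpow hp0.ne']
        rintro ⟨h1, h2⟩
        have h3 : n + i < n + j + 1 := by exact_mod_cast h1.trans_lt hjx.2
        have h4 : n + j < n + i + 1 := by exact_mod_cast hjx.1.trans_lt h2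
        omega
    · push Not at hx
      rw [Finset.sum_eq_zero]
      · positivity
      · intro j hj
        rw [Set.indicator_of_notMem, norm_zero, Real.zero_rpow hp0.ne']
        rintro ⟨h1, h2⟩
        exact absurd h2 (not_lt.2 (hx j hj h1))
  have hexp : Real.exp (σ * (∑ j ∈ Finset.range n, e (n + j) / τ - n)) ≤ 1 := by
    rw [Real.exp_le_one_iff]
    refine mul_nonpos_of_nonneg_of_nonpos hσ0.le ?_
    rw [← Finset.sum_div, sub_nonpos, div_le_iff₀ hτ0]
    exact hsum.trans hn
  rw [hτσ] at hbd
  calc μ.real {x | ((2 * n : ℕ) : ℝ) ≤ |u x|} = m (n + n) := by simp only [hm, two_mul]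
    _ ≤ m n * Real.exp (-M) ^ n *
        Real.exp (σ * (∑ j ∈ Finset.range n, e (n + j) / τ - n)) := hbd
    _ ≤ m n * Real.exp (-M) ^ n * 1 := by
        have : 0 ≤ m n := measureReal_nonneg
        gcongr
    _ ≤ μ.real Set.univ * Real.exp (-M) ^ n := by
        rw [mul_one]
        gcongr
        exact measureReal_mono (Set.subset_univ _)
    _ = _ := by
        rw [← Real.exp_nat_mul]; congr 2; ring

/-- Weighted decay of the superlevel sets in the critical case. -/
theorem tendsto_weighted_tail_of_exp {X : Type*} [MeasurableSpace X] {μ : Measure X}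
    [IsFiniteMeasure μ] {N : ℕ} {p : ℝ} (hN : 2 ≤ N) (hpN : p = N) {u : X → ℝ}
    (hu : AEMeasurable u μ)
    (hexp : ∀ M : ℝ, ∀ᶠ n : ℕ in atTop, μ.real {x | ((2 * n : ℕ) : ℝ) ≤ |u x|} ≤
      μ.real Set.univ * Real.exp (-M * n))
    {b : X → ℝ} (hbm : AEMeasurable b μ) (hbi : Integrable (fun x => |b x| ^ (p / (p - 1))) μ)
    (hb : Integrable
      (fun x => (1 + |b x|) ^ (p / (p - 1)) * (Real.log (1 + |b x|)) ^ (N - 1 : ℕ)) μ) :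
    Tendsto (fun i : ℕ => ((2 : ℝ) ^ i) ^ (p - 1) *
      ∫ x, {x | (2 : ℝ) ^ i ≤ |u x|}.indicator (fun x => |b x| ^ (p / (p - 1))) x ∂μ)
      atTop (𝓝 0) := by
  have hN' : (2 : ℝ) ≤ N := by exact_mod_cast hN
  set q := p / (p - 1) with hq
  have hq0 : 0 < q := div_pos (by linarith) (by linarith)
  have hX : Tendsto (fun i : ℕ => (2 : ℝ) ^ i) atTop atTop :=
    tendsto_pow_atTop_atTop_of_one_lt (by norm_num)
  set g : X → ℝ := fun x => (1 + |b x|) ^ q * (Real.log (1 + |b x|)) ^ (N - 1 : ℕ) with hg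
  have hg0 : ∀ x, 0 ≤ g x := fun x => by
    have : 0 ≤ Real.log (1 + |b x|) := Real.log_nonneg (by linarith [abs_nonneg (b x)])
    positivity
  have hbS : ∀ c : ℝ, NullMeasurableSet {x | c < |b x|} μ := fun c =>
    nullMeasurableSet_lt aemeasurable_const (measurable_norm.comp_aemeasurable hbm)
  have l1 : Tendsto (fun i : ℕ => μ.real Set.univ *
      (((2 : ℝ) ^ i) ^ (p - 1) * Real.exp (-1 * (2 : ℝ) ^ i))) atTop (𝓝 0) := by
    have h1 := (tendsto_rpow_mul_exp_neg_mul_atTop_nhds_zero (p - 1) 1 one_pos).comp hX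
    simpa using h1.const_mul (μ.real Set.univ)
  have l2 : Tendsto (fun i : ℕ => ∫ x, {x | Real.exp ((2 : ℝ) ^ i) < |b x|}.indicator g x ∂μ) atTop
      (𝓝 0) := by
    have h1 : Tendsto (fun i : ℕ => ∫ x, {x | Real.exp ((2 : ℝ) ^ i) < |b x|}.indicator g x ∂μ) atTop
        (𝓝 (∫ _, (0 : ℝ) ∂μ)) := by
      refine tendsto_integral_of_dominated_convergence g
        (fun i => (aestronglyMeasurable_indicator_iff₀ (hbS _)).2 hb.1.restrict) hb
        (fun i => .of_forall fun x => ?_) (.of_forall fun x => ?_)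
      · exact (norm_indicator_le_norm_self _ _).trans (Real.norm_of_nonneg (hg0 x)).le
      · have h2 := (Real.tendsto_exp_atTop.comp hX).eventually_ge_atTop |b x|
        refine tendsto_const_nhds.congr' ?_
        filter_upwards [h2] with i hi
        rw [Set.indicator_of_notMem]
        exact not_lt.2 hi
    simpa using h1
  have hlim := l1.add l2
  rw [add_zero] at hlim
  refine squeeze_zero' (.of_forall fun i => ?_) ?_ hlim
  · exact mul_nonneg (by positivity)
      (integral_nonneg fun x => Set.indicator_nonneg (fun x _ => by positivity) x)
  -- The rate must beat the factor e^{qY} from the region |b| ≤ e^Y, hence q + 1. The hypothesis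
  -- compares level 2n with n, so it is invoked at twice this rate.
  have hmeas : ∀ᶠ i : ℕ in atTop, μ.real {x | (2 : ℝ) ^ i ≤ |u x|} ≤
      μ.real Set.univ * Real.exp (-(q + 1) * (2 : ℝ) ^ i) := by
    have h2 : Tendsto (fun i : ℕ => 2 ^ (i - 1)) atTop (atTop : Filter ℕ) :=
      (tendsto_pow_atTop_atTop_of_one_lt (by norm_num : 1 < 2)).comp (tendsto_sub_atTop_nat 1)
    filter_upwards [h2.eventually (hexp (2 * (q + 1))), eventually_ge_atTop 1] with i hi hi1
    have h3 : 2 * 2 ^ (i - 1) = 2 ^ i := by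
      rw [← pow_succ', Nat.sub_add_cancel hi1]
    have h4 : (2 : ℝ) * 2 ^ (i - 1) = 2 ^ i := by exact_mod_cast h3
    rw [h3] at hi
    push_cast at hi
    rw [← h4] at hi ⊢
    refine hi.trans (le_of_eq ?_)
    congr 2
    ring
  filter_upwards [hmeas] with i hi
  set Y : ℝ := (2 : ℝ) ^ i with hY
  have hY0 : 0 < Y := by positivity
  have hS : NullMeasurableSet {x | Y ≤ |u x|} μ :=
    nullMeasurableSet_le aemeasurable_const (measurable_norm.comp_aemeasurable hu)
  -- Split at |b| = e^Y. Below, |b|^q ≤ e^{qY} is beaten by the decay of the superlevel set. Above,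
  -- Y ≤ log(1 + |b|), and p - 1 = N - 1 makes the weighted power at most g, whose integral over
  -- {|b| > e^Y} vanishes in the limit.
  have hpt : ∀ x, Y ^ (p - 1) * {x | Y ≤ |u x|}.indicator (fun x => |b x| ^ q) x ≤
      {x | Y ≤ |u x|}.indicator (fun _ => Y ^ (p - 1) * Real.exp (q * Y)) x +
        {x | Real.exp Y < |b x|}.indicator g x := by
    intro x
    have hg1 : 0 ≤ {x | Real.exp Y < |b x|}.indicator g x :=
      Set.indicator_nonneg (fun x _ => hg0 x) x
    by_cases hx : x ∈ {x | Y ≤ |u x|}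
    swap
    · rw [Set.indicator_of_notMem hx, Set.indicator_of_notMem hx]
      simpa using hg1
    rw [Set.indicator_of_mem hx, Set.indicator_of_mem hx]
    by_cases hbx : Real.exp Y < |b x|
    · rw [Set.indicator_of_mem (show x ∈ {x | Real.exp Y < |b x|} from hbx)]
      have h1 : Y ≤ Real.log (1 + |b x|) := by
        rw [Real.le_log_iff_exp_le (by positivity)]; linarith
      have h2 : Y ^ (p - 1) ≤ Real.log (1 + |b x|) ^ (N - 1 : ℕ) := by
        have : p - 1 = ((N - 1 : ℕ) : ℝ) := by rw [hpN, Nat.cast_sub (by omega)]; simp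
        rw [this, Real.rpow_natCast]
        gcongr
      have h3 : |b x| ^ q ≤ (1 + |b x|) ^ q :=
        Real.rpow_le_rpow (abs_nonneg _) (by linarith) hq0.le
      have h4 : Y ^ (p - 1) * |b x| ^ q ≤ g x := by
        rw [mul_comm]
        simp only [hg]
        gcongr
      have h5 : 0 ≤ Y ^ (p - 1) * Real.exp (q * Y) := by positivity
      linarith
    · have h1 : |b x| ^ q ≤ Real.exp (q * Y) := by
        rw [mul_comm, Real.exp_mul]
        exact Real.rpow_le_rpow (abs_nonneg _) (not_lt.1 hbx) hq0.le
      have h2 : Y ^ (p - 1) * |b x| ^ q ≤ Y ^ (p - 1) * Real.exp (q * Y) := by gcongr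
      linarith
  rw [← integral_const_mul]
  have i1 : Integrable ({x | Y ≤ |u x|}.indicator fun _ => Y ^ (p - 1) * Real.exp (q * Y)) μ :=
    (integrable_const _).indicator₀ hS
  have i2 : Integrable ({x | Real.exp Y < |b x|}.indicator g) μ := hb.indicator₀ (hbS _)
  refine (integral_mono ((hbi.indicator₀ hS).const_mul _) (i1.add i2) hpt).trans ?_
  rw [integral_add' i1 i2, integral_indicator₀ hS, setIntegral_const]
  gcongr
  rw [smul_eq_mul]
  calc μ.real {x | Y ≤ |u x|} * (Y ^ (p - 1) * Real.exp (q * Y))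
      ≤ (μ.real Set.univ * Real.exp (-(q + 1) * Y)) * (Y ^ (p - 1) * Real.exp (q * Y)) := by
        gcongr
    _ = μ.real Set.univ * (Y ^ (p - 1) * (Real.exp (-(q + 1) * Y) * Real.exp (q * Y))) := by ring
    _ = _ := by
        rw [← Real.exp_add]
        congr 3
        ring

/-- Integrability of the power of `b` in the critical case. -/
theorem integrable_rpow_of_integrable_log {X : Type*} [MeasurableSpace X] {μ : Measure X}
    [IsFiniteMeasure μ] {q : ℝ} (hq : 0 < q) (k : ℕ) {b : X → ℝ} (hbm : AEMeasurable b μ)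
    (hb : Integrable (fun x => (1 + |b x|) ^ q * (Real.log (1 + |b x|)) ^ k) μ) :
    Integrable (fun x => |b x| ^ q) μ := by
  have hm : AEStronglyMeasurable (fun x => |b x| ^ q) μ :=
    ((measurable_norm.comp_aemeasurable hbm).pow_const q).aestronglyMeasurable
  refine Integrable.mono' ((integrable_const (Real.exp 1 ^ q)).add hb) hm (.of_forall fun x => ?_)
  have hb0 := abs_nonneg (b x)
  have hlog : 0 ≤ Real.log (1 + |b x|) := Real.log_nonneg (by linarith)
  rw [Real.norm_of_nonneg (by positivity), Pi.add_apply]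
  -- The logarithm is useless where b is small, but there |b| is bounded; elsewhere it is at least
  -- 1.
  by_cases h : 1 + |b x| ≤ Real.exp 1
  · have h1 : |b x| ^ q ≤ Real.exp 1 ^ q := Real.rpow_le_rpow hb0 (by linarith) hq.le
    have h2 : 0 ≤ (1 + |b x|) ^ q * (Real.log (1 + |b x|)) ^ k := by positivity
    linarith
  · have h1 : |b x| ^ q ≤ (1 + |b x|) ^ q := Real.rpow_le_rpow hb0 (by linarith) hq.le
    have h2 : 1 ≤ Real.log (1 + |b x|) := by
      rw [Real.le_log_iff_exp_le (by positivity)]; linarith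
    have h3 : (1 + |b x|) ^ q * 1 ≤ (1 + |b x|) ^ q * (Real.log (1 + |b x|)) ^ k := by
      gcongr
      exact one_le_pow₀ h2
    have h4 : 0 ≤ Real.exp 1 ^ q := by positivity
    linarith

/-! ### Measurability, fluxes and the renormalized test functions -/

/-- The composition of a Carathéodory function with a measurable function is measurable. -/
theorem IsCaratheodory.aemeasurable_comp {N : ℕ} {Ω : Set (Eu N)} {X Y : Type*}
    [NormedAddCommGroup X] [SecondCountableTopology X] [MeasurableSpace X] [BorelSpace X]
    [PseudoMetricSpace Y] [MeasurableSpace Y] [BorelSpace Y]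
    {F : Eu N → X → Y} (hF : IsCaratheodory Ω F) {s : Eu N → X}
    (hs : AEMeasurable s (volume.restrict Ω)) :
    AEMeasurable (fun x => F x (s x)) (volume.restrict Ω) := by
  have hsm : StronglyMeasurable (hs.mk s) := hs.measurable_mk.stronglyMeasurable
  -- For a simple function the composition is, on each fibre, a section of F with frozen second
  -- variable; continuity of F in that variable passes to the limit.
  refine aemeasurable_of_tendsto_metrizable_ae atTop (f := fun n x => F x (hsm.approx n x))
    (fun n => ?_) ?_
  · have huniv : (⋃ y : (hsm.approx n).range, (hsm.approx n) ⁻¹' {(y : X)}) = Set.univ :=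
      Set.eq_univ_of_forall fun x => Set.mem_iUnion.2
        ⟨⟨hsm.approx n x, SimpleFunc.mem_range_self _ x⟩, rfl⟩
    suffices h : AEMeasurable (fun x => F x (hsm.approx n x)) ((volume.restrict Ω).restrict
        (⋃ y : (hsm.approx n).range, (hsm.approx n) ⁻¹' {(y : X)})) by
      rwa [huniv, Measure.restrict_univ] at h
    rw [aemeasurable_iUnion_iff]
    intro y
    refine ((hF.1 y).restrict (s := (hsm.approx n) ⁻¹' {(y : X)})).congr ?_
    refine (ae_restrict_iff' ((hsm.approx n).measurableSet_fiber _)).2 (.of_forall fun x hx => ?_)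
    have hx' : hsm.approx n x = y := hx
    simp only [hx']
  · filter_upwards [hF.2, hs.ae_eq_mk] with x hx hxs
    have := (hx.tendsto (hs.mk s x)).comp (hsm.tendsto_approx x)
    rw [hxs]
    exact this

/-- The test function `h (t) arctan (m (s - t))`. -/
theorem isC1Lipschitz_mul_arctan {h : ℝ → ℝ} (hh : ContDiff ℝ 1 h) {M : ℝ} (hM0 : 0 ≤ M)
    (hb : ∀ s, |h s| ≤ 1) (hM : ∀ s, |deriv h s| ≤ M) (m : ℕ) :
    ∃ K, IsC1Lipschitz (fun y => h y.2 * Real.arctan (m * (y.1 - y.2)))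
      (fun y => h y.2 * (m / (1 + (m * (y.1 - y.2)) ^ 2)))
      (fun y => deriv h y.2 * Real.arctan (m * (y.1 - y.2)) -
        h y.2 * (m / (1 + (m * (y.1 - y.2)) ^ 2))) K := by
  have hh' : Continuous (deriv h) := hh.continuous_deriv le_rfl
  have hcont : Continuous fun y : ℝ × ℝ => (m : ℝ) / (1 + (m * (y.1 - y.2)) ^ 2) :=
    continuous_const.div (by fun_prop) fun y => by positivity
  have hbd : ∀ z : ℝ, |(m : ℝ) / (1 + z ^ 2)| ≤ (m : ℝ) := fun z => by
    rw [abs_of_nonneg (by positivity)]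
    exact div_le_self (by positivity) (by nlinarith [sq_nonneg z])
  have harc : ∀ z, |Real.arctan z| ≤ 2 := fun z => by
    have h1 := Real.arctan_lt_pi_div_two z
    have h2 := Real.neg_pi_div_two_lt_arctan z
    have h3 := Real.pi_lt_four
    rw [abs_le]; constructor <;> linarith
  have h1 : ∀ y : ℝ × ℝ, |h y.2 * ((m : ℝ) / (1 + (m * (y.1 - y.2)) ^ 2))| ≤ (m : ℝ) := fun y => by
    rw [abs_mul]
    calc _ ≤ 1 * (m : ℝ) := by gcongr; exacts [hb _, hbd _]
      _ = m := one_mul _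
  refine ⟨_, isC1Lipschitz_of_bound (M := ⟨M * 2 + m, by positivity⟩)
    ?_ ?_ (fun y => ?_) (fun y => ?_) (fun y => ?_)⟩
  · exact (hh.continuous.comp continuous_snd).mul hcont
  · exact ((hh'.comp continuous_snd).mul (Real.continuous_arctan.comp (by fun_prop))).sub
      ((hh.continuous.comp continuous_snd).mul hcont)
  · have e1 : HasFDerivAt (fun y : ℝ × ℝ => h y.2)
        (deriv h y.2 • ContinuousLinearMap.snd ℝ ℝ ℝ) y :=
      (hh.differentiable one_ne_zero y.2).hasDerivAt.comp_hasFDerivAt y hasFDerivAt_snd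
    have e2 : HasFDerivAt (fun y : ℝ × ℝ => (m : ℝ) * (y.1 - y.2))
        ((m : ℝ) • (ContinuousLinearMap.fst ℝ ℝ ℝ - ContinuousLinearMap.snd ℝ ℝ ℝ)) y :=
      (hasFDerivAt_fst.sub hasFDerivAt_snd).const_mul (m : ℝ)
    have e3 := (Real.hasDerivAt_arctan (m * (y.1 - y.2))).comp_hasFDerivAt y e2
    refine (e1.mul e3).congr_fderiv ?_
    refine ContinuousLinearMap.ext fun z => ?_
    simp only [add_apply, smul_apply, sub_apply, ContinuousLinearMap.coe_fst', ContinuousLinearMap.coe_snd',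
      smul_eq_mul, Function.comp_apply]
    ring
  · refine (h1 y).trans ?_
    change (m : ℝ) ≤ M * 2 + m
    linarith
  · refine (abs_sub _ _).trans ?_
    change _ ≤ M * 2 + (m : ℝ)
    refine add_le_add ?_ (h1 y)
    rw [abs_mul]
    gcongr
    exacts [hM _, harc _]

theorem integrable_inner_of_memLp {X : Type*} [MeasurableSpace X] {μ : Measure X} {N : ℕ} {p : ℝ}
    (hp : 1 < p) {f g : X → Eu N} (hf : MemLp f (ENNReal.ofReal (p / (p - 1))) μ)
    (hg : MemLp g (ENNReal.ofReal p) μ) : Integrable (fun x => ⟪f x, g x⟫) μ := by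
  have hpq : Real.HolderConjugate p (p / (p - 1)) :=
    (Real.holderConjugate_iff_eq_conjExponent hp).2 rfl
  have : ENNReal.HolderConjugate (ENNReal.ofReal (p / (p - 1))) (ENNReal.ofReal p) :=
    hpq.symm.ennrealOfReal
  refine (hf.norm.integrable_mul hg.norm).mono' (hf.1.inner hg.1) (.of_forall fun x => ?_)
  exact norm_inner_le_norm _ _

/-- Truncated fluxes belong to the dual Lebesgue space. -/
theorem memLp_flux {X : Type*} [MeasurableSpace X] {μ : Measure X} {N : ℕ} {p β : ℝ} (hp : 1 < p)
    {S : Set X} (hS : NullMeasurableSet S μ) {A D : X → Eu N} {d : X → ℝ} (hA : AEMeasurable A μ)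
    (hd : MemLp d (ENNReal.ofReal (p / (p - 1))) μ)
    (hD : MemLp (S.indicator D) (ENNReal.ofReal p) μ)
    (hgrowth : ∀ᵐ x ∂μ, ‖A x‖ ≤ β * (|d x| + ‖D x‖ ^ (p - 1))) :
    MemLp (S.indicator A) (ENNReal.ofReal (p / (p - 1))) μ := by
  have hp1 : 0 < p - 1 := by linarith
  have h1 : MemLp (fun x => ‖S.indicator D x‖ ^ (p - 1)) (ENNReal.ofReal (p / (p - 1))) μ := by
    have h := hD.norm_rpow_div (ENNReal.ofReal (p - 1))
    rwa [ENNReal.toReal_ofReal hp1.le, ← ENNReal.ofReal_div_of_pos hp1] at h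
  refine (hd.norm.add h1).of_le_mul (c := |β|)
    ((aestronglyMeasurable_indicator_iff₀ hS).2 hA.aestronglyMeasurable.restrict) ?_
  filter_upwards [hgrowth] with x hx
  have hnn : 0 ≤ |d x| + ‖S.indicator D x‖ ^ (p - 1) := by positivity
  simp only [Pi.add_apply, Real.norm_eq_abs]
  rw [abs_of_nonneg hnn]
  by_cases hxS : x ∈ S
  · rw [Set.indicator_of_mem hxS, Set.indicator_of_mem hxS]
    rw [Set.indicator_of_mem hxS] at hnn
    exact hx.trans (mul_le_mul_of_nonneg_right (le_abs_self β) hnn)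
  · rw [Set.indicator_of_notMem hxS, norm_zero]
    exact mul_nonneg (abs_nonneg _) hnn

theorem abs_arctan_le_two (z : ℝ) : |Real.arctan z| ≤ 2 := by
  have h1 := Real.arctan_lt_pi_div_two z
  have h2 := Real.neg_pi_div_two_lt_arctan z
  have h3 := Real.pi_lt_four
  rw [abs_le]; constructor <;> linarith

/-- The renormalized equation for `u` tested with `h (v) arctan (m (T_K u - T_K v))`. -/
theorem integral_renormalized_test {N : ℕ} {p : ℝ} (hp : 1 < p) {Ω Γd : Set (Eu N)}
    (hΩo : IsOpen Ω) (hΩb : Bornology.IsBounded Ω) {f : Eu N → ℝ} {u v lu : Eu N → ℝ}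
    {A P Du Dv : Eu N → Eu N}
    (hu : AEMeasurable u (volume.restrict Ω))
    (hlu : AEMeasurable lu (volume.restrict Ω)) {K : ℝ} (hK : 0 < K)
    (huW : MemW1Gamma Ω Γd (ENNReal.ofReal p) (fun x => trunc K (u x)))
    (hvW : MemW1Gamma Ω Γd (ENNReal.ofReal p) (fun x => trunc K (v x)))
    (hDu : HasWeakGradient Ω (fun x => trunc K (u x)) ({x | |u x| < K}.indicator Du))
    (hDv : HasWeakGradient Ω (fun x => trunc K (v x)) ({x | |v x| < K}.indicator Dv))
    {c : ℝ} (hlb : ∀ᵐ x ∂(volume.restrict Ω), |u x| < K → |lu x| ≤ c)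
    (hA : MemLp ({x | |u x| < K}.indicator A) (ENNReal.ofReal (p / (p - 1))) (volume.restrict Ω))
    (hP : MemLp ({x | |u x| < K}.indicator P) (ENNReal.ofReal (p / (p - 1))) (volume.restrict Ω))
    {h : ℝ → ℝ} (hh : ContDiff ℝ 1 h) {M : ℝ} (hM0 : 0 ≤ M) (hb : ∀ s, |h s| ≤ 1)
    (hM : ∀ s, |deriv h s| ≤ M) (h0 : ∀ s, K ≤ |s| → h s = 0) (h0' : ∀ s, K ≤ |s| → deriv h s = 0)
    (heq : ∀ (φ : Eu N → ℝ) (Dφ : Eu N → Eu N), MemW1Gamma Ω Γd (ENNReal.ofReal p) φ →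
      MemLp φ ⊤ (volume.restrict Ω) → HasWeakGradient Ω φ Dφ →
      (∫ x in Ω, lu x * φ x * h (u x))
        + (∫ x in Ω, h (u x) * ⟪A x, Dφ x⟫)
        + (∫ x in Ω, h (u x) * ⟪P x, Dφ x⟫)
        + (∫ x in Ω, φ x * deriv h (u x) * ⟪A x, Du x⟫)
        + (∫ x in Ω, φ x * deriv h (u x) * ⟪P x, Du x⟫)
      = ∫ x in Ω, f x * φ x * h (u x)) (m : ℕ) :
    Integrable (fun x =>
      lu x * (h (u x) * h (v x) * Real.arctan (m * (trunc K (u x) - trunc K (v x)))) +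
      h (u x) * h (v x) * (m / (1 + (m * (trunc K (u x) - trunc K (v x))) ^ 2)) *
        ⟪A x + P x, {x | |u x| < K}.indicator Du x - {x | |v x| < K}.indicator Dv x⟫ +
      Real.arctan (m * (trunc K (u x) - trunc K (v x))) *
        (h (u x) * deriv h (v x) * ⟪A x + P x, {x | |v x| < K}.indicator Dv x⟫ +
          deriv h (u x) * h (v x) * ⟪A x + P x, {x | |u x| < K}.indicator Du x⟫))
      (volume.restrict Ω) ∧
    ∫ x in Ω, (lu x * (h (u x) * h (v x) * Real.arctan (m * (trunc K (u x) - trunc K (v x)))) +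
      h (u x) * h (v x) * (m / (1 + (m * (trunc K (u x) - trunc K (v x))) ^ 2)) *
        ⟪A x + P x, {x | |u x| < K}.indicator Du x - {x | |v x| < K}.indicator Dv x⟫ +
      Real.arctan (m * (trunc K (u x) - trunc K (v x))) *
        (h (u x) * deriv h (v x) * ⟪A x + P x, {x | |v x| < K}.indicator Dv x⟫ +
          deriv h (u x) * h (v x) * ⟪A x + P x, {x | |u x| < K}.indicator Du x⟫)) =
    ∫ x in Ω, f x * (h (u x) * h (v x) *
      Real.arctan (m * (trunc K (u x) - trunc K (v x)))) := by
  have : IsFiniteMeasure (volume.restrict Ω) := ⟨by simpa using hΩb.measure_lt_top⟩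
  set ν := volume.restrict Ω with hν
  have hq : 1 ≤ ENNReal.ofReal p := ENNReal.one_le_ofReal.2 hp.le
  set g : Eu N → Eu N := {x | |u x| < K}.indicator Du with hg
  set k : Eu N → Eu N := {x | |v x| < K}.indicator Dv with hk
  set AK : Eu N → Eu N := {x | |u x| < K}.indicator A with hAK
  set PK : Eu N → Eu N := {x | |u x| < K}.indicator P with hPK
  obtain ⟨B, hF⟩ := isC1Lipschitz_mul_arctan hh hM0 hb hM m
  obtain ⟨hφW, hφD⟩ := huW.comp hΩo hΩb hq ENNReal.ofReal_ne_top hDu hvW hDv hF (by simp)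
  have hgp : MemLp g (ENNReal.ofReal p) ν := by
    obtain ⟨w, _, hw, -⟩ := huW.exists_lipApprox hΩo hq hDu
    exact hw.memLp_grad
  set φ : Eu N → ℝ := fun x =>
    h (trunc K (v x)) * Real.arctan (m * (trunc K (u x) - trunc K (v x))) with hφ
  set Dφ : Eu N → Eu N := fun x =>
    (h (trunc K (v x)) * (m / (1 + (m * (trunc K (u x) - trunc K (v x))) ^ 2))) • g x +
    (deriv h (trunc K (v x)) * Real.arctan (m * (trunc K (u x) - trunc K (v x))) -
      h (trunc K (v x)) * (m / (1 + (m * (trunc K (u x) - trunc K (v x))) ^ 2))) • k x with hDφ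
  have hφm : AEStronglyMeasurable φ ν := hφW.1.1.1
  have hφb : ∀ x, ‖φ x‖ ≤ 2 := fun x => by
    rw [hφ, Real.norm_eq_abs, abs_mul]
    calc _ ≤ 1 * (2 : ℝ) := by gcongr; exacts [hb _, abs_arctan_le_two _]
      _ = 2 := one_mul _
  have hDφp : MemLp Dφ (ENNReal.ofReal p) ν := by
    obtain ⟨w, _, hw, -⟩ := hφW.exists_lipApprox hΩo hq hφD
    exact hw.memLp_grad
  have hmain := heq φ Dφ hφW (memLp_top_of_bound hφm 2 (.of_forall hφb)) hφD
  -- Both sides vanish once |s| ≥ K, so truncating inside h changes nothing although the test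
  -- function sees only truncations.
  have htr : ∀ s, h (trunc K s) = h s := fun s => by
    rcases le_total |s| K with hs | hs
    · rw [trunc_of_abs_le hs]
    · rw [h0 s hs, h0 _ (abs_trunc_eq hK.le hs).ge]
  have htr' : ∀ s, deriv h (trunc K s) = deriv h s := fun s => by
    rcases le_total |s| K with hs | hs
    · rw [trunc_of_abs_le hs]
    · rw [h0' s hs, h0' _ (abs_trunc_eq hK.le hs).ge]
  -- Every flux occurs with a factor h(u) or h'(u), which vanishes for |u| ≥ K; hence it may be
  -- replaced by its truncation, for which integrability is known.
  have hind : ∀ (t : ℝ) (H : Eu N → Eu N) (x : Eu N), (K ≤ |u x| → t = 0) →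
      t • H x = t • {x | |u x| < K}.indicator H x := by
    intro t H x ht
    by_cases hx : |u x| < K
    · rw [Set.indicator_of_mem (show x ∈ {x | |u x| < K} from hx)]
    · rw [ht (not_lt.1 hx), zero_smul, zero_smul]
  have hhu : AEStronglyMeasurable (fun x => h (u x)) ν :=
    (hh.continuous.measurable.comp_aemeasurable hu).aestronglyMeasurable
  have hhu' : AEStronglyMeasurable (fun x => deriv h (u x)) ν :=
    ((hh.continuous_deriv le_rfl).measurable.comp_aemeasurable hu).aestronglyMeasurable
  have i1 : Integrable (fun x => lu x * φ x * h (u x)) ν := by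
    refine Integrable.of_bound ((hlu.aestronglyMeasurable.mul hφm).mul hhu) (|c| * 2 * 1) ?_
    filter_upwards [hlb] with x hx
    by_cases hux : |u x| < K
    · rw [norm_mul, norm_mul]
      gcongr
      · exact (hx hux).trans (le_abs_self c)
      · exact hφb x
      · exact hb _
    · rw [h0 _ (not_lt.1 hux), mul_zero, norm_zero]
      positivity
  have hT2 : ∀ H : Eu N → Eu N, MemLp ({x | |u x| < K}.indicator H)
      (ENNReal.ofReal (p / (p - 1))) ν → Integrable (fun x => h (u x) * ⟪H x, Dφ x⟫) ν := by
    intro H hH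
    have h1 := (integrable_inner_of_memLp hp hH hDφp).bdd_mul hhu
      (.of_forall fun x => (Real.norm_eq_abs _).trans_le (hb (u x)))
    refine h1.congr (.of_forall fun x => ?_)
    simp only
    rw [← real_inner_smul_left, ← real_inner_smul_left, ← hind _ H x (fun hx => h0 _ hx)]
  have hT4' : ∀ (H : Eu N → Eu N) (x : Eu N), φ x * deriv h (u x) * ⟪H x, Du x⟫ =
      φ x * deriv h (u x) * ⟪H x, g x⟫ := by
    intro H x
    rw [← real_inner_smul_right, ← real_inner_smul_right,
      hind _ Du x (fun hx => by rw [h0' _ hx, mul_zero])]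
  have hT4 : ∀ H : Eu N → Eu N, MemLp ({x | |u x| < K}.indicator H)
      (ENNReal.ofReal (p / (p - 1))) ν →
      Integrable (fun x => φ x * deriv h (u x) * ⟪H x, Du x⟫) ν := by
    intro H hH
    have h1 := (integrable_inner_of_memLp hp hH hgp).bdd_mul (hφm.mul hhu')
      (c := 2 * M) (.of_forall fun x => by
        rw [Pi.mul_apply, norm_mul]
        gcongr
        exacts [hφb x, hM _])
    refine h1.congr (.of_forall fun x => ?_)
    simp only [Pi.mul_apply]
    rw [hT4', ← real_inner_smul_left, ← real_inner_smul_left,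
      ← hind _ H x (fun hx => by rw [h0' _ hx, mul_zero])]
  have i2 := hT2 A hA
  have i3 := hT2 P hP
  have i4 := hT4 A hA
  have i5 := hT4 P hP
  -- The expanded equation is regrouped so that exchanging u and v produces matching products, with
  -- only arctan and the gradient difference changing sign.
  have hpt : ∀ x, lu x * (h (u x) * h (v x) *
        Real.arctan (m * (trunc K (u x) - trunc K (v x)))) +
      h (u x) * h (v x) * (m / (1 + (m * (trunc K (u x) - trunc K (v x))) ^ 2)) *
        ⟪A x + P x, g x - k x⟫ +
      Real.arctan (m * (trunc K (u x) - trunc K (v x))) *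
        (h (u x) * deriv h (v x) * ⟪A x + P x, k x⟫ +
          deriv h (u x) * h (v x) * ⟪A x + P x, g x⟫) =
      lu x * φ x * h (u x) + h (u x) * ⟪A x, Dφ x⟫ + h (u x) * ⟪P x, Dφ x⟫ +
        φ x * deriv h (u x) * ⟪A x, Du x⟫ + φ x * deriv h (u x) * ⟪P x, Du x⟫ := by
    intro x
    rw [hT4', hT4']
    simp only [hφ, hDφ, htr, htr', inner_add_right, inner_sub_right, inner_add_left,
      real_inner_smul_right]
    ring
  have isum := (((i1.add i2).add i3).add i4).add i5
  constructor
  · exact isum.congr (.of_forall fun x => (hpt x).symm)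
  · simp only [hpt]
    have e := integral_add' (((i1.add i2).add i3).add i4) i5
    rw [integral_add' ((i1.add i2).add i3) i4, integral_add' (i1.add i2) i3, integral_add' i1 i2,
      hmain] at e
    refine Eq.trans ?_ (e.trans ?_)
    · rfl
    refine integral_congr_ae (.of_forall fun x => ?_)
    simp only [hφ, htr]
    ring

/-! ### Pointwise estimates for the sum of the tested equations -/

/-- Pointwise bound of the remainder terms by Young's inequality. -/
theorem remainder_le {N : ℕ} {p : ℝ} (hp : 1 < p) {n B C : ℝ} (hn : 1 ≤ n) (hB : 0 ≤ B) (hC : 0 ≤ C)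
    {d b r₁ r₂ : ℝ} {J g k : Eu N}
    (hJ : ‖J‖ ≤ B * (2 * |d| + ‖g‖ ^ (p - 1) + ‖k‖ ^ (p - 1)) + 2 * (|b| * (1 + 2 * n) ^ (p - 1)))
    (h₁ : |r₁| ≤ C / n) (h₂ : |r₂| ≤ C / n) :
    |r₁ * ⟪J, k⟫ + r₂ * ⟪J, g⟫| ≤ C * (6 * B + 4 * 3 ^ (p - 1)) * 2 ^ p *
      (1 / n * (|d| ^ (p / (p - 1)) + ‖g‖ ^ p + ‖k‖ ^ p) + n ^ (p - 1) * |b| ^ (p / (p - 1))) := by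
  have hn0 : 0 < n := by linarith
  have hp0 : 0 < p := by linarith
  have hp1 : 0 < p - 1 := by linarith
  set q := p / (p - 1) with hq
  have hpq : Real.HolderConjugate p q := (Real.holderConjugate_iff_eq_conjExponent hp).2 rfl
  set G := ‖g‖ + ‖k‖ with hG
  have hG0 : 0 ≤ G := by positivity
  have hyoung : ∀ s : ℝ, 0 ≤ s → s * G ≤ s ^ q + G ^ p := fun s hs => by
    have h := Real.young_inequality_of_nonneg hs hG0 hpq.symm
    have e1 : s ^ q / q ≤ s ^ q := div_le_self (by positivity) hpq.symm.lt.le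
    have e2 : G ^ p / p ≤ G ^ p := div_le_self (by positivity) hp.le
    linarith
  have hGp : G ^ p ≤ 2 ^ p * (‖g‖ ^ p + ‖k‖ ^ p) := by
    have h1 : G ≤ 2 * max ‖g‖ ‖k‖ := by
      have := le_max_left ‖g‖ ‖k‖
      have := le_max_right ‖g‖ ‖k‖
      linarith
    have h2 : (max ‖g‖ ‖k‖) ^ p ≤ ‖g‖ ^ p + ‖k‖ ^ p := by
      have e1 : 0 ≤ ‖g‖ ^ p := by positivity
      have e2 : 0 ≤ ‖k‖ ^ p := by positivity
      rcases max_cases ‖g‖ ‖k‖ with ⟨h, -⟩ | ⟨h, -⟩ <;> rw [h] <;> linarith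
    calc G ^ p ≤ (2 * max ‖g‖ ‖k‖) ^ p := Real.rpow_le_rpow hG0 h1 hp0.le
      _ = 2 ^ p * (max ‖g‖ ‖k‖) ^ p := Real.mul_rpow (by norm_num) (by positivity)
      _ ≤ _ := by gcongr
  have hGG : G ^ (p - 1) * G = G ^ p := by
    rw [← Real.rpow_add_one' hG0 (by linarith), sub_add_cancel]
  have hg1 : ‖g‖ ^ (p - 1) ≤ G ^ (p - 1) :=
    Real.rpow_le_rpow (norm_nonneg _) (by rw [hG]; linarith [norm_nonneg k]) hp1.le
  have hk1 : ‖k‖ ^ (p - 1) ≤ G ^ (p - 1) :=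
    Real.rpow_le_rpow (norm_nonneg _) (by rw [hG]; linarith [norm_nonneg g]) hp1.le
  -- Here n ≥ 1 is used, through 1 + 2n ≤ 3n.
  have h3n : (1 + 2 * n) ^ (p - 1) ≤ 3 ^ (p - 1) * n ^ (p - 1) := by
    rw [← Real.mul_rpow (by norm_num) hn0.le]
    exact Real.rpow_le_rpow (by linarith) (by linarith) hp1.le
  set T : ℝ := 3 ^ (p - 1) with hT
  have hT0 : 0 < T := by positivity
  -- Since (p-1)q = p, Young's inequality yields n^p |b|^q; the prefactor C/n coming from h' lowers
  -- this to the weight n^{p-1} of the tail.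
  have hnq : (n ^ (p - 1) * |b|) ^ q = n ^ p * |b| ^ q := by
    rw [Real.mul_rpow (by positivity) (abs_nonneg _), ← Real.rpow_mul hn0.le, hq,
      mul_div_cancel₀ _ hp1.ne']
  have hnp : n ^ p = n * n ^ (p - 1) := by
    rw [mul_comm, ← Real.rpow_add_one hn0.ne', sub_add_cancel]
  have hJ2 : ‖J‖ * G ≤ 2 * B * |d| ^ q + (4 * B + 2 * T) * G ^ p + 2 * T * (n ^ p * |b| ^ q) := by
    have y1 := hyoung |d| (abs_nonneg _)
    have y2 := hyoung (n ^ (p - 1) * |b|) (by positivity)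
    rw [hnq] at y2
    calc ‖J‖ * G ≤ (B * (2 * |d| + G ^ (p - 1) + G ^ (p - 1)) +
          2 * (|b| * (T * n ^ (p - 1)))) * G := by
          gcongr
          refine hJ.trans ?_
          gcongr
      _ = 2 * B * (|d| * G) + 2 * B * (G ^ (p - 1) * G) + 2 * T * (n ^ (p - 1) * |b| * G) := by ring
      _ ≤ 2 * B * (|d| ^ q + G ^ p) + 2 * B * G ^ p + 2 * T * (n ^ p * |b| ^ q + G ^ p) := by
          rw [hGG]; gcongr
      _ = _ := by ring
  have h2p : 1 ≤ (2 : ℝ) ^ p := Real.one_le_rpow (by norm_num) hp0.le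
  have hdq : 0 ≤ |d| ^ q := by positivity
  have hbq : 0 ≤ n ^ p * |b| ^ q := by positivity
  have hgk : 0 ≤ ‖g‖ ^ p + ‖k‖ ^ p := by positivity
  have hJ3 : ‖J‖ * G ≤ (6 * B + 4 * T) * 2 ^ p *
      ((|d| ^ q + ‖g‖ ^ p + ‖k‖ ^ p) + n ^ p * |b| ^ q) := by
    calc ‖J‖ * G ≤ _ := hJ2
      _ ≤ (6 * B + 4 * T) * (2 ^ p * |d| ^ q) + (6 * B + 4 * T) * (2 ^ p * (‖g‖ ^ p + ‖k‖ ^ p)) +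
          (6 * B + 4 * T) * (2 ^ p * (n ^ p * |b| ^ q)) := by
          refine add_le_add (add_le_add ?_ ?_) ?_
          · refine mul_le_mul (by linarith) (le_mul_of_one_le_left hdq h2p) hdq (by positivity)
          · exact mul_le_mul (by linarith) hGp (by positivity) (by positivity)
          · exact mul_le_mul (by linarith) (le_mul_of_one_le_left hbq h2p) hbq (by positivity)
      _ = _ := by ring
  have hCn : 0 ≤ C / n := by positivity
  calc |r₁ * ⟪J, k⟫ + r₂ * ⟪J, g⟫| ≤ |r₁| * |⟪J, k⟫| + |r₂| * |⟪J, g⟫| := by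
        rw [← abs_mul, ← abs_mul]; exact abs_add_le _ _
    _ ≤ C / n * (‖J‖ * ‖k‖) + C / n * (‖J‖ * ‖g‖) := by
        gcongr
        · exact abs_real_inner_le_norm _ _
        · exact abs_real_inner_le_norm _ _
    _ = C / n * (‖J‖ * G) := by rw [hG]; ring
    _ ≤ C / n * ((6 * B + 4 * T) * 2 ^ p *
      ((|d| ^ q + ‖g‖ ^ p + ‖k‖ ^ p) + n ^ p * |b| ^ q)) := by gcongr
    _ = _ := by
        rw [hnp]
        field_simp

/-- The pointwise combination of the two tested equations. -/
theorem tested_sum_ge {N : ℕ} {lu lv P Q P' Q' w w' Ψ θ ρ : ℝ} {Ju Jv g k : Eu N}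
    (h1 : P * Q * Ψ ≤ (lu - lv) * (P * Q * w)) (h2 : -θ ≤ P * Q * w' * ⟪Ju - Jv, g - k⟫)
    (h3 : |P * Q' * ⟪Ju - Jv, k⟫ + P' * Q * ⟪Ju - Jv, g⟫| ≤ ρ) (hw : |w| ≤ 2) :
    P * Q * Ψ ≤ (lu * (P * Q * w) + P * Q * w' * ⟪Ju, g - k⟫ +
        w * (P * Q' * ⟪Ju, k⟫ + P' * Q * ⟪Ju, g⟫)) +
      (lv * (Q * P * -w) + Q * P * w' * ⟪Jv, k - g⟫ +
        -w * (Q * P' * ⟪Jv, g⟫ + Q' * P * ⟪Jv, k⟫)) + θ + 2 * ρ := by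
  -- Both equations carry their h' terms with the common factor w up to sign, so only the flux
  -- difference matters; |w| ≤ 2 explains the coefficient of ρ.
  have h4 : |w * (P * Q' * ⟪Ju - Jv, k⟫ + P' * Q * ⟪Ju - Jv, g⟫)| ≤ 2 * ρ := by
    rw [abs_mul]
    exact mul_le_mul hw h3 (abs_nonneg _) (by norm_num)
  have h5 := (abs_le.1 h4).1
  simp only [inner_sub_left, inner_sub_right] at *
  linarith

/-- `m s / (1 + (m s)²)` is bounded by `1` and tends to `0`. -/
theorem mul_div_one_add_sq_le_one (m : ℕ) (s : ℝ) : (m : ℝ) / (1 + (m * s) ^ 2) * |s| ≤ 1 := by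
  rw [div_mul_eq_mul_div, div_le_one (by positivity)]
  have h1 : (m : ℝ) * |s| = |m * s| := by rw [abs_mul, Nat.abs_cast]
  rw [h1, ← sq_abs ((m : ℝ) * s)]
  nlinarith [sq_nonneg (|(m : ℝ) * s| - 1), abs_nonneg ((m : ℝ) * s)]

theorem tendsto_mul_div_one_add_sq (s : ℝ) :
    Tendsto (fun m : ℕ => (m : ℝ) / (1 + (m * s) ^ 2) * |s|) atTop (𝓝 0) := by
  rcases eq_or_ne s 0 with rfl | hs
  · simp
  have hs' : 0 < |s| := abs_pos.2 hs
  have h1 : Tendsto (fun m : ℕ => 1 / |s| * (1 / (m : ℝ))) atTop (𝓝 0) := by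
    simpa using tendsto_one_div_atTop_nhds_zero_nat.const_mul (1 / |s|)
  refine squeeze_zero' (.of_forall fun m => by positivity) ?_ h1
  filter_upwards [eventually_gt_atTop 0] with m hm
  have hm' : (0 : ℝ) < m := by exact_mod_cast hm
  rw [div_mul_eq_mul_div, div_mul_div_comm, one_mul, div_le_div_iff₀ (by positivity) (by positivity)]
  have : (m : ℝ) * |s| * (|s| * m) = (m * s) ^ 2 := by
    rw [mul_pow, ← sq_abs s]; ring
  rw [this]
  linarith

/-! ### Energy decay and the contraction estimate at a fixed level -/

theorem nullMeasurableSet_abs_lt {X : Type*} [MeasurableSpace X] {μ : Measure X} {u : X → ℝ}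
    (hu : AEMeasurable u μ) (k : ℝ) : NullMeasurableSet {x | |u x| < k} μ :=
  nullMeasurableSet_lt (measurable_norm.comp_aemeasurable hu) aemeasurable_const

theorem nullMeasurableSet_le_abs {X : Type*} [MeasurableSpace X] {μ : Measure X} {u : X → ℝ}
    (hu : AEMeasurable u μ) (k : ℝ) : NullMeasurableSet {x | k ≤ |u x|} μ :=
  nullMeasurableSet_le aemeasurable_const (measurable_norm.comp_aemeasurable hu)

/-- Membership in W^{1,p} supplies some weak gradient in L^p; uniqueness identifies it with the
truncated generalized gradient. -/
theorem memLp_truncated_gradient {N : ℕ} {p : ℝ} (hp : 1 < p) {Ω Γd : Set (Eu N)}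
    (hΩo : IsOpen Ω) {u : Eu N → ℝ} {Du : Eu N → Eu N}
    (hW : ∀ k : ℝ, 0 < k → MemW1Gamma Ω Γd (ENNReal.ofReal p) (fun x => trunc k (u x)))
    (hD : IsGeneralizedGradient Ω u Du) (k : ℝ) (hk : 0 < k) :
    MemLp ({x | |u x| < k}.indicator Du) (ENNReal.ofReal p) (volume.restrict Ω) := by
  obtain ⟨w, _, hw, -⟩ := (hW k hk).exists_lipApprox hΩo (ENNReal.one_le_ofReal.2 hp.le) (hD.2 k hk)
  exact hw.memLp_grad

/-- The energy of the truncations at height `n` is `o(n)`. -/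
theorem tendsto_energy {N : ℕ} {p : ℝ} (hp : 1 < p) {Ω : Set (Eu N)}
    {u d : Eu N → ℝ} {A Du : Eu N → Eu N} {α β : ℝ} (hα : 0 < α)
    (hu : AEMeasurable u (volume.restrict Ω)) (hA : AEMeasurable A (volume.restrict Ω))
    (hcoer : ∀ᵐ x ∂(volume.restrict Ω), α * ‖Du x‖ ^ p ≤ ⟪A x, Du x⟫)
    (hgrowth : ∀ᵐ x ∂(volume.restrict Ω), ‖A x‖ ≤ β * (|d x| + ‖Du x‖ ^ (p - 1)))
    (hd : MemLp d (ENNReal.ofReal (p / (p - 1))) (volume.restrict Ω))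
    (hDp : ∀ k : ℝ, 0 < k → MemLp ({x | |u x| < k}.indicator Du) (ENNReal.ofReal p)
      (volume.restrict Ω))
    (hE : Tendsto (fun n : ℕ => (1 / (n : ℝ)) * ∫ x in Ω ∩ {x | |u x| < n}, ⟪A x, Du x⟫)
      atTop (𝓝 0)) :
    Tendsto (fun n : ℕ => (1 / (n : ℝ)) *
      ∫ x in Ω, ‖{x | |u x| < (n : ℝ)}.indicator Du x‖ ^ p) atTop (𝓝 0) := by
  have hlim : Tendsto (fun n : ℕ => 1 / α *
      ((1 / (n : ℝ)) * ∫ x in Ω ∩ {x | |u x| < n}, ⟪A x, Du x⟫)) atTop (𝓝 0) := by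
    simpa using hE.const_mul (1 / α)
  refine squeeze_zero' (.of_forall fun n =>
    mul_nonneg (by positivity) (integral_nonneg fun x => by positivity)) ?_ hlim
  filter_upwards [eventually_gt_atTop 0] with n hn
  have hn' : (0 : ℝ) < n := by exact_mod_cast hn
  have hS := nullMeasurableSet_abs_lt hu (n : ℝ)
  have hAp := memLp_flux hp hS hA hd (hDp n hn') hgrowth
  -- The comparison of integrals by coercivity needs a(x,Du)·Du integrable on {|u| < n}; the growth
  -- condition provides this.
  have hInt := integrable_inner_of_memLp hp hAp (hDp n hn')
  have hp0 : 0 < p := by linarith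
  have hpt : ∀ x, ⟪{x | |u x| < (n : ℝ)}.indicator A x, {x | |u x| < (n : ℝ)}.indicator Du x⟫ =
      {x | |u x| < (n : ℝ)}.indicator (fun x => ⟪A x, Du x⟫) x := by
    intro x
    by_cases hx : x ∈ {x | |u x| < (n : ℝ)}
    · simp only [Set.indicator_of_mem hx]
    · simp only [Set.indicator_of_notMem hx, inner_zero_left]
  have h1 : ∫ x in Ω ∩ {x | |u x| < n}, ⟪A x, Du x⟫ =
      ∫ x in Ω, ⟪{x | |u x| < (n : ℝ)}.indicator A x, {x | |u x| < (n : ℝ)}.indicator Du x⟫ := by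
    simp only [hpt]
    rw [integral_indicator₀ hS, Measure.restrict_restrict₀ hS, Set.inter_comm]
  rw [h1, mul_left_comm, ← integral_const_mul (1 / α)]
  refine mul_le_mul_of_nonneg_left ?_ (by positivity)
  refine integral_mono_of_nonneg (.of_forall fun x => by positivity) (hInt.const_mul _) ?_
  filter_upwards [hcoer] with x hx
  by_cases hxs : x ∈ {x | |u x| < (n : ℝ)}
  · simp only [Set.indicator_of_mem hxs]
    rw [one_div_mul_eq_div, le_div_iff₀ hα, mul_comm]
    exact hx
  · simp only [Set.indicator_of_notMem hxs, inner_zero_left, norm_zero, Real.zero_rpow hp0.ne',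
      mul_zero, le_refl]

/-- D has the sign of r - r', and enlarging m moves the arctangent further in that direction. This
gives a lower bound independent of m. -/
theorem mul_arctan_le_mul_arctan {D r r' m : ℝ} (hD : r ≠ r' → 0 < D * (r - r')) (hm : 1 ≤ m) :
    D * Real.arctan (r - r') ≤ D * Real.arctan (m * (r - r')) := by
  rcases lt_trichotomy r r' with h | h | h
  · have h1 : r - r' < 0 := sub_neg.2 h
    exact mul_le_mul_of_nonpos_left (Real.arctan_strictMono.monotone (by nlinarith))
      (neg_of_mul_pos_left (hD h.ne) h1.le).le
  · simp [h]
  · have h1 : 0 < r - r' := sub_pos.2 h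
    exact mul_le_mul_of_nonneg_left (Real.arctan_strictMono.monotone (by nlinarith))
      (pos_of_mul_pos_left (hD h.ne') h1.le).le

set_option maxHeartbeats 2000000 in
/-- The weighted `L¹`-contraction estimate at a fixed truncation level. -/
theorem integral_cutoff_le {N : ℕ} {p : ℝ} (hp : 1 < p) {Ω Γd : Set (Eu N)}
    (hΩo : IsOpen Ω) (hΩb : Bornology.IsBounded Ω) {a : Eu N → Eu N → Eu N} {lam : Eu N → ℝ → ℝ}
    {Φ : Eu N → ℝ → Eu N} {f b d : Eu N → ℝ} {β : ℝ}
    (ha : IsCaratheodory Ω a) (hlam : IsCaratheodory Ω lam) (hΦ : IsCaratheodory Ω Φ)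
    (ha_mono : ∀ᵐ x ∂(volume.restrict Ω), ∀ ξ ξ' : Eu N, 0 ≤ ⟪a x ξ - a x ξ', ξ - ξ'⟫)
    (ha_growth : ∀ᵐ x ∂(volume.restrict Ω), ∀ ξ : Eu N,
      ‖a x ξ‖ ≤ β * (|d x| + ‖ξ‖ ^ (p - 1)))
    (hd : MemLp d (ENNReal.ofReal (p / (p - 1))) (volume.restrict Ω))
    (hΦ_growth : ∀ᵐ x ∂(volume.restrict Ω), ∀ s : ℝ, ‖Φ x s‖ ≤ |b x| * (1 + |s|) ^ (p - 1))
    (hb : MemLp b (ENNReal.ofReal (p / (p - 1))) (volume.restrict Ω))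
    (hlam_strict : ∀ᵐ x ∂(volume.restrict Ω), ∀ r r' : ℝ, r ≠ r' →
      0 < (lam x r - lam x r') * (r - r'))
    {n : ℝ} (hn : 1 ≤ n) {c L C : ℝ} (hL : 0 < L) (hC : 0 ≤ C)
    (hlam_bdd : ∀ᵐ x ∂(volume.restrict Ω), ∀ s : ℝ, |s| ≤ 2 * n → |lam x s| ≤ c)
    (hΦ_lip : ∀ᵐ x ∂(volume.restrict Ω), ∀ r ∈ Set.Icc (-(2 * n)) (2 * n),
      ∀ r' ∈ Set.Icc (-(2 * n)) (2 * n), ‖Φ x r - Φ x r'‖ ≤ L * |b x| * |r - r'|)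
    {h : ℝ → ℝ} (hh : ContDiff ℝ 1 h) (hh0 : ∀ s, 0 ≤ h s) (hh1 : ∀ s, h s ≤ 1)
    (hh' : ∀ s, |deriv h s| ≤ C / n) (hsupp : ∀ s, 2 * n ≤ |s| → h s = 0)
    (hsupp' : ∀ s, |s| ≤ n ∨ 2 * n ≤ |s| → deriv h s = 0)
    {u v : Eu N → ℝ} {Du Dv : Eu N → Eu N}
    (hu : AEMeasurable u (volume.restrict Ω)) (hv : AEMeasurable v (volume.restrict Ω))
    (huW : ∀ k : ℝ, 0 < k → MemW1Gamma Ω Γd (ENNReal.ofReal p) (fun x => trunc k (u x)))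
    (hvW : ∀ k : ℝ, 0 < k → MemW1Gamma Ω Γd (ENNReal.ofReal p) (fun x => trunc k (v x)))
    (hDu : IsGeneralizedGradient Ω u Du) (hDv : IsGeneralizedGradient Ω v Dv)
    (hequ : ∀ (φ : Eu N → ℝ) (Dφ : Eu N → Eu N), MemW1Gamma Ω Γd (ENNReal.ofReal p) φ →
      MemLp φ ⊤ (volume.restrict Ω) → HasWeakGradient Ω φ Dφ →
      (∫ x in Ω, lam x (u x) * φ x * h (u x))
        + (∫ x in Ω, h (u x) * ⟪a x (Du x), Dφ x⟫)
        + (∫ x in Ω, h (u x) * ⟪Φ x (u x), Dφ x⟫)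
        + (∫ x in Ω, φ x * deriv h (u x) * ⟪a x (Du x), Du x⟫)
        + (∫ x in Ω, φ x * deriv h (u x) * ⟪Φ x (u x), Du x⟫)
      = ∫ x in Ω, f x * φ x * h (u x))
    (heqv : ∀ (φ : Eu N → ℝ) (Dφ : Eu N → Eu N), MemW1Gamma Ω Γd (ENNReal.ofReal p) φ →
      MemLp φ ⊤ (volume.restrict Ω) → HasWeakGradient Ω φ Dφ →
      (∫ x in Ω, lam x (v x) * φ x * h (v x))
        + (∫ x in Ω, h (v x) * ⟪a x (Dv x), Dφ x⟫)
        + (∫ x in Ω, h (v x) * ⟪Φ x (v x), Dφ x⟫)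
        + (∫ x in Ω, φ x * deriv h (v x) * ⟪a x (Dv x), Dv x⟫)
        + (∫ x in Ω, φ x * deriv h (v x) * ⟪Φ x (v x), Dv x⟫)
      = ∫ x in Ω, f x * φ x * h (v x)) :
    Integrable (fun x => h (u x) * h (v x) *
      ((lam x (u x) - lam x (v x)) * Real.arctan (u x - v x))) (volume.restrict Ω) ∧
    ∫ x in Ω, h (u x) * h (v x) * ((lam x (u x) - lam x (v x)) * Real.arctan (u x - v x)) ≤
      2 * (C * (6 * |β| + 4 * 3 ^ (p - 1)) * 2 ^ p) *
        (1 / n * ((∫ x in Ω, |d x| ^ (p / (p - 1))) +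
            (∫ x in Ω, ‖{x | |u x| < 2 * n}.indicator Du x‖ ^ p) +
            (∫ x in Ω, ‖{x | |v x| < 2 * n}.indicator Dv x‖ ^ p)) +
          (n ^ (p - 1) * (∫ x in Ω, {x | n ≤ |u x|}.indicator (fun x => |b x| ^ (p / (p - 1))) x) +
           n ^ (p - 1) *
            (∫ x in Ω, {x | n ≤ |v x|}.indicator (fun x => |b x| ^ (p / (p - 1))) x))) := by
  have : IsFiniteMeasure (volume.restrict Ω) := ⟨by simpa using hΩb.measure_lt_top⟩
  set ν := volume.restrict Ω with hν
  have hn0 : 0 < n := by linarith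
  set K := 2 * n with hKdef
  have hK : 0 < K := by positivity
  have hp0 : 0 < p := by linarith
  have hp1 : 0 < p - 1 := by linarith
  set q := p / (p - 1) with hq
  have hq0 : 0 < q := div_pos hp0 hp1
  set g : Eu N → Eu N := {x | |u x| < K}.indicator Du with hg
  set k : Eu N → Eu N := {x | |v x| < K}.indicator Dv with hk
  have hgp : MemLp g (ENNReal.ofReal p) ν := memLp_truncated_gradient hp hΩo huW hDu K hK
  have hkp : MemLp k (ENNReal.ofReal p) ν := memLp_truncated_gradient hp hΩo hvW hDv K hK
  have hrpow : ∀ {F : Type} [NormedAddCommGroup F] {r : ℝ} {H : Eu N → F}, 0 < r →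
      MemLp H (ENNReal.ofReal r) ν → Integrable (fun x => ‖H x‖ ^ r) ν := by
    intro F _ r H hr hH
    have := hH.integrable_norm_rpow (by simpa using hr) ENNReal.ofReal_ne_top
    rwa [ENNReal.toReal_ofReal hr.le] at this
  have hhabs : ∀ s, |h s| ≤ 1 := fun s => by rw [abs_of_nonneg (hh0 s)]; exact hh1 s
  have hflux : ∀ {z : Eu N → ℝ} {Dz : Eu N → Eu N}, AEMeasurable z ν → AEMeasurable Dz ν →
      MemLp ({x | |z x| < K}.indicator Dz) (ENNReal.ofReal p) ν →
      MemLp ({x | |z x| < K}.indicator fun x => a x (Dz x)) (ENNReal.ofReal q) ν ∧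
      MemLp ({x | |z x| < K}.indicator fun x => Φ x (z x)) (ENNReal.ofReal q) ν := by
    intro z Dz hz hDz hzp
    have hS := nullMeasurableSet_abs_lt hz K
    refine ⟨memLp_flux hp hS (ha.aemeasurable_comp hDz) hd hzp
      (ha_growth.mono fun x hx => hx _), ?_⟩
    refine hb.of_le_mul (c := (1 + K) ^ (p - 1)) ((aestronglyMeasurable_indicator_iff₀ hS).2
      (hΦ.aemeasurable_comp hz).aestronglyMeasurable.restrict) ?_
    filter_upwards [hΦ_growth] with x hx
    by_cases hxs : x ∈ {x | |z x| < K}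
    · rw [Set.indicator_of_mem hxs, mul_comm]
      refine (hx _).trans ?_
      rw [Real.norm_eq_abs]
      have hlt : |z x| < K := hxs
      gcongr
    · rw [Set.indicator_of_notMem hxs, norm_zero]
      positivity
  obtain ⟨hAu, hPu⟩ := hflux hu hDu.1 hgp
  obtain ⟨hAv, hPv⟩ := hflux hv hDv.1 hkp
  have hCn : 0 ≤ C / n := by positivity
  set Ψ : Eu N → ℝ := fun x => (lam x (u x) - lam x (v x)) * Real.arctan (u x - v x) with hΨ
  have hlu := hlam.aemeasurable_comp hu
  have hlv := hlam.aemeasurable_comp hv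
  have hhu : AEMeasurable (fun x => h (u x)) ν := hh.continuous.measurable.comp_aemeasurable hu
  have hhv : AEMeasurable (fun x => h (v x)) ν := hh.continuous.measurable.comp_aemeasurable hv
  have hlt_of : ∀ {s : ℝ}, h s ≠ 0 → |s| < K := fun {s} hs => by
    by_contra hlt; exact hs (hsupp s (not_lt.1 hlt))
  have hΨi : Integrable (fun x => h (u x) * h (v x) * Ψ x) ν := by
    refine Integrable.of_bound (C := 1 * 1 * ((|c| + |c|) * 2)) ((hhu.mul hhv).mul ((hlu.sub hlv).mul
      (Real.continuous_arctan.measurable.comp_aemeasurable (hu.sub hv)))).aestronglyMeasurable ?_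
    filter_upwards [hlam_bdd] with x hx
    by_cases h1 : h (u x) = 0
    · rw [h1, zero_mul, zero_mul, norm_zero]; positivity
    by_cases h2 : h (v x) = 0
    · rw [h2, mul_zero, zero_mul, norm_zero]; positivity
    have e1 := (hx _ (hlt_of h1).le).trans (le_abs_self c)
    have e2 := (hx _ (hlt_of h2).le).trans (le_abs_self c)
    rw [norm_mul, norm_mul, hΨ]
    simp only [norm_mul, Real.norm_eq_abs]
    gcongr
    · exact hhabs _
    · exact hhabs _
    · exact (abs_sub _ _).trans (add_le_add e1 e2)
    · exact abs_arctan_le_two _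
  -- Majorant of the h' terms. The coefficient b enters only where |u| ≥ n or |v| ≥ n, since h'
  -- vanishes on [-n, n].
  set ρ : Eu N → ℝ := fun x => (C * (6 * |β| + 4 * 3 ^ (p - 1)) * 2 ^ p) *
    (1 / n * (|d x| ^ q + ‖g x‖ ^ p + ‖k x‖ ^ p) +
      (n ^ (p - 1) * {x | n ≤ |u x|}.indicator (fun x => |b x| ^ q) x +
        n ^ (p - 1) * {x | n ≤ |v x|}.indicator (fun x => |b x| ^ q) x)) with hρ
  have hbi : Integrable (fun x => |b x| ^ q) ν := hrpow hq0 hb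
  have hdi : Integrable (fun x => |d x| ^ q) ν := hrpow hq0 hd
  have hgi := hrpow hp0 hgp
  have hki := hrpow hp0 hkp
  have hbu := hbi.indicator₀ (nullMeasurableSet_le_abs hu n)
  have hbv := hbi.indicator₀ (nullMeasurableSet_le_abs hv n)
  have hρi : Integrable ρ ν :=
    ((((hdi.add hgi).add hki).const_mul _).add
      ((hbu.const_mul _).add (hbv.const_mul _))).const_mul _
  have hρint : ∫ x, ρ x ∂ν = (C * (6 * |β| + 4 * 3 ^ (p - 1)) * 2 ^ p) *
        (1 / n * ((∫ x, |d x| ^ q ∂ν) + (∫ x, ‖g x‖ ^ p ∂ν) + (∫ x, ‖k x‖ ^ p ∂ν)) +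
          (n ^ (p - 1) * (∫ x, {x | n ≤ |u x|}.indicator (fun x => |b x| ^ q) x ∂ν) +
           n ^ (p - 1) * (∫ x, {x | n ≤ |v x|}.indicator (fun x => |b x| ^ q) x ∂ν))) := by
    simp only [hρ]
    rw [integral_const_mul]
    congr 1
    have e1 := integral_add' (((hdi.add hgi).add hki).const_mul (1 / n))
      ((hbu.const_mul (n ^ (p - 1))).add (hbv.const_mul (n ^ (p - 1))))
    rw [integral_const_mul, integral_add' (hdi.add hgi) hki, integral_add' hdi hgi,
      integral_add' (hbu.const_mul _) (hbv.const_mul _), integral_const_mul,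
      integral_const_mul] at e1
    exact e1
  have hρ0 : ∀ x, 0 ≤ ρ x := fun x => by
    have e1 : 0 ≤ {x | n ≤ |u x|}.indicator (fun x => |b x| ^ q) x :=
      Set.indicator_nonneg (fun x _ => by positivity) x
    have e2 : 0 ≤ {x | n ≤ |v x|}.indicator (fun x => |b x| ^ q) x :=
      Set.indicator_nonneg (fun x _ => by positivity) x
    simp only [hρ]
    positivity
  set W : Eu N → ℝ := fun x => h (u x) * h (v x) * (L * |b x| * (‖g x‖ + ‖k x‖)) with hW
  have hbgk : Integrable (fun x => |b x| * (‖g x‖ + ‖k x‖)) ν := by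
    have hpq : Real.HolderConjugate p q := (Real.holderConjugate_iff_eq_conjExponent hp).2 rfl
    have : ENNReal.HolderConjugate (ENNReal.ofReal q) (ENNReal.ofReal p) := hpq.symm.ennrealOfReal
    exact hb.norm.integrable_mul (hgp.norm.add hkp.norm)
  have hWi : Integrable W ν := by
    refine ((hbgk.const_mul L).bdd_mul (hhu.mul hhv).aestronglyMeasurable (c := 1 * 1)
      (.of_forall fun x => ?_)).congr (.of_forall fun x => ?_)
    · simp only [Pi.mul_apply, norm_mul, Real.norm_eq_abs]
      gcongr
      exacts [hhabs _, hhabs _]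
    · simp only [hW, Pi.mul_apply]; ring
  set s : Eu N → ℝ := fun x => trunc K (u x) - trunc K (v x) with hs
  have hsm : AEMeasurable s ν := by
    have ht : Continuous (trunc K) := by unfold trunc; fun_prop
    exact (ht.measurable.comp_aemeasurable hu).sub (ht.measurable.comp_aemeasurable hv)
  -- Majorant of the convection difference: the Lipschitz bound on Φ supplies the factor |s| that
  -- compensates the derivative of arctan(m·). The scalar factor is at most 1 and tends to 0, also
  -- where s = 0, while W is integrable because b is in L^{p'} and the truncated gradients are in
  -- L^p.
  set θ : ℕ → Eu N → ℝ := fun m x => (m / (1 + (m * s x) ^ 2) * |s x|) * W x with hθ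
  have hW0 : ∀ x, 0 ≤ W x := fun x => by
    have e1 := hh0 (u x)
    have e2 := hh0 (v x)
    simp only [hW]
    positivity
  have hθm : ∀ m, AEStronglyMeasurable (θ m) ν := fun m => by
    have hc : Measurable fun t : ℝ => (m : ℝ) / (1 + (m * t) ^ 2) * |t| := by fun_prop
    exact (hc.comp_aemeasurable hsm).aestronglyMeasurable.mul hWi.1
  have hθW : ∀ m x, ‖θ m x‖ ≤ W x := fun m x => by
    simp only [hθ]
    rw [norm_mul, Real.norm_of_nonneg (hW0 x), Real.norm_of_nonneg (by positivity)]
    exact mul_le_of_le_one_left (hW0 x) (mul_div_one_add_sq_le_one m (s x))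
  have hθi : ∀ m, Integrable (θ m) ν := fun m => hWi.mono' (hθm m) (.of_forall (hθW m))
  have hθlim : Tendsto (fun m => ∫ x, θ m x ∂ν) atTop (𝓝 0) := by
    have h1 : Tendsto (fun m => ∫ x, θ m x ∂ν) atTop (𝓝 (∫ _, (0 : ℝ) ∂ν)) := by
      refine tendsto_integral_of_dominated_convergence W hθm hWi
        (fun m => .of_forall (hθW m)) (.of_forall fun x => ?_)
      simpa using (tendsto_mul_div_one_add_sq (s x)).mul_const (W x)
    simpa using h1
  refine ⟨hΨi, ?_⟩
  have hkey : ∀ m : ℕ, 1 ≤ m → ∫ x, h (u x) * h (v x) * Ψ x ∂ν ≤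
      (∫ x, θ m x ∂ν) + 2 * ∫ x, ρ x ∂ν := by
    intro m hm
    have hm' : (1 : ℝ) ≤ m := by exact_mod_cast hm
    obtain ⟨iu, eu⟩ := integral_renormalized_test hp hΩo hΩb hu hlu hK (huW K hK) (hvW K hK)
      (hDu.2 K hK) (hDv.2 K hK) (hlam_bdd.mono fun x hx hxu => hx _ hxu.le) hAu hPu hh hCn hhabs hh'
      hsupp (fun s hs => hsupp' s (Or.inr hs)) hequ m
    obtain ⟨iv, ev⟩ := integral_renormalized_test hp hΩo hΩb hv hlv hK (hvW K hK) (huW K hK)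
      (hDv.2 K hK) (hDu.2 K hK) (hlam_bdd.mono fun x hx hxv => hx _ hxv.le) hAv hPv hh hCn hhabs hh'
      hsupp (fun s hs => hsupp' s (Or.inr hs)) heqv m
    have hodd : ∀ x, (m : ℝ) * (trunc K (v x) - trunc K (u x)) = -(m * s x) := fun x => by
      simp only [hs]; ring
    -- The data terms of the two equations are opposite, the test functions being odd in (u, v).
    have hsum : (∫ x, f x * (h (u x) * h (v x) * Real.arctan (m * s x)) ∂ν) +
        ∫ x, f x * (h (v x) * h (u x) *
          Real.arctan (m * (trunc K (v x) - trunc K (u x)))) ∂ν = 0 := by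
      rw [← neg_eq_iff_add_eq_zero, ← integral_neg]
      refine integral_congr_ae (.of_forall fun x => ?_)
      simp only [hodd, Real.arctan_neg]
      ring
    rw [← eu, ← ev] at hsum
    have hle := integral_mono_ae hΨi (((iu.add iv).add (hθi m)).add (hρi.const_mul 2)) (by
      filter_upwards [ha_mono, ha_growth, hΦ_growth, hlam_strict, hΦ_lip] with x hamx hagx hΦx hlx
        hΦlx
      have hgx : |u x| < K → g x = Du x := fun hx =>
        Set.indicator_of_mem (show x ∈ {x | |u x| < K} from hx) _
      have hkx : |v x| < K → k x = Dv x := fun hx =>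
        Set.indicator_of_mem (show x ∈ {x | |v x| < K} from hx) _
      have hsx : |u x| < K → |v x| < K → s x = u x - v x := fun h1 h2 => by
        simp only [hs, trunc_of_abs_le h1.le, trunc_of_abs_le h2.le]
      have c1 : h (u x) * h (v x) * Ψ x ≤ (lam x (u x) - lam x (v x)) *
          (h (u x) * h (v x) * Real.arctan (m * s x)) := by
        by_cases h1 : h (u x) = 0
        · simp [h1]
        by_cases h2 : h (v x) = 0
        · simp [h2]
        rw [hsx (hlt_of h1) (hlt_of h2)]
        have hmono := mul_arctan_le_mul_arctan (r := u x) (r' := v x) (hlx _ _) hm'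
        calc _ ≤ h (u x) * h (v x) *
              ((lam x (u x) - lam x (v x)) * Real.arctan (m * (u x - v x))) := by
              have e1 := hh0 (u x)
              have e2 := hh0 (v x)
              simp only [hΨ]
              gcongr
          _ = _ := by ring
      have c2 : -θ m x ≤ h (u x) * h (v x) * (m / (1 + (m * s x) ^ 2)) *
          ⟪(a x (Du x) + Φ x (u x)) - (a x (Dv x) + Φ x (v x)), g x - k x⟫ := by
        by_cases h1 : h (u x) = 0
        · simp [hθ, hW, h1]
        by_cases h2 : h (v x) = 0
        · simp [hθ, hW, h2]
        have hu' := hlt_of h1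
        have hv' := hlt_of h2
        have e1 : 0 ≤ ⟪a x (Du x) - a x (Dv x), g x - k x⟫ := by
          rw [hgx hu', hkx hv']; exact hamx _ _
        have e2 : -(L * |b x| * |s x| * (‖g x‖ + ‖k x‖)) ≤
            ⟪Φ x (u x) - Φ x (v x), g x - k x⟫ := by
          have e3 := hΦlx _ (abs_le.1 hu'.le) _ (abs_le.1 hv'.le)
          rw [← hsx hu' hv'] at e3
          have e4 := (abs_le.1 (abs_real_inner_le_norm (Φ x (u x) - Φ x (v x)) (g x - k x))).1
          have e5 : ‖Φ x (u x) - Φ x (v x)‖ * ‖g x - k x‖ ≤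
              L * |b x| * |s x| * (‖g x‖ + ‖k x‖) := by
            gcongr
            exact norm_sub_le _ _
          linarith
        have e6 : ⟪(a x (Du x) + Φ x (u x)) - (a x (Dv x) + Φ x (v x)), g x - k x⟫ =
            ⟪a x (Du x) - a x (Dv x), g x - k x⟫ + ⟪Φ x (u x) - Φ x (v x), g x - k x⟫ := by
          rw [← inner_add_left]; congr 1; abel
        have e7 : 0 ≤ h (u x) * h (v x) * ((m : ℝ) / (1 + (m * s x) ^ 2)) := by
          have := hh0 (u x)
          have := hh0 (v x)
          positivity
        calc -θ m x = h (u x) * h (v x) * (m / (1 + (m * s x) ^ 2)) *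
              -(L * |b x| * |s x| * (‖g x‖ + ‖k x‖)) := by simp only [hθ, hW]; ring
          _ ≤ _ := by
              rw [e6]
              exact mul_le_mul_of_nonneg_left (by linarith) e7
      have c3 : |h (u x) * deriv h (v x) *
            ⟪(a x (Du x) + Φ x (u x)) - (a x (Dv x) + Φ x (v x)), k x⟫ +
          deriv h (u x) * h (v x) *
            ⟪(a x (Du x) + Φ x (u x)) - (a x (Dv x) + Φ x (v x)), g x⟫| ≤ ρ x := by
        -- Outside this region both products of a cutoff with a derivative of the cutoff vanish.
        -- Inside it the truncated gradients equal the full ones and one of the two tails is active.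
        by_cases hz : |u x| < K ∧ |v x| < K ∧ (n ≤ |u x| ∨ n ≤ |v x|)
        swap
        · have hz1 : h (u x) * deriv h (v x) = 0 := by
            by_contra hne
            have n1 := left_ne_zero_of_mul hne
            have n2 := right_ne_zero_of_mul hne
            have n3 : ¬(|v x| ≤ n ∨ K ≤ |v x|) := fun h' => n2 (hsupp' _ h')
            push Not at n3
            exact hz ⟨hlt_of n1, n3.2, Or.inr n3.1.le⟩
          have hz2 : deriv h (u x) * h (v x) = 0 := by
            by_contra hne
            have n1 := right_ne_zero_of_mul hne
            have n2 := left_ne_zero_of_mul hne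
            have n3 : ¬(|u x| ≤ n ∨ K ≤ |u x|) := fun h' => n2 (hsupp' _ h')
            push Not at n3
            exact hz ⟨n3.2, hlt_of n1, Or.inl n3.1.le⟩
          rw [hz1, hz2, zero_mul, zero_mul, add_zero, abs_zero]
          exact hρ0 x
        obtain ⟨hux, hvx, hor⟩ := hz
        have hJ : ‖(a x (Du x) + Φ x (u x)) - (a x (Dv x) + Φ x (v x))‖ ≤
            |β| * (2 * |d x| + ‖g x‖ ^ (p - 1) + ‖k x‖ ^ (p - 1)) +
              2 * (|b x| * (1 + 2 * n) ^ (p - 1)) := by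
          rw [hgx hux, hkx hvx]
          have e1 : ∀ ξ : Eu N, ‖a x ξ‖ ≤ |β| * (|d x| + ‖ξ‖ ^ (p - 1)) := fun ξ =>
            (hagx ξ).trans (mul_le_mul_of_nonneg_right (le_abs_self β) (by positivity))
          have e2 : ∀ t : ℝ, |t| < K → ‖Φ x t‖ ≤ |b x| * (1 + 2 * n) ^ (p - 1) := fun t ht => by
            refine (hΦx t).trans ?_
            have : |t| ≤ 2 * n := ht.le
            gcongr
          calc _ ≤ (‖a x (Du x)‖ + ‖Φ x (u x)‖) + (‖a x (Dv x)‖ + ‖Φ x (v x)‖) :=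
                (norm_sub_le _ _).trans (add_le_add (norm_add_le _ _) (norm_add_le _ _))
            _ ≤ _ := by linarith [e1 (Du x), e1 (Dv x), e2 _ hux, e2 _ hvx]
        have hr1 : |h (u x) * deriv h (v x)| ≤ C / n := by
          rw [abs_mul]
          exact (mul_le_mul (hhabs _) (hh' _) (abs_nonneg _) zero_le_one).trans (one_mul _).le
        have hr2 : |deriv h (u x) * h (v x)| ≤ C / n := by
          rw [abs_mul]
          exact (mul_le_mul (hh' _) (hhabs _) (abs_nonneg _) hCn).trans (mul_one _).le
        refine (remainder_le hp hn (abs_nonneg β) hC hJ hr1 hr2).trans ?_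
        simp only [hρ]
        gcongr
        have e1 : 0 ≤ {x | n ≤ |u x|}.indicator (fun x => |b x| ^ q) x :=
          Set.indicator_nonneg (fun x _ => by positivity) x
        have e2 : 0 ≤ {x | n ≤ |v x|}.indicator (fun x => |b x| ^ q) x :=
          Set.indicator_nonneg (fun x _ => by positivity) x
        rw [← mul_add]
        gcongr
        rcases hor with h1 | h1
        · rw [Set.indicator_of_mem (show x ∈ {x | n ≤ |u x|} from h1)]
          linarith
        · rw [Set.indicator_of_mem (show x ∈ {x | n ≤ |v x|} from h1)]
          linarith
      have hfin := tested_sum_ge c1 c2 c3 (abs_arctan_le_two (m * s x))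
      simp only [Pi.add_apply, hodd, Real.arctan_neg, neg_sq]
      exact hfin)
    rw [integral_add' ((iu.add iv).add (hθi m)) (hρi.const_mul 2),
      integral_add' (iu.add iv) (hθi m), integral_add' iu iv, hsum, integral_const_mul,
      zero_add] at hle
    exact hle
  have hfinal : ∫ x, h (u x) * h (v x) * Ψ x ∂ν ≤ 2 * ∫ x, ρ x ∂ν := by
    have hl : Tendsto (fun m => (∫ x, θ m x ∂ν) + 2 * ∫ x, ρ x ∂ν) atTop
        (𝓝 (0 + 2 * ∫ x, ρ x ∂ν)) := hθlim.add_const _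
    rw [zero_add] at hl
    exact ge_of_tendsto hl ((eventually_ge_atTop 1).mono hkey)
  rw [hρint, ← mul_assoc] at hfinal
  exact hfinal

/-! ### Cutoffs, tails and the limit in the truncation level -/

/-- Cutoff functions of the values of a solution: `h = 1` on `[-n, n]`, `h = 0` off `[-2n, 2n]`. -/
theorem exists_cutoff : ∃ C : ℝ, 0 < C ∧ ∀ n : ℝ, 0 < n → ∃ h : ℝ → ℝ, ContDiff ℝ 1 h ∧
    (∃ K : ℝ≥0, LipschitzWith K h) ∧ HasCompactSupport h ∧ (∀ s, 0 ≤ h s) ∧ (∀ s, h s ≤ 1) ∧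
    (∀ s, |s| ≤ n → h s = 1) ∧ (∀ s, 2 * n ≤ |s| → h s = 0) ∧ (∀ s, |deriv h s| ≤ C / n) ∧
    (∀ s, |s| ≤ n ∨ 2 * n ≤ |s| → deriv h s = 0) := by
  obtain ⟨C, hC, hstep⟩ := exists_smooth_step
  refine ⟨C, hC, fun n hn => ?_⟩
  obtain ⟨G, hG, hG0, hG1, hGn, hGl, hG', hGz⟩ := hstep n (2 * n) hn (by linarith)
  have hder : ∀ s, deriv (fun s => 1 - G s) s = -deriv G s := fun s => deriv_const_sub 1
  have hbd : ∀ s, |deriv (fun s => 1 - G s) s| ≤ C / n := fun s => by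
    rw [hder, abs_neg]
    simpa [two_mul] using hG' s
  have hsm : ContDiff ℝ 1 fun s => 1 - G s := contDiff_const.sub hG
  have hz : ∀ s, 2 * n ≤ |s| → 1 - G s = 0 := fun s hs => by rw [hG1 s hs, sub_self]
  refine ⟨fun s => 1 - G s, hsm, ⟨(C / n).toNNReal, ?_⟩, ?_, fun s => by linarith [hGl s],
    fun s => by linarith [hGn s], fun s hs => by simp only [hG0 s hs, sub_zero], hz, hbd,
    fun s hs => by rw [hder, hGz s hs, neg_zero]⟩
  · refine lipschitzWith_of_nnnorm_deriv_le (hsm.differentiable one_ne_zero) fun s => ?_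
    rw [← NNReal.coe_le_coe, Real.coe_toNNReal _ (by positivity), coe_nnnorm]
    exact hbd s
  · refine HasCompactSupport.intro (isCompact_Icc (a := -(2 * n)) (b := 2 * n)) fun s hs => hz s ?_
    by_contra hlt
    exact hs (abs_le.1 (not_le.1 hlt).le)

/-- For p < N the exponent N/(p-1) exceeds p' on a finite measure space; for p = N the logarithmic
condition controls |b|^{p'}. This makes the convection flux of a truncation dual to its gradient. -/
theorem memLp_coefficient {N : ℕ} {p : ℝ} (hp : 1 < p) (hpN : p ≤ N) {X : Type*}
    [MeasurableSpace X] {μ : Measure X} [IsFiniteMeasure μ] {b : X → ℝ} (hb : AEMeasurable b μ)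
    (hb_lt : p < N → MemLp b (ENNReal.ofReal (N / (p - 1))) μ)
    (hb_eq : p = N → Integrable
      (fun x => (1 + |b x|) ^ ((N : ℝ) / (N - 1)) * (Real.log (1 + |b x|)) ^ (N - 1 : ℕ)) μ) :
    MemLp b (ENNReal.ofReal (p / (p - 1))) μ := by
  have hp1 : 0 < p - 1 := by linarith
  rcases hpN.lt_or_eq with h | h
  · exact (hb_lt h).mono_exponent (ENNReal.ofReal_le_ofReal (by gcongr))
  · have hq : 0 < p / (p - 1) := div_pos (by linarith) hp1
    have hi := hb_eq h
    rw [← h] at hi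
    rw [← integrable_norm_rpow_iff hb.aestronglyMeasurable (by simpa using hq)
      ENNReal.ofReal_ne_top, ENNReal.toReal_ofReal hq.le]
    exact integrable_rpow_of_integrable_log hq (N - 1) hb hi

/-- The weighted tail of the convection coefficient over the superlevel sets of a function whose
truncations have energy `o(n)`. -/
theorem tendsto_weighted_tail {N : ℕ} (hN : 2 ≤ N) {Ω Γd : Set (Eu N)} (hΩo : IsOpen Ω)
    (hΩb : Bornology.IsBounded Ω) (hΩL : HasLipschitzBoundary Ω) {p : ℝ} (hp : 1 < p) (hpN : p ≤ N)
    {b : Eu N → ℝ} (hb : AEMeasurable b (volume.restrict Ω))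
    (hb_lt : p < N → MemLp b (ENNReal.ofReal (N / (p - 1))) (volume.restrict Ω))
    (hb_eq : p = N → IntegrableOn
      (fun x => (1 + |b x|) ^ ((N : ℝ) / (N - 1)) * (Real.log (1 + |b x|)) ^ (N - 1 : ℕ)) Ω)
    {u : Eu N → ℝ} {Du : Eu N → Eu N} (hu : AEMeasurable u (volume.restrict Ω))
    (hW : ∀ k : ℝ, 0 < k → MemW1Gamma Ω Γd (ENNReal.ofReal p) (fun x => trunc k (u x)))
    (hD : IsGeneralizedGradient Ω u Du)
    (hE : Tendsto (fun n : ℕ => (1 / (n : ℝ)) *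
      ∫ x in Ω, ‖{x | |u x| < (n : ℝ)}.indicator Du x‖ ^ p) atTop (𝓝 0)) :
    Tendsto (fun i : ℕ => ((2 : ℝ) ^ i) ^ (p - 1) *
      ∫ x in Ω, {x | (2 : ℝ) ^ i ≤ |u x|}.indicator (fun x => |b x| ^ (p / (p - 1))) x)
      atTop (𝓝 0) := by
  have : IsFiniteMeasure (volume.restrict Ω) := ⟨by simpa using hΩb.measure_lt_top⟩
  have hDp := memLp_truncated_gradient hp hΩo hW hD
  obtain ⟨C, k₀, hC, -, hlev⟩ := exists_level_estimate hN hΩo hΩb hΩL hp hu hW hD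
  rcases hpN.lt_or_eq with h | h
  · exact tendsto_weighted_tail_of_lt hp h hu hDp hE hC hlev (hb_lt h)
  · have hi : Integrable (fun x => (1 + |b x|) ^ (p / (p - 1)) *
        (Real.log (1 + |b x|)) ^ (N - 1 : ℕ)) (volume.restrict Ω) := by
      have := hb_eq h
      rwa [← h] at this
    rw [← h] at hlev
    exact tendsto_weighted_tail_of_exp hN h hu
      (exists_measure_superlevel_le_exp hp hDp hE hC hlev hu) hb
      (integrable_rpow_of_integrable_log (div_pos (by linarith) (by linarith)) (N - 1) hb hi) hi

/-- A nonnegative function whose cut off integrals tend to zero vanishes almost everywhere. -/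
theorem ae_eq_zero_of_tendsto_integral_cutoff {X : Type*} [MeasurableSpace X] {μ : Measure X}
    {χ : ℕ → X → ℝ} {Ψ : X → ℝ} {R : ℕ → ℝ} (hΨ : ∀ᵐ x ∂μ, 0 ≤ Ψ x) (hχ : ∀ i x, 0 ≤ χ i x)
    (hχ1 : ∀ᵐ x ∂μ, ∀ᶠ i in atTop, χ i x = 1)
    (hInt : ∀ i, Integrable (fun x => χ i x * Ψ x) μ) (hle : ∀ i, ∫ x, χ i x * Ψ x ∂μ ≤ R i)
    (hR : Tendsto R atTop (𝓝 0)) : Ψ =ᵐ[μ] 0 := by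
  have hnn : ∀ i, ∀ᵐ x ∂μ, 0 ≤ χ i x * Ψ x := fun i =>
    hΨ.mono fun x hx => mul_nonneg (hχ i x) hx
  have hl : Tendsto (fun i => ∫⁻ x, ENNReal.ofReal (χ i x * Ψ x) ∂μ) atTop (𝓝 0) := by
    refine tendsto_of_tendsto_of_tendsto_of_le_of_le tendsto_const_nhds
      (by simpa using ENNReal.tendsto_ofReal hR) (fun i => bot_le) fun i => ?_
    rw [← ofReal_integral_eq_lintegral_ofReal (hInt i) (hnn i)]
    exact ENNReal.ofReal_le_ofReal (hle i)
  have hlim : ∀ᵐ x ∂μ, Tendsto (fun i => ENNReal.ofReal (χ i x * Ψ x)) atTop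
      (𝓝 (ENNReal.ofReal (Ψ x))) := hχ1.mono fun x hx =>
    tendsto_const_nhds.congr' (hx.mono fun i hi => by simp only [hi, one_mul])
  have hm : ∀ i, AEMeasurable (fun x => ENNReal.ofReal (χ i x * Ψ x)) μ := fun i =>
    (hInt i).1.aemeasurable.ennreal_ofReal
  -- Integrability of Ψ itself is not known, so the limit is taken in extended nonnegative
  -- integrals.
  have hfatou := lintegral_liminf_le' (u := atTop) hm
  rw [hl.liminf_eq, nonpos_iff_eq_zero, lintegral_congr_ae (hlim.mono fun x hx => hx.liminf_eq),
    lintegral_eq_zero_iff' (aemeasurable_of_tendsto_metrizable_ae atTop hm hlim)] at hfatou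
  filter_upwards [hfatou, hΨ] with x h1 h2
  exact le_antisymm (ENNReal.ofReal_eq_zero.1 h1) h2

theorem mul_arctan_pos {D r r' : ℝ} (h : 0 < D * (r - r')) : 0 < D * Real.arctan (r - r') := by
  rcases pos_and_pos_or_neg_and_neg_of_mul_pos h with ⟨h1, h2⟩ | ⟨h1, h2⟩
  · exact mul_pos h1 (Real.arctan_pos.2 h2)
  · exact mul_pos_of_neg_of_neg h1 (Real.arctan_lt_zero.2 h2)

end RenormalizedUniqueness

/-! ### Uniqueness of the renormalized solution -/

open RenormalizedUniqueness in
theorem theorem4p1 (N : ℕ) (hN : 2 ≤ N) (p : ℝ) (hp1 : 1 < p) (hpN : p ≤ N)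
    (Ω Γn Γd : Set (Eu N)) (hΩo : IsOpen Ω) (hΩb : Bornology.IsBounded Ω) (hΩc : IsConnected Ω)
    (hΩL : HasLipschitzBoundary Ω)
    (hΓ : Γn ∪ Γd = frontier Ω) (hΓ' : Γn ∩ Γd = ∅) (hΓd : 0 < surfaceMeasure N Γd)
    (a : Eu N → Eu N → Eu N) (lam : Eu N → ℝ → ℝ) (Φ : Eu N → ℝ → Eu N) (f b d : Eu N → ℝ)
    (α β : ℝ)
    (ha : IsCaratheodory Ω a) (hlam : IsCaratheodory Ω lam) (hΦ : IsCaratheodory Ω Φ)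
    (hα : 0 < α)
    (ha_coercive : ∀ᵐ x ∂(volume.restrict Ω), ∀ ξ : Eu N, α * ‖ξ‖ ^ p ≤ ⟪a x ξ, ξ⟫)
    (ha_mono : ∀ᵐ x ∂(volume.restrict Ω), ∀ ξ ξ' : Eu N, 0 ≤ ⟪a x ξ - a x ξ', ξ - ξ'⟫)
    (ha_growth : ∀ᵐ x ∂(volume.restrict Ω), ∀ ξ : Eu N,
      ‖a x ξ‖ ≤ β * (|d x| + ‖ξ‖ ^ (p - 1)))
    (hd : MemLp d (ENNReal.ofReal (p / (p - 1))) (volume.restrict Ω))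
    (hlam_sign : ∀ᵐ x ∂(volume.restrict Ω), ∀ s : ℝ, 0 ≤ lam x s * s)
    (hlam_bdd : ∀ k : ℝ, 0 < k → ∃ c : ℝ, 0 < c ∧
      ∀ᵐ x ∂(volume.restrict Ω), ∀ s : ℝ, |s| ≤ k → |lam x s| ≤ c)
    (hΦ_growth : ∀ᵐ x ∂(volume.restrict Ω), ∀ s : ℝ, ‖Φ x s‖ ≤ |b x| * (1 + |s|) ^ (p - 1))
    (hb : AEMeasurable b (volume.restrict Ω))
    (hb_lt : p < N → MemLp b (ENNReal.ofReal (N / (p - 1))) (volume.restrict Ω))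
    (hb_eq : p = N → IntegrableOn
      (fun x => (1 + |b x|) ^ ((N : ℝ) / (N - 1)) * (Real.log (1 + |b x|)) ^ (N - 1 : ℕ)) Ω)
    (hf : IntegrableOn f Ω)
    (hlam_strict : ∀ᵐ x ∂(volume.restrict Ω), ∀ r r' : ℝ, r ≠ r' →
      0 < (lam x r - lam x r') * (r - r'))
    (hΦ_lip : ∀ C : Set ℝ, IsCompact C → ∃ L : ℝ, 0 < L ∧
      ∀ᵐ x ∂(volume.restrict Ω), ∀ r ∈ C, ∀ r' ∈ C, ‖Φ x r - Φ x r'‖ ≤ L * |b x| * |r - r'|)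
    (u v : Eu N → ℝ)
    (hu : IsRenormalizedSolution Ω Γd p a lam Φ f u)
    (hv : IsRenormalizedSolution Ω Γd p a lam Φ f v) :
    u =ᵐ[volume.restrict Ω] v := by
  have : IsFiniteMeasure (volume.restrict Ω) := ⟨by simpa using hΩb.measure_lt_top⟩
  obtain ⟨hum, huW, Du, hDu, hEu, hequ⟩ := hu
  obtain ⟨hvm, hvW, Dv, hDv, hEv, heqv⟩ := hv
  have hbq := memLp_coefficient hp1 hpN hb hb_lt hb_eq
  have hEu' := tendsto_energy hp1 hα hum (ha.aemeasurable_comp hDu.1)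
    (ha_coercive.mono fun x hx => hx _) (ha_growth.mono fun x hx => hx _) hd
    (memLp_truncated_gradient hp1 hΩo huW hDu) hEu
  have hEv' := tendsto_energy hp1 hα hvm (ha.aemeasurable_comp hDv.1)
    (ha_coercive.mono fun x hx => hx _) (ha_growth.mono fun x hx => hx _) hd
    (memLp_truncated_gradient hp1 hΩo hvW hDv) hEv
  have htu := tendsto_weighted_tail hN hΩo hΩb hΩL hp1 hpN hb hb_lt hb_eq hum huW hDu hEu'
  have htv := tendsto_weighted_tail hN hΩo hΩb hΩL hp1 hpN hb hb_lt hb_eq hvm hvW hDv hEv'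
  obtain ⟨C, hC, hcut⟩ := exists_cutoff
  have hpow : ∀ i : ℕ, (1 : ℝ) ≤ 2 ^ i := fun i => one_le_pow₀ one_le_two
  -- The truncation levels are n = 2^i, those along which the weighted tails are known to vanish.
  choose h hh hlip hcpt h0 h1 hone hsupp hder hder0 using
    fun i : ℕ => hcut (2 ^ i) (zero_lt_one.trans_le (hpow i))
  have henergy : ∀ {E : ℝ → ℝ}, Tendsto (fun n : ℕ => (1 / (n : ℝ)) * E n) atTop (𝓝 0) →
      Tendsto (fun i : ℕ => 1 / (2 : ℝ) ^ i * E (2 * 2 ^ i)) atTop (𝓝 0) := fun {E} hE => by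
    -- Energies are taken at height 2n = 2^{i+1} but divided by n = 2^i; the discrepancy is the
    -- factor 2.
    have e1 := (hE.comp ((tendsto_pow_atTop_atTop_of_one_lt (by norm_num : 1 < 2)).comp
      (tendsto_add_atTop_nat 1))).const_mul 2
    rw [mul_zero] at e1
    refine e1.congr fun i => ?_
    simp only [Function.comp_apply, Nat.cast_pow, Nat.cast_ofNat]
    rw [pow_succ', ← mul_assoc]
    congr 1
    field_simp
  have hdl : Tendsto (fun i : ℕ => 1 / (2 : ℝ) ^ i * ∫ x in Ω, |d x| ^ (p / (p - 1))) atTop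
      (𝓝 0) := by
    refine henergy (E := fun _ => ∫ x in Ω, |d x| ^ (p / (p - 1))) ?_
    simpa using tendsto_one_div_atTop_nhds_zero_nat.mul_const (∫ x in Ω, |d x| ^ (p / (p - 1)))
  -- The right side of the contraction estimate tends to 0, its constant being independent of i. The
  -- Lipschitz constants of Φ on [-2n, 2n], which may grow with n, disappeared when m → ∞ at fixed
  -- n.
  have hR := ((((hdl.add (henergy (E := fun r => ∫ x in Ω,
    ‖{x | |u x| < r}.indicator Du x‖ ^ p) hEu')).add (henergy (E := fun r => ∫ x in Ω,
    ‖{x | |v x| < r}.indicator Dv x‖ ^ p) hEv')).add (htu.add htv)).const_mul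
      (2 * (C * (6 * |β| + 4 * 3 ^ (p - 1)) * 2 ^ p)))
  choose c _ hc using fun i : ℕ => hlam_bdd (2 * 2 ^ i) (by positivity)
  choose L hL hLip using
    fun i : ℕ => hΦ_lip (Set.Icc (-(2 * 2 ^ i)) (2 * 2 ^ i)) isCompact_Icc
  have hest := fun i =>
    integral_cutoff_le hp1 hΩo hΩb ha hlam hΦ ha_mono ha_growth hd hΦ_growth hbq hlam_strict
      (hpow i) (hL i) hC.le (hc i) (hLip i) (hh i) (h0 i) (h1 i) (hder i) (hsupp i) (hder0 i) hum hvm huW hvW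
      hDu hDv (hequ (h i) (hlip i) (hcpt i)) (heqv (h i) (hlip i) (hcpt i))
  have hpos : ∀ᵐ x ∂(volume.restrict Ω), u x ≠ v x →
      0 < (lam x (u x) - lam x (v x)) * Real.arctan (u x - v x) :=
    hlam_strict.mono fun x hx hne => mul_arctan_pos (hx _ _ hne)
  have hzero := ae_eq_zero_of_tendsto_integral_cutoff
    (Ψ := fun x => (lam x (u x) - lam x (v x)) * Real.arctan (u x - v x))
    (χ := fun i x => h i (u x) * h i (v x))
    (hpos.mono fun x hx => by
      by_cases huv : u x = v x
      · simp [huv]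
      · exact (hx huv).le)
    (fun i x => mul_nonneg (h0 i _) (h0 i _))
    (.of_forall fun x => by
      have hlim := (tendsto_pow_atTop_atTop_of_one_lt (one_lt_two (α := ℝ))).eventually_ge_atTop
        (max |u x| |v x|)
      filter_upwards [hlim] with i hi
      rw [hone i _ ((le_max_left _ _).trans hi), hone i _ ((le_max_right _ _).trans hi), one_mul])
    (fun i => (hest i).1) (fun i => (hest i).2) (by simpa only [← mul_add, add_zero, mul_zero] using hR)
  filter_upwards [hzero, hpos] with x hx hx'
  by_contra hne
  exact (hx' hne).ne' hx
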